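/- Write $\mathbb T^d=\mathbb R^d/\mathbb Z^d$ and $R_\alpha(x)=x+\alpha$. Let $\mathrm{Diff}^\infty_0(\mathbb T^d)$ be the set of $C^\infty$ diffeomorphisms of $\mathbb T^d$ that are isotopic to the identity. For $f,g\in \mathrm{Diff}^\infty_0(\mathbb T^d)$ and $s\in\mathbb N$ let $$d_s(f,g)=\min_{F,G}\ \max_{0\le\sigma\le s}\ \sup_{x\in\mathbb R^d}\|D^\sigma F(x)-D^\sigma G(x)\|,$$ where $F,G:\mathbb R^d\to\mathbb R^d$ run over the lifts of $f,g$. A point $\alpha\in\mathbb T^d$ is Diophantine of type $(\gamma,\tau)$ if for all $k\in\mathbb Z^d\setminus\{0\}$ the distance of $k\cdot\alpha$ to the nearest integer is at least $\gamma^{-1}|k|^{-\tau}$, where $|k|=\sum_i|k_i|$. The measure rotation set $\rho_{\mathrm{meas}}(f)\subseteq\mathbb T^d$ is the set of the vectors $\int_{\mathbb T^d}(F(\tilde x)-\tilde x)\,d\nu(x)\bmod\mathbb Z^d$, where $\nu$ runs over the $f$-invariant Borel probability measures on $\mathbb T^d$, $F$ is a lift of $f$ and $\tilde x\in\mathbb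 R^d$ represents $x$. **Theorem.** Let $d\ge 1$, $\gamma>0$ and $\tau>d$. There are $\varepsilon>0$ and an integer $s_0>0$, and for all $s\in\mathbb N$ and $\eta>0$ there are $\delta_{s,\eta}>0$ and $s_1(s,\eta)\in\mathbb N$, all depending only on the data named and on $d,\gamma,\tau$, with the following property. Let $\alpha\in\mathbb T^d$ be Diophantine of type $(\gamma,\tau)$ and let $f\in\mathrm{Diff}^\infty_0(\mathbb T^d)$ satisfy $d_0(f,R_\alpha)<\varepsilon$, $d_{s_0}(f,R_\alpha)<1$ and $\alpha\in\rho_{\mathrm{meas}}(f)$. Then $f$ is $C^\infty$-conjugate to $R_\alpha$: there is $\varphi\in\mathrm{Diff}^\infty_0(\mathbb T^d)$ with $\varphi\circ f=R_\alpha\circ\varphi$. Moreover, $\varphi$ can be chosen close to the identity, in the following sense: for all $s\in\mathbb N$ and $\eta>0$, if $d_0(f,R_\alpha)<\delta_{s,\eta}$ and $d_{s_1(s,\eta)}(f,R_\alpha)<1$, then $d_s(\varphi,\mathrm{Id})<\eta$. -/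

import Mathlib

open MeasureTheory Set
open scoped ContDiff

noncomputable section

/-- The torus `ℝᵈ / ℤᵈ`. -/
abbrev Torus (d : ℕ) : Type := UnitAddTorus (Fin d)

/-- The covering space `ℝᵈ`, with the Euclidean norm. -/
abbrev Cover (d : ℕ) : Type := EuclideanSpace ℝ (Fin d)

/-- The covering map `ℝᵈ → ℝᵈ / ℤᵈ`. -/
def Torus.proj {d : ℕ} (x : Cover d) : Torus d := fun i => (x i : UnitAddCircle)

/-- The representative in `[0, 1)ᵈ` of a point of the torus. -/
def Torus.rep {d : ℕ} (x : Torus d) : Cover d :=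
  WithLp.toLp 2 fun i => (AddCircle.equivIco (1 : ℝ) 0 (x i) : ℝ)

theorem Torus.proj_rep {d : ℕ} (x : Torus d) : Torus.proj (Torus.rep x) = x := by
  funext i
  exact AddCircle.coe_equivIco (p := (1 : ℝ)) (a := 0)

/-- The rotation (translation) `x ↦ x + α` of the torus. -/
def Torus.rotation {d : ℕ} (α : Torus d) : Torus d → Torus d := fun x => x + α

/-- `F` is a (continuous) lift of the self-map `f` of the torus. -/
def IsLift {d : ℕ} (F : Cover d → Cover d) (f : Torus d → Torus d) : Prop :=
  Continuous F ∧ ∀ x, Torus.proj (F x) = f (Torus.proj x)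

/-- A self-map of the torus is `C^∞` when it has a `C^∞` lift. (Every continuous self-map has a
continuous lift, and the covering map is a local diffeomorphism.) -/
def IsSmoothTorusMap {d : ℕ} (f : Torus d → Torus d) : Prop :=
  ∃ F : Cover d → Cover d, ContDiff ℝ ∞ F ∧ IsLift F f

/-- `Diff^∞(𝕋ᵈ)`: bijections of the torus that are `C^∞` with `C^∞` inverse. -/
structure TorusDiffeo (d : ℕ) extends Torus d ≃ Torus d where
  smooth_toFun : IsSmoothTorusMap toFun
  smooth_invFun : IsSmoothTorusMap invFun

instance {d : ℕ} : CoeFun (TorusDiffeo d) (fun _ => Torus d → Torus d) := ⟨fun f => f.toFun⟩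

/-- `Diff^∞_0(𝕋ᵈ)`: the diffeomorphisms that are joined to the identity by a smooth isotopy, that
is, by a family, smooth in `(t, x) ∈ [0, 1] × 𝕋ᵈ`, of diffeomorphisms of the torus. The isotopy is
written through a lift `H t` of its time-`t` map. -/
def IsotopicToId {d : ℕ} (f : TorusDiffeo d) : Prop :=
  ∃ H : ℝ → Cover d → Cover d,
    ContDiffOn ℝ ∞ (Function.uncurry H) (Icc (0 : ℝ) 1 ×ˢ univ) ∧
    (∀ t ∈ Icc (0 : ℝ) 1, ∃ g : TorusDiffeo d, IsLift (H t) g) ∧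
    IsLift (H 0) id ∧ IsLift (H 1) f

/-- The `C^s` distance
`d_s(f, g) = max_{0 ≤ σ ≤ s} sup_x ‖D^σ F(x) - D^σ G(x)‖`, the lifts `F` of `f` and `G` of `g`
being chosen so as to make it least. (Lifts are unique up to addition of an integer vector, so the
choice matters for `σ = 0` only.) -/
def torusDist {d : ℕ} (s : ℕ) (f g : Torus d → Torus d) : ENNReal :=
  ⨅ (F : Cover d → Cover d) (_ : IsLift F f) (G : Cover d → Cover d) (_ : IsLift G g),
    ⨆ (σ : ℕ) (_ : σ ≤ s) (x : Cover d),
      ‖iteratedFDeriv ℝ σ F x - iteratedFDeriv ℝ σ G x‖ₑ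

/-- The Diophantine condition of type `(γ, τ)`: for all `k ∈ ℤᵈ \ {0}`, the distance of `k · α` to
the nearest integer is at least `γ⁻¹ / |k|^τ`, with the `ℓ¹` norm on `ℤᵈ`. (The norm of
`UnitAddCircle` is the distance to the nearest integer.) -/
def IsDiophantine {d : ℕ} (γ τ : ℝ) (α : Torus d) : Prop :=
  ∀ k : Fin d → ℤ, k ≠ 0 →
    γ⁻¹ / ((∑ i, |k i| : ℤ) : ℝ) ^ τ ≤ ‖∑ i, k i • α i‖

/-- The mean displacement `∫ (F(x̃) - x̃) dν` of a lift `F` against a measure on the torus. When `F`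
lifts a map homotopic to the identity, the integrand does not depend on the representative `x̃`. -/
def meanDisplacement {d : ℕ} (ν : Measure (Torus d)) (F : Cover d → Cover d) : Cover d :=
  ∫ x : Torus d, (F (Torus.rep x) - Torus.rep x) ∂ν

/-- The measure rotation set `ρ_meas(f) ⊆ 𝕋ᵈ`: the rotation vectors `∫ (F(x̃) - x̃) dν mod ℤᵈ` of the
`f`-invariant Borel probability measures `ν`. -/
def measRotationSet {d : ℕ} (f : Torus d → Torus d) : Set (Torus d) :=
  {β | ∃ ν : Measure (Torus d), IsProbabilityMeasure ν ∧ MeasurePreserving f ν ν ∧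
    ∃ F : Cover d → Cover d, IsLift F f ∧ β = Torus.proj (meanDisplacement ν F)}

end

namespace TorusKAM

section Mean

variable {d : ℕ}

/-- The complexification `ℂᵈ` of the covering space. -/
abbrev CCover (d : ℕ) : Type := EuclideanSpace ℂ (Fin d)

/-- An integer vector, as a point of the covering space. -/
noncomputable def intVec (k : Fin d → ℤ) : Cover d := WithLp.toLp 2 fun i => (k i : ℝ)

@[simp] lemma intVec_apply (k : Fin d → ℤ) (i : Fin d) : intVec k i = k i := rfl

lemma intVec_zero : intVec (0 : Fin d → ℤ) = 0 := by ext i; simp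

lemma intVec_add (k l : Fin d → ℤ) : intVec (k + l) = intVec k + intVec l := by ext i; simp

lemma intVec_neg (k : Fin d → ℤ) : intVec (-k) = -intVec k := by ext i; simp

lemma intVec_sub (k l : Fin d → ℤ) : intVec (k - l) = intVec k - intVec l := by ext i; simp

lemma abs_apply_le_norm (x : Cover d) (i : Fin d) : |x i| ≤ ‖x‖ := by
  simpa using PiLp.norm_apply_le x i

lemma one_le_norm_intVec {k : Fin d → ℤ} (hk : k ≠ 0) : 1 ≤ ‖intVec k‖ := by
  obtain ⟨i, hi⟩ := Function.ne_iff.1 hk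
  have h1 : (1 : ℝ) ≤ |(k i : ℝ)| := by exact_mod_cast Int.one_le_abs hi
  exact h1.trans (abs_apply_le_norm (intVec k) i)

/-- The inclusion `ℝᵈ → ℂᵈ`. -/
noncomputable def incl : Cover d →L[ℝ] CCover d :=
  LinearMap.mkContinuous
    { toFun := fun x => WithLp.toLp 2 fun i => (x i : ℂ)
      map_add' := fun x y => by ext i; simp
      map_smul' := fun c x => by ext i; simp } 1
    (fun x => by simp [EuclideanSpace.norm_eq])

/-- The imaginary part `ℂᵈ → ℝᵈ`. -/
noncomputable def imPart : CCover d →L[ℝ] Cover d :=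
  LinearMap.mkContinuous
    { toFun := fun z => WithLp.toLp 2 fun i => (z i).im
      map_add' := fun x y => by ext i; simp
      map_smul' := fun c x => by ext i; simp } 1
    (fun z => by
      simp only [EuclideanSpace.norm_eq, LinearMap.coe_mk, AddHom.coe_mk, one_mul]
      refine Real.sqrt_le_sqrt (Finset.sum_le_sum fun i _ => ?_)
      gcongr
      exact Complex.abs_im_le_norm _)

/-- The real part `ℂᵈ → ℝᵈ`. -/
noncomputable def rePart : CCover d →L[ℝ] Cover d :=
  LinearMap.mkContinuous
    { toFun := fun z => WithLp.toLp 2 fun i => (z i).re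
      map_add' := fun x y => by ext i; simp
      map_smul' := fun c x => by ext i; simp } 1
    (fun z => by
      simp only [EuclideanSpace.norm_eq, LinearMap.coe_mk, AddHom.coe_mk, one_mul]
      refine Real.sqrt_le_sqrt (Finset.sum_le_sum fun i _ => ?_)
      gcongr
      exact Complex.abs_re_le_norm _)

@[simp] lemma incl_apply (x : Cover d) (i : Fin d) : incl x i = (x i : ℂ) := rfl
@[simp] lemma imPart_apply (z : CCover d) (i : Fin d) : imPart z i = (z i).im := rfl
@[simp] lemma rePart_apply (z : CCover d) (i : Fin d) : rePart z i = (z i).re := rfl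

@[simp] lemma norm_incl (x : Cover d) : ‖incl x‖ = ‖x‖ := by simp [EuclideanSpace.norm_eq]

lemma norm_imPart_le (z : CCover d) : ‖imPart z‖ ≤ ‖z‖ := by
  have := (imPart (d := d)).le_of_opNorm_le (LinearMap.mkContinuous_norm_le _ zero_le_one _) z
  simpa using this

lemma opNorm_rePart_le : ‖(rePart : CCover d →L[ℝ] Cover d)‖ ≤ 1 :=
  LinearMap.mkContinuous_norm_le _ zero_le_one _

lemma opNorm_incl_le : ‖(incl : Cover d →L[ℝ] CCover d)‖ ≤ 1 :=
  LinearMap.mkContinuous_norm_le _ zero_le_one _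

@[simp] lemma imPart_incl (x : Cover d) : imPart (incl x) = 0 := by ext i; simp
@[simp] lemma rePart_incl (x : Cover d) : rePart (incl x) = x := by ext i; simp

lemma incl_injective : Function.Injective (incl : Cover d → CCover d) := fun x y h => by
  simpa using congrArg rePart h

lemma incl_rePart_add (z : CCover d) : incl (rePart z) + Complex.I • incl (imPart z) = z := by
  ext i
  simp [mul_comm Complex.I, Complex.re_add_im]

lemma imPart_I_smul_incl (y : Cover d) : imPart (Complex.I • incl y) = y := by
  ext i; simp

lemma incl_rePart_of_imPart_eq_zero {z : CCover d} (h : imPart z = 0) : incl (rePart z) = z := by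
  conv_rhs => rw [← incl_rePart_add z, h]
  simp

/-- Invariance under integer translations. -/
def IsPeriodic {F : Type*} (u : Cover d → F) : Prop := ∀ x k, u (x + intVec k) = u x

lemma proj_add (x y : Cover d) : Torus.proj (x + y) = Torus.proj x + Torus.proj y := by
  funext i; simp [Torus.proj]

lemma proj_intVec (k : Fin d → ℤ) : Torus.proj (intVec k) = 0 := by
  funext i
  simp only [Torus.proj, intVec_apply, Pi.zero_apply]
  rw [AddCircle.coe_eq_zero_iff]
  exact ⟨k i, by simp⟩

lemma proj_eq_iff {x y : Cover d} : Torus.proj x = Torus.proj y ↔ ∃ k, y = x + intVec k := by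
  constructor
  · intro h
    have : ∀ i, ∃ n : ℤ, y i = x i + n := by
      intro i
      have hi := congrFun h.symm i
      simp only [Torus.proj] at hi
      rw [← sub_eq_zero, ← AddCircle.coe_sub, AddCircle.coe_eq_zero_iff] at hi
      obtain ⟨n, hn⟩ := hi
      exact ⟨n, by simp at hn; linarith⟩
    choose k hk using this
    exact ⟨k, by ext i; simp [hk]⟩
  · rintro ⟨k, rfl⟩
    rw [proj_add, proj_intVec, add_zero]

lemma proj_add_intVec (x : Cover d) (k : Fin d → ℤ) :
    Torus.proj (x + intVec k) = Torus.proj x := (proj_eq_iff.2 ⟨k, rfl⟩).symm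

lemma IsPeriodic.eq_of_proj_eq {F : Type*} {u : Cover d → F} (hu : IsPeriodic u) {x y : Cover d}
    (h : Torus.proj x = Torus.proj y) : u x = u y := by
  obtain ⟨k, rfl⟩ := proj_eq_iff.1 h
  exact (hu x k).symm

lemma IsPeriodic.rep_proj {F : Type*} {u : Cover d → F} (hu : IsPeriodic u) (x : Cover d) :
    u (Torus.rep (Torus.proj x)) = u x := hu.eq_of_proj_eq (Torus.proj_rep _)

lemma isOpenQuotientMap_proj : IsOpenQuotientMap (Torus.proj : Cover d → Torus d) := by
  have h1 : IsOpenQuotientMap (Pi.map fun (_ : Fin d) (t : ℝ) => (t : UnitAddCircle)) :=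
    IsOpenQuotientMap.piMap fun _ => QuotientAddGroup.isOpenQuotientMap_mk
  have h2 : IsOpenQuotientMap (EuclideanSpace.equiv (Fin d) ℝ) :=
    (EuclideanSpace.equiv (Fin d) ℝ).toHomeomorph.isOpenQuotientMap
  exact h1.comp h2

lemma proj_surjective : Function.Surjective (Torus.proj : Cover d → Torus d) :=
  fun x => ⟨_, Torus.proj_rep x⟩

lemma IsPeriodic.continuous_rep {F : Type*} [TopologicalSpace F] {u : Cover d → F}
    (hu : IsPeriodic u) (hc : Continuous u) : Continuous fun x : Torus d => u (Torus.rep x) := by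
  rw [isOpenQuotientMap_proj.isQuotientMap.continuous_iff]
  exact hc.congr fun x => (hu.rep_proj x).symm

/-- The normalized Haar measure of the torus. -/
noncomputable def haar (d : ℕ) : Measure (Torus d) := Measure.pi fun _ => AddCircle.haarAddCircle

instance : IsProbabilityMeasure (haar d) := by unfold haar; infer_instance

instance : (haar d).IsAddRightInvariant := by
  have : (haar d).IsAddLeftInvariant := by unfold haar; infer_instance
  infer_instance

lemma fderiv_add_period {𝕜 E F : Type*} [NontriviallyNormedField 𝕜] [NormedAddCommGroup E]
    [NormedSpace 𝕜 E] [NormedAddCommGroup F] [NormedSpace 𝕜 F] {u : E → F} {p : E}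
    (h : ∀ x, u (x + p) = u x) (x : E) : fderiv 𝕜 u (x + p) = fderiv 𝕜 u x := by
  rw [← fderiv_comp_add_right]
  congr 1
  exact funext h

lemma IsPeriodic.integrable {F : Type*} [NormedAddCommGroup F] {u : Cover d → F} (hu : IsPeriodic u) (hc : Continuous u) :
    Integrable (fun x => u (Torus.rep x)) (haar d) :=
  (hu.continuous_rep hc).integrable_of_hasCompactSupport (HasCompactSupport.of_compactSpace _)

lemma IsPeriodic.exists_bound {F : Type*} [NormedAddCommGroup F] {u : Cover d → F} (hu : IsPeriodic u) (hc : Continuous u) :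
    ∃ C, 0 ≤ C ∧ ∀ x, ‖u x‖ ≤ C := by
  obtain ⟨C, hC⟩ := isCompact_univ.exists_bound_of_continuousOn (hu.continuous_rep hc).continuousOn
  refine ⟨max C 0, le_max_right _ _, fun x => ?_⟩
  rw [← hu.rep_proj x]
  exact (hC _ (mem_univ _)).trans (le_max_left _ _)

variable {F : Type*} [NormedAddCommGroup F] [NormedSpace ℝ F]

/-- The mean over the torus of a periodic function. -/
noncomputable def mean (u : Cover d → F) : F := ∫ x, u (Torus.rep x) ∂haar d

lemma mean_const [CompleteSpace F] (c : F) : mean (fun _ : Cover d => c) = c := by simp [mean]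

lemma norm_mean_le {u : Cover d → F} {C : ℝ} (h : ∀ x, ‖u x‖ ≤ C) : ‖mean u‖ ≤ C := by
  have := norm_integral_le_of_norm_le_const (μ := haar d)
    (Filter.Eventually.of_forall fun x => h (Torus.rep x))
  simpa [mean] using this

lemma IsPeriodic.mean_translate {u : Cover d → F} (hu : IsPeriodic u) (y : Cover d) :
    mean (fun x => u (x + y)) = mean u := by
  unfold mean
  rw [← integral_add_right_eq_self (fun x => u (Torus.rep x)) (Torus.proj y)]
  refine integral_congr_ae (Filter.Eventually.of_forall fun x => ?_)
  refine hu.eq_of_proj_eq ?_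
  rw [Torus.proj_rep, proj_add, Torus.proj_rep]

lemma IsPeriodic.mean_add {u v : Cover d → F} (hu : IsPeriodic u) (hv : IsPeriodic v)
    (cu : Continuous u) (cv : Continuous v) : mean (fun x => u x + v x) = mean u + mean v :=
  integral_add (hu.integrable cu) (hv.integrable cv)

lemma IsPeriodic.mean_clm {G : Type*} [NormedAddCommGroup G] [NormedSpace ℝ G] [CompleteSpace F]
    [CompleteSpace G] {u : Cover d → F} (hu : IsPeriodic u) (cu : Continuous u) (L : F →L[ℝ] G) :
    mean (fun x => L (u x)) = L (mean u) :=
  L.integral_comp_comm (hu.integrable cu)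

/-- Differentiation under the mean, for a family with bounded derivative. -/
lemma hasDerivAt_mean {f f' : ℝ → Cover d → F} {t₀ δ C : ℝ} (hδ : 0 < δ)
    (hper : ∀ t ∈ Metric.ball t₀ δ, IsPeriodic (f t)) (hc : ∀ t ∈ Metric.ball t₀ δ, Continuous (f t))
    (hper' : IsPeriodic (f' t₀)) (hc' : Continuous (f' t₀))
    (hb : ∀ t ∈ Metric.ball t₀ δ, ∀ x, ‖f' t x‖ ≤ C)
    (hd : ∀ t ∈ Metric.ball t₀ δ, ∀ x, HasDerivAt (fun t => f t x) (f' t x) t) :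
    HasDerivAt (fun t => mean (f t)) (mean (f' t₀)) t₀ := by
  refine (hasDerivAt_integral_of_dominated_loc_of_deriv_le (μ := haar d) (bound := fun _ => C)
    (F := fun t x => f t (Torus.rep x)) (F' := fun t x => f' t (Torus.rep x))
    (Metric.ball_mem_nhds t₀ hδ) ?_ ?_ ?_ ?_ (integrable_const _) ?_).2
  · filter_upwards [Metric.ball_mem_nhds t₀ hδ] with t ht
    exact ((hper t ht).integrable (hc t ht)).aestronglyMeasurable
  · exact (hper _ (Metric.mem_ball_self hδ)).integrable (hc _ (Metric.mem_ball_self hδ))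
  · exact (hper'.integrable hc').aestronglyMeasurable
  · exact Filter.Eventually.of_forall fun x t ht => hb t ht _
  · exact Filter.Eventually.of_forall fun x t ht => hd t ht _

/-- The mean of a derivative vanishes. -/
lemma IsPeriodic.mean_fderiv {u : Cover d → F} (hu : IsPeriodic u) (hd : ContDiff ℝ 1 u)
    (y : Cover d) : mean (fun x => fderiv ℝ u x y) = 0 := by
  have hpf : IsPeriodic (fderiv ℝ u) := fun x k => fderiv_add_period (fun x => hu x k) x
  have hcf : Continuous (fderiv ℝ u) := hd.continuous_fderiv one_ne_zero
  obtain ⟨C, hC0, hC⟩ := hpf.exists_bound hcf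
  have key : HasDerivAt (fun t : ℝ => mean (fun x => u (x + t • y)))
      (mean (fun x => fderiv ℝ u (x + (0 : ℝ) • y) y)) 0 := by
    refine hasDerivAt_mean (f := fun t x => u (x + t • y))
      (f' := fun t x => fderiv ℝ u (x + t • y) y) (C := C * ‖y‖) one_pos ?_ ?_ ?_ ?_ ?_ ?_
    · intro t _ x k
      simp only
      rw [add_right_comm, hu]
    · intro t _
      exact hd.continuous.comp (by fun_prop)
    · intro x k
      simp only
      rw [add_right_comm, hpf]
    · simpa using hcf.clm_apply continuous_const
    · intro t _ x
      exact (ContinuousLinearMap.le_opNorm _ _).trans (by gcongr; exact hC _)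
    · intro t _ x
      have h1 : HasFDerivAt u (fderiv ℝ u (x + t • y)) (x + t • y) :=
        (hd.differentiable one_ne_zero _).hasFDerivAt
      have h2 : HasDerivAt (fun t : ℝ => x + t • y) y t := by
        simpa using ((hasDerivAt_id t).smul_const y).const_add x
      exact h1.comp_hasDerivAt t h2
  have h0 : (fun t : ℝ => mean (fun x => u (x + t • y))) = fun _ => mean u :=
    funext fun t => hu.mean_translate _
  rw [h0] at key
  simpa using key.unique (hasDerivAt_const _ _)

end Mean

section Characters

variable {d : ℕ}

/-- The linear form `z ↦ 2πi k · z`. -/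
noncomputable def phase (k : Fin d → ℤ) : CCover d →L[ℂ] ℂ :=
  (2 * Real.pi * Complex.I : ℂ) • ∑ i, (k i : ℂ) • EuclideanSpace.proj i

/-- The character `z ↦ exp (2πi k · z)`. -/
noncomputable def char (k : Fin d → ℤ) (z : CCover d) : ℂ := Complex.exp (phase k z)

lemma phase_apply (k : Fin d → ℤ) (z : CCover d) :
    phase k z = 2 * Real.pi * Complex.I * ∑ i, (k i : ℂ) * z i := by
  simp [phase]

lemma phase_neg (k : Fin d → ℤ) (z : CCover d) : phase (-k) z = -phase k z := by
  simp [phase_apply]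

lemma phase_zero (z : CCover d) : phase (0 : Fin d → ℤ) z = 0 := by
  simp [phase_apply]

lemma inner_intVec (k : Fin d → ℤ) (y : Cover d) : inner ℝ (intVec k) y = ∑ i, (k i : ℝ) * y i := by
  simp [PiLp.inner_apply, mul_comm]

lemma phase_incl (k : Fin d → ℤ) (y : Cover d) :
    phase k (incl y) = ((2 * Real.pi * inner ℝ (intVec k) y : ℝ) : ℂ) * Complex.I := by
  rw [phase_apply, inner_intVec]
  push_cast
  simp only [incl_apply]
  ring

lemma phase_re (k : Fin d → ℤ) (z : CCover d) :
    (phase k z).re = -(2 * Real.pi * inner ℝ (intVec k) (imPart z)) := by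
  rw [← incl_rePart_add z, map_add, map_smul, phase_incl, phase_incl]
  simp [imPart_I_smul_incl]

lemma char_add (k : Fin d → ℤ) (z w : CCover d) : char k (z + w) = char k z * char k w := by
  simp [char, Complex.exp_add]

lemma char_zero (z : CCover d) : char (0 : Fin d → ℤ) z = 1 := by simp [char, phase_zero]

lemma char_intVec (k l : Fin d → ℤ) : char k (incl (intVec l)) = 1 := by
  rw [char, Complex.exp_eq_one_iff]
  refine ⟨∑ i, k i * l i, ?_⟩
  rw [phase_apply]
  push_cast
  simp only [incl_apply, intVec_apply]
  push_cast
  ring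

lemma char_periodic (k l : Fin d → ℤ) (z : CCover d) : char k (z + incl (intVec l)) = char k z := by
  rw [char_add, char_intVec, mul_one]

lemma norm_char (k : Fin d → ℤ) (z : CCover d) :
    ‖char k z‖ = Real.exp (-(2 * Real.pi * inner ℝ (intVec k) (imPart z))) := by
  rw [char, Complex.norm_exp, phase_re]

lemma norm_char_incl (k : Fin d → ℤ) (x : Cover d) : ‖char k (incl x)‖ = 1 := by
  simp [norm_char]

lemma norm_char_le (k : Fin d → ℤ) {z : CCover d} {r : ℝ} (hz : ‖imPart z‖ ≤ r) :
    ‖char k z‖ ≤ Real.exp (2 * Real.pi * ‖intVec k‖ * r) := by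
  rw [norm_char, Real.exp_le_exp]
  have h := (abs_le.1 (abs_real_inner_le_norm (intVec k) (imPart z))).1
  have h2 : ‖intVec k‖ * ‖imPart z‖ ≤ ‖intVec k‖ * r := by gcongr
  nlinarith [Real.pi_pos]

lemma char_neg_incl (k : Fin d → ℤ) (x : Cover d) :
    char (-k) (incl x) = starRingEnd ℂ (char k (incl x)) := by
  rw [char, char, ← Complex.exp_conj, phase_neg, phase_incl]
  simp only [map_mul, Complex.conj_ofReal, Complex.conj_I, mul_neg]

lemma mFourier_proj (k : Fin d → ℤ) (x : Cover d) :
    UnitAddTorus.mFourier k (Torus.proj x) = char k (incl x) := by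
  simp only [UnitAddTorus.mFourier, ContinuousMap.coe_mk, Torus.proj, fourier_coe_apply, char,
    ← Complex.exp_sum, phase_apply, Finset.mul_sum, incl_apply]
  congr 1
  refine Finset.sum_congr rfl fun i _ => ?_
  simp
  ring

lemma hasFDerivAt_char (k : Fin d → ℤ) (z : CCover d) :
    HasFDerivAt (char k) (char k z • phase k) z :=
  (phase k).hasFDerivAt.cexp

lemma contDiff_char (k : Fin d → ℤ) {n : ℕ∞ω} : ContDiff ℂ n (char k : CCover d → ℂ) :=
  (phase k).contDiff.cexp

lemma continuous_char (k : Fin d → ℤ) : Continuous (char k : CCover d → ℂ) :=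
  (contDiff_char k (n := 0)).continuous

lemma norm_phase_le (k : Fin d → ℤ) : ‖phase k‖ ≤ 2 * Real.pi * ‖intVec k‖ := by
  refine ContinuousLinearMap.opNorm_le_bound _ (by positivity) fun z => ?_
  rw [phase_apply, norm_mul, mul_assoc (2 * Real.pi)]
  have h0 : ‖(2 * Real.pi * Complex.I : ℂ)‖ = 2 * Real.pi := by
    simp [abs_of_pos Real.pi_pos]
  rw [h0]
  refine mul_le_mul_of_nonneg_left ?_ (by positivity)
  have := norm_inner_le_norm (𝕜 := ℂ) (incl (intVec k)) z
  rw [norm_incl] at this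
  refine le_trans (le_of_eq ?_) this
  congr 1
  simp [PiLp.inner_apply, mul_comm]

/-- The open strip of width `r` around the real points. -/
def strip (d : ℕ) (r : ℝ) : Set (CCover d) := {z | ‖imPart z‖ < r}

lemma isOpen_strip (r : ℝ) : IsOpen (strip d r) :=
  isOpen_lt (by fun_prop) continuous_const

lemma convex_strip (r : ℝ) : Convex ℝ (strip d r) := by
  have : strip d r = imPart ⁻¹' Metric.ball 0 r := by ext z; simp [strip]
  rw [this]
  exact (convex_ball _ _).linear_preimage imPart.toLinearMap

lemma strip_mono {r s : ℝ} (h : r ≤ s) : strip d r ⊆ strip d s := fun _ hz => lt_of_lt_of_le hz h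

lemma incl_mem_strip {r : ℝ} (hr : 0 < r) (x : Cover d) : incl x ∈ strip d r := by
  simpa [strip] using hr

lemma add_incl_mem_strip {r : ℝ} {z : CCover d} (x : Cover d) :
    z + incl x ∈ strip d r ↔ z ∈ strip d r := by
  simp [strip]

/-- Invariance under integer translations, for functions of complex variables. -/
def CPeriodic {F : Type*} (u : CCover d → F) : Prop := ∀ z k, u (z + incl (intVec k)) = u z

lemma CPeriodic.real {F : Type*} {u : CCover d → F} (hu : CPeriodic u) :
    IsPeriodic fun x : Cover d => u (incl x) := fun x k => by
  simp only [map_add]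
  exact hu _ _

lemma CPeriodic.translate {F : Type*} {u : CCover d → F} (hu : CPeriodic u) (p : CCover d) :
    CPeriodic fun z => u (z + p) := fun z k => by
  simp only
  rw [add_right_comm, hu]

variable {F : Type*} [NormedAddCommGroup F] [NormedSpace ℂ F]

lemma CPeriodic.derivative {u : CCover d → F} (hu : CPeriodic u) : CPeriodic (fderiv ℂ u) :=
  fun z k => fderiv_add_period (fun x => hu x k) z

/-- Holomorphy on a strip. -/
def HolOn (u : CCover d → F) (r : ℝ) : Prop := ContDiffOn ℂ ∞ u (strip d r)

lemma HolOn.mono {u : CCover d → F} {r s : ℝ} (h : HolOn u s) (hrs : r ≤ s) : HolOn u r :=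
  ContDiffOn.mono h (strip_mono hrs)

lemma HolOn.differentiableAt {u : CCover d → F} {r : ℝ} (h : HolOn u r) {z : CCover d}
    (hz : z ∈ strip d r) : DifferentiableAt ℂ u z :=
  (ContDiffOn.differentiableOn h (by simp)).differentiableAt ((isOpen_strip r).mem_nhds hz)

lemma HolOn.derivative {u : CCover d → F} {r : ℝ} (h : HolOn u r) : HolOn (fderiv ℂ u) r :=
  ContDiffOn.fderiv_of_isOpen h (isOpen_strip r) (by simp)

lemma HolOn.translate {u : CCover d → F} {r : ℝ} (h : HolOn u r) (p : Cover d) :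
    HolOn (fun z => u (z + incl p)) r :=
  ContDiffOn.comp (g := u) h (contDiff_id.add contDiff_const).contDiffOn
    fun _ hz => (add_incl_mem_strip p).2 hz

/-- The restriction to a real affine subspace of a function holomorphic on a strip. -/
lemma HolOn.contDiff_real {u : CCover d → F} {r : ℝ} (h : HolOn u r) {p : CCover d}
    (hp : p ∈ strip d r) : ContDiff ℝ ∞ fun x : Cover d => u (incl x + p) := by
  have h1 : ContDiffOn ℝ ∞ u (strip d r) := ContDiffOn.restrict_scalars ℝ h
  rw [← contDiffOn_univ]
  refine h1.comp (g := u) (incl.contDiff.add contDiff_const).contDiffOn fun x _ => ?_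
  rw [add_comm, add_incl_mem_strip]
  exact hp

lemma HolOn.contDiff_incl {u : CCover d → F} {r : ℝ} (h : HolOn u r) (hr : 0 < r) :
    ContDiff ℝ ∞ fun x : Cover d => u (incl x) := by
  simpa using h.contDiff_real (p := 0) (by simpa [strip] using hr)

/-- Cauchy's estimate on strips. -/
lemma HolOn.norm_fderiv_le {u : CCover d → F} {r s M : ℝ} (h : HolOn u r)
    (hM : ∀ z ∈ strip d r, ‖u z‖ ≤ M) (hs : s < r) {z : CCover d} (hz : z ∈ strip d s) :
    ‖fderiv ℂ u z‖ ≤ M / (r - s) := by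
  have hrs : 0 < r - s := sub_pos.2 hs
  have hzr : z ∈ strip d r := strip_mono hs.le hz
  have hM0 : 0 ≤ M := (norm_nonneg _).trans (hM z hzr)
  refine ContinuousLinearMap.opNorm_le_bound _ (by positivity) fun v => ?_
  rcases eq_or_ne v 0 with rfl | hv
  · simp
  have hv' : 0 < ‖v‖ := norm_pos_iff.2 hv
  have hmem : ∀ t ∈ Metric.closedBall (0 : ℂ) ((r - s) / ‖v‖), z + t • v ∈ strip d r := by
    intro t ht
    rw [mem_closedBall_zero_iff, le_div_iff₀ hv'] at ht
    have h1 : ‖imPart (t • v)‖ ≤ r - s := (norm_imPart_le _).trans (by rwa [norm_smul])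
    have h2 : ‖imPart z‖ < s := hz
    have h3 := norm_add_le (imPart z) (imPart (t • v))
    change ‖imPart (z + t • v)‖ < r
    rw [map_add]
    linarith
  have hder : ∀ t : ℂ, HasDerivAt (fun t : ℂ => z + t • v) v t := fun t => by
    simpa using ((hasDerivAt_id t).smul_const v).const_add z
  have hd : ∀ t ∈ Metric.closedBall (0 : ℂ) ((r - s) / ‖v‖),
      HasDerivAt (fun t : ℂ => u (z + t • v)) (fderiv ℂ u (z + t • v) v) t := fun t ht =>
    (h.differentiableAt (hmem t ht)).hasFDerivAt.comp_hasDerivAt t (hder t)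
  have hpos : 0 < (r - s) / ‖v‖ := by positivity
  have key := Complex.norm_deriv_le_of_forall_mem_sphere_norm_le (c := 0)
    (f := fun t : ℂ => u (z + t • v)) (C := M) hpos
    (DifferentiableOn.diffContOnCl (by
      rw [closure_ball _ hpos.ne']
      exact fun t ht => (hd t ht).differentiableAt.differentiableWithinAt))
    (fun t ht => hM _ (hmem t (Metric.sphere_subset_closedBall ht)))
  rw [(hd 0 (Metric.mem_closedBall_self hpos.le)).deriv] at key
  simp only [zero_smul, add_zero] at key
  calc _ ≤ _ := key
    _ = _ := by field_simp

/-- The mean of a periodic holomorphic function does not change under imaginary translations. -/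
lemma HolOn.mean_shift {u : CCover d → F} {r M : ℝ} (h : HolOn u r) (hp : CPeriodic u)
    (hM : ∀ z ∈ strip d r, ‖u z‖ ≤ M) {y : Cover d} (hy : ‖y‖ < r) :
    mean (fun x => u (incl x + Complex.I • incl y)) = mean fun x => u (incl x) := by
  set η : CCover d := Complex.I • incl y with hη
  set δ : ℝ := (r - ‖y‖) / (2 * (‖y‖ + 1)) with hδ
  have hy0 := norm_nonneg y
  have hδ0 : 0 < δ := div_pos (sub_pos.2 hy) (by positivity)
  set r' : ℝ := (r + ‖y‖) / 2 with hr'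
  have hr'r : r' < r := by rw [hr']; linarith
  have hδy : (1 + δ) * ‖y‖ < r' := by
    have : δ * (‖y‖ + 1) = (r - ‖y‖) / 2 := by rw [hδ]; field_simp
    nlinarith
  have hmem : ∀ s ∈ Icc (0 : ℝ) 1, ∀ t ∈ Metric.ball s δ, t • η ∈ strip d r' := by
    intro s hs t ht
    have h1 : |t| ≤ 1 + δ := by
      rw [Metric.mem_ball, Real.dist_eq, abs_lt] at ht
      rw [abs_le]; constructor <;> linarith [hs.1, hs.2]
    change ‖imPart (t • η)‖ < r'
    rw [map_smul, hη, imPart_I_smul_incl, norm_smul, Real.norm_eq_abs]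
    nlinarith
  have hmem2 : ∀ p ∈ strip d r', ∀ x, incl x + p ∈ strip d r' := fun p hp x => by
    rw [add_comm, add_incl_mem_strip]; exact hp
  have hder : ∀ s ∈ Icc (0 : ℝ) 1,
      HasDerivAt (fun t : ℝ => mean fun x => u (incl x + t • η)) 0 s := by
    intro s hs
    have hs' := hmem s hs s (Metric.mem_ball_self hδ0)
    have hcd := h.contDiff_real (strip_mono hr'r.le hs')
    have hper : IsPeriodic fun x => u (incl x + s • η) := (hp.translate _).real
    have key : HasDerivAt (fun t : ℝ => mean fun x => u (incl x + t • η))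
        (mean fun x => fderiv ℂ u (incl x + s • η) η) s := by
      refine hasDerivAt_mean (f := fun t x => u (incl x + t • η))
        (f' := fun t x => fderiv ℂ u (incl x + t • η) η) (C := M / (r - r') * ‖η‖) hδ0
        (fun t _ => (hp.translate _).real)
        (fun t ht => (h.contDiff_real (strip_mono hr'r.le (hmem s hs t ht))).continuous)
        ?_ ?_ ?_ ?_
      · intro x k
        exact congrArg (fun L => L η) ((hp.derivative.translate (s • η)).real x k)
      · exact (h.derivative.contDiff_real (strip_mono hr'r.le hs')).continuous.clm_apply
          continuous_const
      · intro t ht x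
        refine (ContinuousLinearMap.le_opNorm _ _).trans ?_
        gcongr
        exact h.norm_fderiv_le hM hr'r (hmem2 _ (hmem s hs t ht) x)
      · intro t ht x
        have h1 := (h.differentiableAt
          (strip_mono hr'r.le (hmem2 _ (hmem s hs t ht) x))).hasFDerivAt.restrictScalars ℝ
        have h2 : HasDerivAt (fun t : ℝ => incl x + t • η) η t := by
          simpa using ((hasDerivAt_id t).smul_const η).const_add (incl x)
        exact h1.comp_hasDerivAt t h2
    have h0 : (mean fun x => fderiv ℂ u (incl x + s • η) η) = 0 := by
      have hz := hper.mean_fderiv (hcd.of_le (by simp)) y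
      have hfd : ∀ x, fderiv ℝ (fun x => u (incl x + s • η)) x y
          = fderiv ℂ u (incl x + s • η) (incl y) := by
        intro x
        have h1 := (h.differentiableAt
          (strip_mono hr'r.le (hmem2 _ hs' x))).hasFDerivAt.restrictScalars ℝ
        have h2 : HasFDerivAt (fun x : Cover d => incl x + s • η) incl x :=
          (incl.hasFDerivAt).add_const _
        have h3 : HasFDerivAt (fun x => u (incl x + s • η)) _ x := h1.comp x h2
        rw [h3.fderiv]
        rfl
      simp only [hfd] at hz
      have h3 : (fun x => fderiv ℂ u (incl x + s • η) η)
          = fun x => Complex.I • fderiv ℂ u (incl x + s • η) (incl y) := by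
        funext x
        rw [hη, map_smul]
      rw [h3]
      unfold mean at hz ⊢
      rw [integral_smul, hz, smul_zero]
    rwa [h0] at key
  have := constant_of_has_deriv_right_zero (f := fun t : ℝ => mean fun x => u (incl x + t • η))
    (a := 0) (b := 1) (fun t ht => (hder t ht).continuousAt.continuousWithinAt)
    (fun t ht => (hder t ⟨ht.1, ht.2.le⟩).hasDerivWithinAt) 1 (right_mem_Icc.2 zero_le_one)
  simpa using this

end Characters

section FourierCoefficients

variable {d : ℕ} {F : Type*} [NormedAddCommGroup F] [NormedSpace ℂ F]

/-- The Fourier coefficients of a periodic function. -/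
noncomputable def coeff (u : Cover d → F) (k : Fin d → ℤ) : F :=
  mean fun x => char (-k) (incl x) • u x

lemma char_real_periodic (k : Fin d → ℤ) : IsPeriodic fun x : Cover d => char k (incl x) :=
  CPeriodic.real fun z l => char_periodic k l z

lemma continuous_char_incl (k : Fin d → ℤ) : Continuous fun x : Cover d => char k (incl x) :=
  (continuous_char k).comp incl.continuous

lemma IsPeriodic.char_smul {u : Cover d → F} (hu : IsPeriodic u) (k : Fin d → ℤ) :
    IsPeriodic fun x => char k (incl x) • u x := fun x l =>
  congrArg₂ (· • ·) (char_real_periodic k x l) (hu x l)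

lemma norm_coeff_le {u : Cover d → F} {C : ℝ} (h : ∀ x, ‖u x‖ ≤ C) (k : Fin d → ℤ) :
    ‖coeff u k‖ ≤ C :=
  norm_mean_le fun x => by rw [norm_smul, norm_char_incl, one_mul]; exact h x

lemma coeff_zero (u : Cover d → F) : coeff u 0 = mean u := by
  simp [coeff, char_zero]

lemma IsPeriodic.coeff_clm {G : Type*} [NormedAddCommGroup G] [NormedSpace ℂ G] [CompleteSpace F]
    [CompleteSpace G] {u : Cover d → F} (hu : IsPeriodic u) (cu : Continuous u) (L : F →L[ℂ] G)
    (k : Fin d → ℤ) : coeff (fun x => L (u x)) k = L (coeff u k) := by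
  have := (hu.char_smul (-k)).mean_clm ((continuous_char_incl (-k)).smul cu)
    (L.restrictScalars ℝ)
  simpa [coeff] using this

lemma coeff_eq_mFourierCoeff {u : Cover d → F} (k : Fin d → ℤ) :
    coeff u k = UnitAddTorus.mFourierCoeff (fun x : Torus d => u (Torus.rep x)) k := by
  unfold coeff mean UnitAddTorus.mFourierCoeff
  refine integral_congr_ae (Filter.Eventually.of_forall fun x => ?_)
  simp only
  rw [← mFourier_proj, Torus.proj_rep]

/-- Fourier inversion. -/
lemma IsPeriodic.hasSum_coeff {u : Cover d → CCover d} (hu : IsPeriodic u) (cu : Continuous u)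
    (hs : Summable fun k => ‖coeff u k‖) (x : Cover d) :
    HasSum (fun k => char k (incl x) • coeff u k) (u x) := by
  have hs' : Summable fun k => char k (incl x) • coeff u k := by
    refine Summable.of_norm ?_
    simpa [norm_smul, norm_char_incl] using hs
  have hi : ∀ i, (∑' k, char k (incl x) • coeff u k) i = u x i := by
    intro i
    let P : CCover d →L[ℂ] ℂ := EuclideanSpace.proj i
    let f : C(UnitAddTorus (Fin d), ℂ) :=
      ⟨fun y => P (u (Torus.rep y)), P.continuous.comp (hu.continuous_rep cu)⟩
    have hf : ∀ k, UnitAddTorus.mFourierCoeff f k = P (coeff u k) := fun k => by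
      rw [← hu.coeff_clm cu P k, coeff_eq_mFourierCoeff]
      rfl
    have hsum : Summable (UnitAddTorus.mFourierCoeff f) := by
      refine Summable.of_norm_bounded hs fun k => ?_
      rw [hf]
      exact PiLp.norm_apply_le _ _
    have h1 := UnitAddTorus.hasSum_mFourier_series_apply_of_summable hsum (Torus.proj x)
    have h2 := P.hasSum hs'.hasSum
    have h3 : f (Torus.proj x) = P (u x) := congrArg P (hu.rep_proj x)
    rw [h3] at h1
    refine h2.unique (h1.congr_fun ?_)
    intro k
    rw [hf, mFourier_proj, map_smul, smul_eq_mul, smul_eq_mul, mul_comm]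
  have : (∑' k, char k (incl x) • coeff u k) = u x := by ext i; exact hi i
  rw [← this]
  exact hs'.hasSum

lemma IsPeriodic.coeff_fderiv [CompleteSpace F] {u : Cover d → F} (hu : IsPeriodic u)
    (hd : ContDiff ℝ 1 u) (k : Fin d → ℤ) (y : Cover d) :
    coeff (fderiv ℝ u) k y = phase k (incl y) • coeff u k := by
  have hpf : IsPeriodic (fderiv ℝ u) := fun x k => fderiv_add_period (fun x => hu x k) x
  have hcf : Continuous (fderiv ℝ u) := hd.continuous_fderiv one_ne_zero
  have cu := hd.continuous
  have hchar : ∀ x, HasFDerivAt (fun x : Cover d => char (-k) (incl x))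
      (((char (-k) (incl x) • phase (-k)).restrictScalars ℝ).comp incl) x := fun x =>
    ((hasFDerivAt_char (-k) (incl x)).restrictScalars ℝ).comp x incl.hasFDerivAt
  have hG : ContDiff ℝ 1 fun x : Cover d => char (-k) (incl x) • u x :=
    (((contDiff_char (-k)).restrict_scalars ℝ).comp incl.contDiff).smul hd
  have h0 := (hu.char_smul (-k)).mean_fderiv hG y
  have hval : ∀ x, fderiv ℝ (fun x : Cover d => char (-k) (incl x) • u x) x y
      = char (-k) (incl x) • fderiv ℝ u x y + -(phase k (incl y) • char (-k) (incl x) • u x) := by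
    intro x
    have h3 : HasFDerivAt (fun x : Cover d => char (-k) (incl x) • u x) _ x :=
      (hchar x).smul (hd.differentiable one_ne_zero x).hasFDerivAt
    rw [h3.fderiv]
    simp [phase_neg, smul_smul, mul_comm]
  simp only [hval] at h0
  have p1 : IsPeriodic fun x => char (-k) (incl x) • fderiv ℝ u x := hpf.char_smul (-k)
  have c1 : Continuous fun x : Cover d => char (-k) (incl x) • fderiv ℝ u x :=
    (continuous_char_incl (-k)).smul hcf
  have p2 := hu.char_smul (-k)
  have c2 := (continuous_char_incl (-k)).smul cu
  have hA : mean (fun x => char (-k) (incl x) • fderiv ℝ u x y) = coeff (fderiv ℝ u) k y := by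
    have := p1.mean_clm c1 (ContinuousLinearMap.apply ℝ F y)
    simpa [coeff] using this
  have hB : mean (fun x => -(phase k (incl y) • char (-k) (incl x) • u x))
      = -(phase k (incl y) • coeff u k) := by
    unfold mean coeff mean
    rw [integral_neg, integral_smul]
  rw [IsPeriodic.mean_add (u := fun x => char (-k) (incl x) • fderiv ℝ u x y)
    (v := fun x => -(phase k (incl y) • char (-k) (incl x) • u x)) (fun x l => ?_) (fun x l => ?_)
    (c1.clm_apply continuous_const) ((c2.const_smul _).neg), hA, hB] at h0
  · exact add_neg_eq_zero.1 h0
  · exact congrArg (fun L => L y) (p1 x l)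
  · exact congrArg (fun v => -(phase k (incl y) • v)) (p2 x l)

lemma IsPeriodic.norm_coeff_le_fderiv [CompleteSpace F] {u : Cover d → F} (hu : IsPeriodic u)
    (hd : ContDiff ℝ 1 u) (k : Fin d → ℤ) :
    ‖intVec k‖ * ‖coeff u k‖ ≤ ‖coeff (fderiv ℝ u) k‖ := by
  rcases eq_or_ne (intVec k) 0 with hk | hk
  · simp [hk]
  have h := hu.coeff_fderiv hd k (intVec k)
  have h1 := (coeff (fderiv ℝ u) k).le_opNorm (intVec k)
  rw [h, phase_incl, real_inner_self_eq_norm_sq, norm_smul, norm_mul, Complex.norm_I, mul_one,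
    Complex.norm_real, Real.norm_of_nonneg (by positivity)] at h1
  have hk' : 0 < ‖intVec k‖ := norm_pos_iff.2 hk
  have h2 : (‖intVec k‖ * ‖coeff u k‖) * ‖intVec k‖ ≤ ‖coeff (fderiv ℝ u) k‖ * ‖intVec k‖ := by
    refine le_trans ?_ h1
    have : 0 ≤ ‖intVec k‖ ^ 2 * ‖coeff u k‖ := by positivity
    nlinarith [Real.two_le_pi]
  exact le_of_mul_le_mul_right h2 hk'

/-- The decay of the Fourier coefficients of a smooth function. -/
lemma IsPeriodic.pow_mul_norm_coeff_le (m : ℕ) :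
    ∀ {F : Type} [NormedAddCommGroup F] [NormedSpace ℂ F] [CompleteSpace F] {u : Cover d → F}
      (_ : IsPeriodic u) (_ : ContDiff ℝ ∞ u) {C : ℝ} (_ : ∀ x, ‖iteratedFDeriv ℝ m u x‖ ≤ C)
      (k : Fin d → ℤ), ‖intVec k‖ ^ m * ‖coeff u k‖ ≤ C := by
  induction m with
  | zero =>
    intro F _ _ _ u hu hd C hC k
    simpa using norm_coeff_le (fun x => by simpa using hC x) k
  | succ m ih =>
    intro F _ _ _ u hu hd C hC k
    have hpf : IsPeriodic (fderiv ℝ u) := fun x k => fderiv_add_period (fun x => hu x k) x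
    have h1 := ih hpf (hd.fderiv_right (by simp)) (C := C)
      (fun x => by rw [norm_iteratedFDeriv_fderiv]; exact hC x) k
    calc ‖intVec k‖ ^ (m + 1) * ‖coeff u k‖ = ‖intVec k‖ ^ m * (‖intVec k‖ * ‖coeff u k‖) := by ring
      _ ≤ ‖intVec k‖ ^ m * ‖coeff (fderiv ℝ u) k‖ := by
        gcongr
        exact hu.norm_coeff_le_fderiv (hd.of_le (by simp)) k
      _ ≤ C := h1

/-- The exponential decay of the Fourier coefficients of a holomorphic function. -/
lemma HolOn.norm_coeff_le {u : CCover d → F} {r M : ℝ} (h : HolOn u r) (hr : 0 < r)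
    (hp : CPeriodic u) (hM : ∀ z ∈ strip d r, ‖u z‖ ≤ M) (k : Fin d → ℤ) :
    ‖coeff (fun x => u (incl x)) k‖ ≤ M * Real.exp (-(2 * Real.pi * ‖intVec k‖ * r)) := by
  have hM0 : 0 ≤ M := (norm_nonneg _).trans (hM _ (incl_mem_strip hr 0))
  have key : ∀ ρ ∈ Ioo 0 r,
      ‖coeff (fun x => u (incl x)) k‖ ≤ M * Real.exp (-(2 * Real.pi * ‖intVec k‖ * ρ)) := by
    intro ρ hρ
    set y : Cover d := (-ρ / ‖intVec k‖) • intVec k with hy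
    have hyn : ‖y‖ ≤ ρ := by
      rw [hy, norm_smul, norm_div, norm_neg, norm_norm, Real.norm_of_nonneg hρ.1.le]
      rcases eq_or_ne ‖intVec k‖ 0 with h0 | h0
      · simp [h0, hρ.1.le]
      · rw [div_mul_cancel₀ _ h0]
    have hinner : inner ℝ (intVec k) y = -ρ * ‖intVec k‖ := by
      rw [hy, inner_smul_right, real_inner_self_eq_norm_sq]
      rcases eq_or_ne ‖intVec k‖ 0 with h0 | h0
      · simp [h0]
      · field_simp
    have hG : HolOn (fun z => char (-k) z • u z) r :=
      (contDiff_char (-k)).contDiffOn.smul h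
    have hGp : CPeriodic fun z => char (-k) z • u z := fun z l => by
      simp only
      rw [char_periodic, hp]
    have hGM : ∀ z ∈ strip d r,
        ‖char (-k) z • u z‖ ≤ Real.exp (2 * Real.pi * ‖intVec (-k)‖ * r) * M := fun z hz => by
      rw [norm_smul]
      exact mul_le_mul (norm_char_le _ (le_of_lt hz)) (hM z hz) (norm_nonneg _) (Real.exp_pos _).le
    have hsh := hG.mean_shift hGp hGM (y := y) (hyn.trans_lt hρ.2)
    rw [coeff, ← hsh]
    refine norm_mean_le fun x => ?_
    have him : imPart (incl x + Complex.I • incl y) = y := by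
      rw [map_add, imPart_incl, imPart_I_smul_incl, zero_add]
    rw [norm_smul, norm_char, him, intVec_neg, inner_neg_left, hinner, mul_comm]
    refine mul_le_mul (hM _ ?_) (le_of_eq ?_) (Real.exp_pos _).le hM0
    · change ‖imPart _‖ < r
      rw [him]
      exact hyn.trans_lt hρ.2
    · congr 1
      ring
  have hlim : Filter.Tendsto (fun ρ => M * Real.exp (-(2 * Real.pi * ‖intVec k‖ * ρ)))
      (nhdsWithin r (Iio r)) (nhds (M * Real.exp (-(2 * Real.pi * ‖intVec k‖ * r)))) :=
    (Continuous.tendsto (by fun_prop) r).mono_left nhdsWithin_le_nhds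
  refine ge_of_tendsto hlim ?_
  filter_upwards [Ioo_mem_nhdsLT hr] with ρ hρ using key ρ hρ

/-- Fourier series with exponentially decaying coefficients are holomorphic. -/
lemma contDiffOn_tsum_char (r : ℝ) (n : ℕ) :
    ∀ {F : Type} [NormedAddCommGroup F] [NormedSpace ℂ F] [CompleteSpace F]
      {b : (Fin d → ℤ) → F} (_ : ∀ m : ℕ, Summable fun k =>
        ‖intVec k‖ ^ m * Real.exp (2 * Real.pi * ‖intVec k‖ * r) * ‖b k‖),
      ContDiffOn ℂ n (fun z => ∑' k, char k z • b k) (strip d r) := by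
  have hfd : ∀ {F : Type} [NormedAddCommGroup F] [NormedSpace ℂ F] [CompleteSpace F]
      {b : (Fin d → ℤ) → F} (_ : ∀ m : ℕ, Summable fun k =>
        ‖intVec k‖ ^ m * Real.exp (2 * Real.pi * ‖intVec k‖ * r) * ‖b k‖), ∀ z ∈ strip d r,
      HasFDerivAt (fun z => ∑' k, char k z • b k)
        (∑' k, char k z • (phase k).smulRight (b k)) z := by
    intro F _ _ _ b hb z hz
    refine hasFDerivAt_tsum_of_isPreconnected ((hb 1).mul_left (2 * Real.pi)) (isOpen_strip r)
      (convex_strip r).isPreconnected (f := fun k z => char k z • b k)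
      (f' := fun k z => char k z • (phase k).smulRight (b k)) ?_ ?_ hz ?_ hz
    · intro k w _
      convert (hasFDerivAt_char k w).smul_const (b k) using 1
      ext v
      simp [smul_smul]
    · intro k w hw
      rw [norm_smul]
      have h1 := norm_char_le k (le_of_lt hw)
      have h2 : ‖(phase k).smulRight (b k)‖ ≤ 2 * Real.pi * ‖intVec k‖ * ‖b k‖ := by
        rw [ContinuousLinearMap.norm_smulRight_apply]
        gcongr
        exact norm_phase_le k
      refine (mul_le_mul h1 h2 (norm_nonneg _) (Real.exp_pos _).le).trans (le_of_eq ?_)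
      ring
    · refine Summable.of_norm_bounded (hb 0) fun k => ?_
      rw [norm_smul, pow_zero, one_mul]
      gcongr
      exact norm_char_le k (le_of_lt hz)
  induction n with
  | zero =>
    intro F _ _ _ b hb
    exact contDiffOn_zero.2 fun z hz => (hfd hb z hz).continuousAt.continuousWithinAt
  | succ n ih =>
    intro F _ _ _ b hb
    have hb' : ∀ m : ℕ, Summable fun k => ‖intVec k‖ ^ m *
        Real.exp (2 * Real.pi * ‖intVec k‖ * r) * ‖(phase k).smulRight (b k)‖ := fun m => by
      refine Summable.of_nonneg_of_le (fun k => by positivity) (fun k => ?_)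
        ((hb (m + 1)).mul_left (2 * Real.pi))
      have h2 : ‖(phase k).smulRight (b k)‖ ≤ 2 * Real.pi * ‖intVec k‖ * ‖b k‖ := by
        rw [ContinuousLinearMap.norm_smulRight_apply]
        gcongr
        exact norm_phase_le k
      refine (mul_le_mul_of_nonneg_left h2 (by positivity)).trans (le_of_eq ?_)
      ring
    push_cast
    rw [contDiffOn_succ_iff_fderiv_of_isOpen (isOpen_strip r)]
    refine ⟨fun z hz => (hfd hb z hz).differentiableAt.differentiableWithinAt, by simp, ?_⟩
    exact (ih hb').congr fun z hz => (hfd hb z hz).fderiv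

end FourierCoefficients

section SmallDivisors

variable {d : ℕ}

/-- The size of an integer vector, at least one. -/
noncomputable def wt (k : Fin d → ℤ) : ℝ := max 1 ‖intVec k‖

lemma one_le_wt (k : Fin d → ℤ) : 1 ≤ wt k := le_max_left _ _

lemma wt_pos (k : Fin d → ℤ) : 0 < wt k := one_pos.trans_le (one_le_wt k)

lemma norm_le_wt (k : Fin d → ℤ) : ‖intVec k‖ ≤ wt k := le_max_right _ _

lemma wt_eq {k : Fin d → ℤ} (hk : k ≠ 0) : wt k = ‖intVec k‖ := max_eq_right (one_le_norm_intVec hk)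

lemma summable_wt (d : ℕ) : Summable fun k : Fin d → ℤ => (wt k ^ (d + 1))⁻¹ := by
  let b := (EuclideanSpace.basisFun (Fin d) ℝ).toBasis
  let L : Submodule ℤ (Cover d) := Submodule.span ℤ (range b)
  have hmem : ∀ k : Fin d → ℤ, intVec k ∈ L := by
    intro k
    have : intVec k = ∑ i, k i • b i := by
      have h := b.sum_repr (intVec k)
      rw [← h]
      refine Finset.sum_congr rfl fun i _ => ?_
      simp [b, Int.cast_smul_eq_zsmul]
    rw [this]
    exact Submodule.sum_mem _ fun i _ => Submodule.smul_mem _ _ (Submodule.subset_span ⟨i, rfl⟩)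
  have hrank : Module.finrank ℤ L < d + 1 := by
    have : Module.finrank ℤ L = Module.finrank ℝ (Cover d) := ZLattice.rank ℝ L
    simp [this]
  have h1 := ZLattice.summable_norm_pow_inv L (d + 1) hrank
  have hinj : Function.Injective fun k : Fin d → ℤ => (⟨intVec k, hmem k⟩ : L) := by
    intro k l h
    have h' : intVec k = intVec l := congrArg Subtype.val h
    funext i
    have := congrArg (fun v : Cover d => v i) h'
    simpa using this
  have h2 := h1.comp_injective hinj
  have h3 : Summable fun k : Fin d → ℤ => if k = 0 then (1 : ℝ) else 0 :=
    summable_of_ne_finset_zero (s := {0}) fun k hk => by simp at hk; simp [hk]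
  refine Summable.of_nonneg_of_le (fun k => by have := wt_pos k; positivity) (fun k => ?_)
    (h2.add h3)
  rcases eq_or_ne k 0 with rfl | hk
  · have : ((wt (0 : Fin d → ℤ)) ^ (d + 1))⁻¹ = 1 := by simp [wt, intVec_zero]
    rw [this]
    simp [intVec_zero]
  · rw [wt_eq hk]
    simp [hk]

/-- Exponential decay beats polynomial growth. -/
lemma wt_pow_mul_exp_le {k : Fin d → ℤ} (hk : k ≠ 0) {r : ℝ} (hr : 0 < r) (j : ℕ) :
    wt k ^ j * Real.exp (-(Real.pi * ‖intVec k‖ * r)) ≤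
      (j + d + 1).factorial * r⁻¹ ^ (j + d + 1) * (wt k ^ (d + 1))⁻¹ := by
  rw [wt_eq hk]
  have hn : 0 < ‖intVec k‖ := one_pos.trans_le (one_le_norm_intVec hk)
  set x := ‖intVec k‖
  have h1 := Real.pow_div_factorial_le_exp (x * r) (by positivity) (j + d + 1)
  have h2 : Real.exp (x * r) ≤ Real.exp (Real.pi * x * r) := by
    rw [Real.exp_le_exp]
    nlinarith [Real.two_le_pi, mul_pos hn hr]
  have h3 := h1.trans h2
  rw [Real.exp_neg]
  have hf : (0 : ℝ) < (j + d + 1).factorial := by positivity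
  rw [div_le_iff₀ hf] at h3
  rw [inv_pow]
  rw [← div_eq_mul_inv, ← div_eq_mul_inv, ← div_eq_mul_inv, div_div,
    div_le_div_iff₀ (Real.exp_pos _) (by positivity)]
  calc x ^ j * (r ^ (j + d + 1) * x ^ (d + 1)) = (x * r) ^ (j + d + 1) := by rw [mul_pow]; ring
    _ ≤ _ := h3
    _ = _ := by ring

/-- Identity theorem on strips. -/
lemma HolOn.eqOn {F : Type*} [NormedAddCommGroup F] [NormedSpace ℂ F] [CompleteSpace F]
    {u v : CCover d → F} {r : ℝ} (hu : HolOn u r) (hv : HolOn v r)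
    (h : ∀ x, u (incl x) = v (incl x)) {z : CCover d} (hz : z ∈ strip d r) : u z = v z := by
  let x := rePart z
  let y := imPart z
  let p : ℂ → CCover d := fun t => incl x + t • incl y
  have him : ∀ t, imPart (p t) = t.im • y := fun t => by
    ext i
    simp [p]
  let U : Set ℂ := {t | |t.im| * ‖y‖ < r}
  have hUo : IsOpen U := isOpen_lt (by fun_prop) continuous_const
  have hmem : ∀ t ∈ U, p t ∈ strip d r := fun t ht => by
    change ‖imPart (p t)‖ < r
    rw [him, norm_smul]
    exact ht
  have hy : ‖y‖ < r := hz
  have hconv : Convex ℝ U := by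
    have : U = p ⁻¹' strip d r := by
      ext t
      change _ ↔ ‖imPart (p t)‖ < r
      rw [him, norm_smul]
      rfl
    rw [this]
    intro s hs t ht a b ha hb hab
    have h := convex_strip r hs ht ha hb hab
    have hp : p (a • s + b • t) = a • p s + b • p t := by
      have hab' : (incl x : CCover d) = (a + b) • incl x := by rw [hab, one_smul]
      simp only [p]
      rw [hab']
      have h1 : (a : ℝ) + b = 1 := hab
      simp only [h1, one_smul]
      rw [smul_add, smul_add, add_smul, smul_assoc, smul_assoc, add_add_add_comm, ← add_smul, h1,
        one_smul]
    rw [mem_preimage, hp]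
    exact h
  have han : ∀ {w : CCover d → F}, HolOn w r → AnalyticOnNhd ℂ (fun t => w (p t)) U := by
    intro w hw
    refine DifferentiableOn.analyticOnNhd (fun t ht => ?_) hUo
    have h1 : DifferentiableAt ℂ p t :=
      (differentiableAt_const _).add (differentiableAt_id.smul_const _)
    exact ((hw.differentiableAt (hmem t ht)).comp t h1).differentiableWithinAt
  have hr : 0 < r := (norm_nonneg y).trans_lt hy
  have h0 : (0 : ℂ) ∈ U := by simpa [U] using hr
  have hI : Complex.I ∈ U := by simpa [U] using hy
  have hfreq : ∃ᶠ t in nhdsWithin (0 : ℂ) {0}ᶜ, u (p t) = v (p t) := by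
    have htend : Filter.Tendsto (fun s : ℝ => (s : ℂ)) (nhdsWithin 0 {0}ᶜ)
        (nhdsWithin (0 : ℂ) {0}ᶜ) := by
      refine tendsto_nhdsWithin_iff.2 ⟨?_, ?_⟩
      · exact (Complex.continuous_ofReal.tendsto' 0 0 (by simp)).mono_left nhdsWithin_le_nhds
      · filter_upwards [self_mem_nhdsWithin] with s hs
        simpa using hs
    refine htend.frequently (Filter.Eventually.frequently (Filter.Eventually.of_forall fun s => ?_))
    have : p s = incl (x + s • y) := by
      simp [p, map_add, map_smul]
    rw [this, h]
  have key := (han hu).eqOn_of_preconnected_of_frequently_eq (han hv) hconv.isPreconnected h0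
    hfreq hI
  have hpI : p Complex.I = z := incl_rePart_add z
  simpa [hpI] using key

section FourierSeries

variable {F : Type} [NormedAddCommGroup F] [NormedSpace ℂ F]

/-- The function with given Fourier coefficients. -/
noncomputable def fourierSeries (b : (Fin d → ℤ) → F) (z : CCover d) : F := ∑' k, char k z • b k

lemma fourierSeries_periodic (b : (Fin d → ℤ) → F) : CPeriodic (fourierSeries b) := fun z l => by
  simp [fourierSeries, char_periodic]

lemma norm_fourierSeries_le {b : (Fin d → ℤ) → F} {B : (Fin d → ℤ) → ℝ} (hB : Summable B) {r : ℝ}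
    (h : ∀ k, Real.exp (2 * Real.pi * ‖intVec k‖ * r) * ‖b k‖ ≤ B k) {z : CCover d}
    (hz : ‖imPart z‖ ≤ r) : ‖fourierSeries b z‖ ≤ ∑' k, B k :=
  tsum_of_norm_bounded hB.hasSum fun k => by
    rw [norm_smul]
    exact (mul_le_mul_of_nonneg_right (norm_char_le k hz) (norm_nonneg _)).trans (h k)

lemma holOn_fourierSeries [CompleteSpace F] {b : (Fin d → ℤ) → F} {r : ℝ} (h : ∀ m : ℕ, Summable
    fun k => ‖intVec k‖ ^ m * Real.exp (2 * Real.pi * ‖intVec k‖ * r) * ‖b k‖) :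
    HolOn (fourierSeries b) r :=
  contDiffOn_infty.2 fun n => contDiffOn_tsum_char r n h

end FourierSeries

/-- Real values at real points. -/
def IsReal (u : CCover d → CCover d) : Prop := ∀ x, imPart (u (incl x)) = 0

lemma imPart_eq_zero_iff {z : CCover d} : imPart z = 0 ↔ ∀ i, starRingEnd ℂ (z i) = z i := by
  constructor
  · intro h i
    rw [Complex.conj_eq_iff_im]
    exact congrArg (fun v : Cover d => v i) h
  · intro h
    ext i
    exact Complex.conj_eq_iff_im.1 (h i)

lemma isReal_fourierSeries {b : (Fin d → ℤ) → CCover d} (hs : Summable fun k => ‖b k‖)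
    (hb : ∀ k i, b (-k) i = starRingEnd ℂ (b k i)) : IsReal (fourierSeries b) := by
  intro x
  rw [imPart_eq_zero_iff]
  intro i
  have hs' : Summable fun k => char k (incl x) • b k := by
    refine Summable.of_norm ?_
    simpa [norm_smul, norm_char_incl] using hs
  have h1 : fourierSeries b (incl x) i = ∑' k, char k (incl x) * b k i := by
    have := (EuclideanSpace.proj i : CCover d →L[ℂ] ℂ).map_tsum hs'
    simpa [fourierSeries] using this
  rw [h1, Complex.conj_tsum, ← (Equiv.neg (Fin d → ℤ)).tsum_eq]
  refine tsum_congr fun k => ?_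
  simp only [Equiv.neg_apply, map_mul]
  rw [hb, char_neg_incl, Complex.conj_conj, Complex.conj_conj]

lemma coeff_neg_of_real {u : Cover d → CCover d} (hu : IsPeriodic u) (cu : Continuous u)
    (h : ∀ x, imPart (u x) = 0) (k : Fin d → ℤ) (i : Fin d) :
    coeff u (-k) i = starRingEnd ℂ (coeff u k i) := by
  have e : ∀ k, coeff u k i = coeff (fun x => u x i) k := fun k =>
    (hu.coeff_clm cu (EuclideanSpace.proj i : CCover d →L[ℂ] ℂ) k).symm
  rw [e, e]
  unfold coeff mean
  rw [← integral_conj]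
  refine integral_congr_ae (Filter.Eventually.of_forall fun x => ?_)
  simp only [smul_eq_mul, map_mul]
  rw [char_neg_incl, imPart_eq_zero_iff.1 (h _) i]

/-- The Diophantine condition bounds the small divisors from below. -/
lemma norm_inv_char_sub_one_le {γ τ : ℝ} {N : ℕ} (hγ : 0 < γ) (hτ : τ ≤ N) {a : Cover d}
    (ha : IsDiophantine γ τ (Torus.proj a)) {k : Fin d → ℤ} (hk : k ≠ 0) :
    char k (incl a) - 1 ≠ 0 ∧ ‖(char k (incl a) - 1)⁻¹‖ ≤ γ * (d * wt k) ^ N := by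
  set S : ℝ := ((∑ i, |k i| : ℤ) : ℝ) with hS
  have hS1 : 1 ≤ S := by
    obtain ⟨i, hi⟩ := Function.ne_iff.1 hk
    have h1 : 1 ≤ |k i| := Int.one_le_abs hi
    have h2 : |k i| ≤ ∑ i, |k i| :=
      Finset.single_le_sum (f := fun i => |k i|) (fun _ _ => abs_nonneg _) (Finset.mem_univ i)
    rw [hS]
    exact_mod_cast h1.trans h2
  have hSw : S ≤ d * wt k := by
    rw [hS]
    push_cast
    have : ∑ i, |(k i : ℝ)| ≤ ∑ _i : Fin d, wt k :=
      Finset.sum_le_sum fun i _ => (abs_apply_le_norm (intVec k) i).trans (norm_le_wt k)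
    simpa using this
  have hSτ : S ^ τ ≤ (d * wt k) ^ N := by
    calc S ^ τ ≤ S ^ (N : ℝ) := Real.rpow_le_rpow_of_exponent_le hS1 hτ
      _ = S ^ N := Real.rpow_natCast _ _
      _ ≤ _ := by gcongr
  set θ : ℝ := inner ℝ (intVec k) a with hθ
  have hsum : ∑ i, k i • Torus.proj a i = ((θ : ℝ) : UnitAddCircle) := by
    rw [hθ, inner_intVec]
    refine Eq.trans ?_
      (map_sum (QuotientAddGroup.mk' (AddSubgroup.zmultiples (1 : ℝ))) _ _).symm
    refine Finset.sum_congr rfl fun i _ => ?_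
    simp only [Torus.proj]
    rw [← AddCircle.coe_zsmul, zsmul_eq_mul]
    rfl
  have hD := ha k hk
  rw [hsum, UnitAddCircle.norm_eq] at hD
  set t : ℝ := θ - round θ with ht
  have ht2 : |t| ≤ 1 / 2 := abs_sub_round θ
  have hchar : char k (incl a) = Complex.exp (Complex.I * ((2 * Real.pi * t : ℝ) : ℂ)) := by
    rw [char, phase_incl, ← hθ]
    have : ((2 * Real.pi * θ : ℝ) : ℂ) * Complex.I
        = Complex.I * ((2 * Real.pi * t : ℝ) : ℂ) + (round θ : ℤ) * (2 * Real.pi * Complex.I) := by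
      rw [ht]
      push_cast
      ring
    rw [this, Complex.exp_add, Complex.exp_int_mul_two_pi_mul_I, mul_one]
  have hnorm : |t| ≤ ‖char k (incl a) - 1‖ := by
    rw [hchar, Complex.norm_exp_I_mul_ofReal_sub_one, norm_mul, Real.norm_eq_abs, Real.norm_eq_abs]
    have h1 : |2 * Real.pi * t / 2| ≤ Real.pi / 2 := by
      have : 2 * Real.pi * t / 2 = Real.pi * t := by ring
      rw [this, abs_mul, abs_of_pos Real.pi_pos]
      nlinarith [Real.pi_pos]
    have h2 := Real.mul_abs_le_abs_sin h1
    have h3 : 2 / Real.pi * |2 * Real.pi * t / 2| = 2 * |t| := by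
      have : 2 * Real.pi * t / 2 = Real.pi * t := by ring
      rw [this, abs_mul, abs_of_pos Real.pi_pos]
      field_simp
    rw [h3] at h2
    have : |(2 : ℝ)| = 2 := by norm_num
    rw [this]
    linarith [abs_nonneg t]
  have hpos : 0 < γ⁻¹ / S ^ τ := div_pos (inv_pos.2 hγ) (Real.rpow_pos_of_pos (by linarith) _)
  have hlow := hD.trans hnorm
  refine ⟨norm_pos_iff.1 (hpos.trans_le hlow), ?_⟩
  rw [norm_inv]
  calc ‖char k (incl a) - 1‖⁻¹ ≤ (γ⁻¹ / S ^ τ)⁻¹ := by gcongr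
    _ = γ * S ^ τ := by rw [inv_div, div_inv_eq_mul, mul_comm]
    _ ≤ _ := by gcongr

end SmallDivisors

section CohomologicalEquation

variable {d : ℕ}

/-- The cohomological equation over a Diophantine rotation, in strips. -/
theorem exists_cohomological_solution (d : ℕ) (γ τ : ℝ) (hγ : 0 < γ) :
    ∃ (C : ℝ) (p : ℕ), 1 ≤ C ∧ ∀ a : Cover d, IsDiophantine γ τ (Torus.proj a) →
      ∀ (r M : ℝ) (g : CCover d → CCover d), 0 < r → HolOn g r → CPeriodic g → IsReal g →
        (∀ z ∈ strip d r, ‖g z‖ ≤ M) → mean (fun x => g (incl x)) = 0 →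
        ∃ ζ : CCover d → CCover d, HolOn ζ (r / 2) ∧ CPeriodic ζ ∧ IsReal ζ ∧
          (∀ z ∈ strip d (r / 2), ‖ζ z‖ ≤ C * r⁻¹ ^ p * M) ∧
          ∀ z ∈ strip d (r / 2), ζ (z + incl a) - ζ z = g z := by
  set N : ℕ := ⌈τ⌉₊ with hN
  set Z : ℝ := ∑' k : Fin d → ℤ, (wt k ^ (d + 1))⁻¹ with hZ
  have hZ0 : 0 ≤ Z := tsum_nonneg fun k => by have := wt_pos k; positivity
  set C₀ : ℝ := γ * (d : ℝ) ^ N * (N + d + 1).factorial * Z with hC₀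
  have hC₀0 : 0 ≤ C₀ := by positivity
  refine ⟨C₀ + 1, N + d + 1, by linarith, fun a ha r M g hr hg gp gr gM gmean => ?_⟩
  have hM0 : 0 ≤ M := (norm_nonneg _).trans (gM _ (incl_mem_strip hr 0))
  set c : (Fin d → ℤ) → CCover d := coeff fun x => g (incl x) with hc
  have hgc : Continuous fun x : Cover d => g (incl x) := (hg.contDiff_incl hr).continuous
  have hc0 : c 0 = 0 := by rw [hc, coeff_zero, gmean]
  have hcM : ∀ k, ‖c k‖ ≤ M * Real.exp (-(2 * Real.pi * ‖intVec k‖ * r)) := fun k =>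
    hg.norm_coeff_le hr gp gM k
  set b : (Fin d → ℤ) → CCover d := fun k => (char k (incl a) - 1)⁻¹ • c k with hb
  have hb0 : b 0 = 0 := by simp [hb, hc0]
  have hbM : ∀ (m : ℕ) (k : Fin d → ℤ),
      ‖intVec k‖ ^ m * Real.exp (2 * Real.pi * ‖intVec k‖ * (r / 2)) * ‖b k‖ ≤
        (γ * (d : ℝ) ^ N * (N + m + d + 1).factorial * r⁻¹ ^ (N + m + d + 1) * M) *
          (wt k ^ (d + 1))⁻¹ := by
    intro m k
    have hw := wt_pos k
    rcases eq_or_ne k 0 with rfl | hk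
    · rw [hb0, norm_zero, mul_zero]
      positivity
    · have h1 := (norm_inv_char_sub_one_le hγ (Nat.le_ceil τ) ha hk).2
      have h2 : ‖b k‖ ≤ (γ * (d * wt k) ^ N) *
          (M * Real.exp (-(2 * Real.pi * ‖intVec k‖ * r))) := by
        rw [hb, norm_smul]
        exact mul_le_mul h1 (hcM k) (norm_nonneg _) (by positivity)
      have h3 := wt_pow_mul_exp_le hk hr (N + m)
      have hexp : Real.exp (2 * Real.pi * ‖intVec k‖ * (r / 2)) *
          Real.exp (-(2 * Real.pi * ‖intVec k‖ * r)) = Real.exp (-(Real.pi * ‖intVec k‖ * r)) := by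
        rw [← Real.exp_add]
        congr 1
        ring
      calc ‖intVec k‖ ^ m * Real.exp (2 * Real.pi * ‖intVec k‖ * (r / 2)) * ‖b k‖
          ≤ wt k ^ m * Real.exp (2 * Real.pi * ‖intVec k‖ * (r / 2)) *
            ((γ * (d * wt k) ^ N) * (M * Real.exp (-(2 * Real.pi * ‖intVec k‖ * r)))) := by
              gcongr
              exact norm_le_wt k
        _ = (γ * (d : ℝ) ^ N * M) * (wt k ^ (N + m) *
            (Real.exp (2 * Real.pi * ‖intVec k‖ * (r / 2)) *
              Real.exp (-(2 * Real.pi * ‖intVec k‖ * r)))) := by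
              rw [mul_pow, pow_add]; ring
        _ ≤ (γ * (d : ℝ) ^ N * M) * ((N + m + d + 1).factorial * r⁻¹ ^ (N + m + d + 1) *
            (wt k ^ (d + 1))⁻¹) := by
              rw [hexp]
              gcongr
        _ = _ := by ring
  have hsum : ∀ m : ℕ, Summable fun k =>
      ‖intVec k‖ ^ m * Real.exp (2 * Real.pi * ‖intVec k‖ * (r / 2)) * ‖b k‖ := fun m =>
    Summable.of_nonneg_of_le (fun k => by positivity) (hbM m) ((summable_wt d).mul_left _)
  have hbs : Summable fun k => ‖b k‖ := by
    refine Summable.of_nonneg_of_le (fun k => norm_nonneg _) (fun k => ?_) (hsum 0)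
    rw [pow_zero, one_mul]
    exact le_mul_of_one_le_left (norm_nonneg _) (Real.one_le_exp (by positivity))
  have hcs : Summable fun k => ‖c k‖ := by
    refine Summable.of_nonneg_of_le (fun k => norm_nonneg _) (fun k => ?_)
      ((summable_wt d).mul_left (M * ((0 + d + 1).factorial * r⁻¹ ^ (0 + d + 1))))
    have hw := wt_pos k
    rcases eq_or_ne k 0 with rfl | hk
    · rw [hc0, norm_zero]
      positivity
    · refine (hcM k).trans ?_
      rw [mul_assoc M]
      refine mul_le_mul_of_nonneg_left ?_ hM0
      refine le_trans ?_ (wt_pow_mul_exp_le hk hr 0)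
      rw [pow_zero, one_mul, Real.exp_le_exp]
      have : 0 ≤ Real.pi * ‖intVec k‖ * r := by positivity
      linarith
  have hζ : HolOn (fourierSeries b) (r / 2) := holOn_fourierSeries hsum
  refine ⟨fourierSeries b, hζ, fourierSeries_periodic b, isReal_fourierSeries hbs ?_, ?_, ?_⟩
  · intro k i
    have h1 : c (-k) i = starRingEnd ℂ (c k i) := coeff_neg_of_real gp.real hgc gr k i
    have h2 : (char (-k) (incl a) - 1)⁻¹ = starRingEnd ℂ ((char k (incl a) - 1)⁻¹) := by
      rw [char_neg_incl, map_inv₀, map_sub, map_one]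
    simp only [hb, PiLp.smul_apply, smul_eq_mul, map_mul, h1, h2]
  · intro z hz
    have h := norm_fourierSeries_le ((summable_wt d).mul_left
      (γ * (d : ℝ) ^ N * (N + 0 + d + 1).factorial * r⁻¹ ^ (N + 0 + d + 1) * M))
      (fun k => by simpa only [pow_zero, one_mul] using hbM 0 k) (le_of_lt hz)
    refine h.trans ?_
    rw [tsum_mul_left, ← hZ, add_zero]
    have h1 : (0 : ℝ) ≤ r⁻¹ ^ (N + d + 1) * M := by positivity
    have h2 : γ * (d : ℝ) ^ N * (N + d + 1).factorial * r⁻¹ ^ (N + d + 1) * M * Z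
        = C₀ * (r⁻¹ ^ (N + d + 1) * M) := by rw [hC₀]; ring
    rw [h2, mul_assoc (C₀ + 1)]
    nlinarith
  · intro z hz
    refine HolOn.eqOn (u := fun z => fourierSeries b (z + incl a) - fourierSeries b z) (v := g)
      (ContDiffOn.sub (hζ.translate a) hζ) (hg.mono (by linarith)) (fun x => ?_) hz
    have s1 : ∀ x : Cover d, Summable fun k => char k (incl x) • b k := fun x => by
      refine Summable.of_norm ?_
      simpa [norm_smul, norm_char_incl] using hbs
    have e1 := ((s1 (x + a)).hasSum.sub (s1 x).hasSum)
    have e2 := gp.real.hasSum_coeff hgc hcs x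
    simp only [fourierSeries]
    rw [← map_add]
    refine e1.unique ?_
    convert e2 using 2 with k
    rw [map_add, char_add, ← sub_smul, hb]
    simp only
    rw [smul_smul]
    rcases eq_or_ne k 0 with rfl | hk
    · have : coeff (fun x => g (incl x)) 0 = 0 := hc0
      simp [hc0, this]
    · have hne := (norm_inv_char_sub_one_le hγ (Nat.le_ceil τ) ha hk).1
      congr 1
      field_simp

lemma IsReal.norm_imPart_le {w : CCover d → CCover d} {r K : ℝ} (hw : HolOn w r) (hr : IsReal w)
    (hK : ∀ z ∈ strip d r, ‖fderiv ℂ w z‖ ≤ K) {z : CCover d} (hz : z ∈ strip d r) :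
    ‖imPart (w z)‖ ≤ K * ‖imPart z‖ := by
  have hr0 : 0 < r := (norm_nonneg _).trans_lt hz
  have h := (convex_strip r).norm_image_sub_le_of_norm_fderiv_le (𝕜 := ℂ)
    (fun x hx => hw.differentiableAt hx) hK (incl_mem_strip hr0 (rePart z)) hz
  have h1 : z - incl (rePart z) = Complex.I • incl (imPart z) := by
    rw [sub_eq_iff_eq_add']
    exact (incl_rePart_add z).symm
  rw [h1, norm_smul, Complex.norm_I, one_mul, norm_incl] at h
  refine le_trans ?_ h
  have h2 : imPart (w z) = imPart (w z - w (incl (rePart z))) := by rw [map_sub, hr, sub_zero]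
  rw [h2]
  exact TorusKAM.norm_imPart_le _

/-- Operators that preserve the real points. -/
def RealOp (T : CCover d →L[ℂ] CCover d) : Prop := ∀ x, imPart (T (incl x)) = 0

lemma RealOp.inverse {T S : CCover d →L[ℂ] CCover d} (hT : RealOp T) (hST : S * T = 1)
    (hTS : T * S = 1) : RealOp S := by
  intro x
  set y := S (incl x) with hy
  have h1 : T y = incl x := by
    have := congrArg (fun L => L (incl x)) hTS
    simpa using this
  have h2 : imPart (T y) = rePart (T (incl (imPart y))) := by
    conv_lhs => rw [← incl_rePart_add y, map_add, map_smul, map_add, hT, zero_add,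
      ← incl_rePart_of_imPart_eq_zero (hT (imPart y)), imPart_I_smul_incl]
  have h3 : T (incl (imPart y)) = 0 := by
    rw [← incl_rePart_of_imPart_eq_zero (hT (imPart y)), ← h2, h1, imPart_incl, map_zero]
  have h4 : incl (imPart y) = S (T (incl (imPart y))) := by
    have := congrArg (fun L => L (incl (imPart y))) hST
    simpa using this.symm
  rw [h3, map_zero] at h4
  simpa using congrArg rePart h4

lemma IsReal.realOp_fderiv {w : CCover d → CCover d} {r : ℝ} (hw : HolOn w r) (hr : IsReal w)
    (hr0 : 0 < r) (x : Cover d) : RealOp (fderiv ℂ w (incl x)) := by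
  intro v
  have h1 := (hw.differentiableAt (incl_mem_strip hr0 x)).hasFDerivAt.restrictScalars ℝ
  have h2 : HasFDerivAt (fun y : Cover d => imPart (w (incl y))) _ x :=
    imPart.hasFDerivAt.comp x (h1.comp x incl.hasFDerivAt)
  have h3 : (fun y : Cover d => imPart (w (incl y))) = fun _ => 0 := funext hr
  rw [h3] at h2
  have h4 := congrArg (fun L => L v) (h2.unique (hasFDerivAt_const _ _))
  simpa using h4

/-- Second-order Taylor estimate on strips. -/
lemma HolOn.norm_taylor_le {P : CCover d → CCover d} {r M : ℝ} (hr : 0 < r) (hP : HolOn P (4 * r))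
    (hM : ∀ z ∈ strip d (4 * r), ‖P z‖ ≤ M) {p ξ : CCover d} (hp : p ∈ strip d (2 * r))
    (hq : p + ξ ∈ strip d (2 * r)) :
    ‖P (p + ξ) - P p - fderiv ℂ P p ξ‖ ≤ M / r ^ 2 * ‖ξ‖ ^ 2 := by
  have h1 : ∀ z ∈ strip d (3 * r), ‖fderiv ℂ P z‖ ≤ M / r := fun z hz => by
    have := hP.norm_fderiv_le hM (by linarith : 3 * r < 4 * r) hz
    rwa [show 4 * r - 3 * r = r by ring] at this
  have h2 : ∀ z ∈ strip d (2 * r), ‖fderiv ℂ (fderiv ℂ P) z‖ ≤ M / r ^ 2 := fun z hz => by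
    have := (hP.derivative.mono (by linarith : 3 * r ≤ 4 * r)).norm_fderiv_le h1
      (by linarith : 2 * r < 3 * r) hz
    rwa [show 3 * r - 2 * r = r by ring, div_div, ← sq] at this
  have hM0 : 0 ≤ M := (norm_nonneg _).trans (hM _ (incl_mem_strip (by linarith) 0))
  have hseg : segment ℝ p (p + ξ) ⊆ strip d (2 * r) := (convex_strip _).segment_subset hp hq
  have h3 : ∀ z ∈ segment ℝ p (p + ξ), ‖fderiv ℂ P z - fderiv ℂ P p‖ ≤ M / r ^ 2 * ‖ξ‖ := by
    intro z hz
    have := (convex_strip (2 * r)).norm_image_sub_le_of_norm_fderiv_le (𝕜 := ℂ)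
      (fun x hx => (hP.derivative.mono (by linarith : 2 * r ≤ 4 * r)).differentiableAt hx) h2 hp
      (hseg hz)
    refine this.trans ?_
    gcongr
    have := norm_sub_le_of_mem_segment hz
    simpa using this
  have h4 := (convex_segment p (p + ξ)).norm_image_sub_le_of_norm_fderiv_le' (𝕜 := ℂ)
    (fun x hx => (hP.mono (by linarith : 2 * r ≤ 4 * r)).differentiableAt (hseg hx)) h3
    (left_mem_segment ℝ p _) (right_mem_segment ℝ p _)
  simp only [add_sub_cancel_left] at h4
  refine h4.trans (le_of_eq ?_)
  ring

section Neumann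

variable {R : Type*} [NormedRing R] [CompleteSpace R]

lemma isUnit_one_add_of_norm_lt {t : R} (ht : ‖t‖ < 1) : IsUnit (1 + t) := by
  have := isUnit_one_sub_of_norm_lt_one (x := -t) (by rwa [norm_neg])
  rwa [sub_neg_eq_add] at this

lemma norm_inverse_one_add_le {t : R} (h1 : ‖(1 : R)‖ ≤ 1) {c : ℝ} (hc : c < 1) (ht : ‖t‖ ≤ c) :
    ‖Ring.inverse (1 + t)‖ ≤ (1 - c)⁻¹ ∧ ‖Ring.inverse (1 + t) - 1‖ ≤ c / (1 - c) := by
  have hu := isUnit_one_add_of_norm_lt (ht.trans_lt hc)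
  have h2 := Ring.inverse_mul_cancel _ hu
  set B := Ring.inverse (1 + t)
  have h3 : B = 1 - B * t := by rw [mul_add, mul_one] at h2; exact eq_sub_of_add_eq h2
  have hc0 : 0 < 1 - c := by linarith
  have h4 : ‖B * t‖ ≤ ‖B‖ * c := (norm_mul_le _ _).trans (by gcongr)
  have h5 : ‖B‖ ≤ (1 - c)⁻¹ := by
    have : ‖B‖ ≤ 1 + ‖B‖ * c := by
      conv_lhs => rw [h3]
      exact (norm_sub_le _ _).trans (add_le_add h1 h4)
    rw [← one_div, le_div_iff₀ hc0]
    linarith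
  refine ⟨h5, ?_⟩
  have h6 : B - 1 = -(B * t) := by conv_lhs => rw [h3]; simp
  rw [h6, norm_neg, div_eq_inv_mul]
  refine h4.trans ?_
  have : 0 ≤ c := (norm_nonneg _).trans ht
  gcongr

end Neumann

end CohomologicalEquation

section NewtonStep

variable {d : ℕ}

/-- The defect of the equation `w (z + a) - w z = P (z + w z) - lam`. -/
noncomputable def defect (a : Cover d) (P w : CCover d → CCover d) (lam : Cover d) (z : CCover d) :
    CCover d :=
  w (z + incl a) - w z - P (z + w z) + incl lam

section Defect

variable {a : Cover d} {P w : CCover d → CCover d} {lam : Cover d} {r : ℝ}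

lemma add_mem_strip (hw : HolOn w r) (wr : IsReal w)
    (hK : ∀ z ∈ strip d r, ‖fderiv ℂ w z‖ ≤ 1 / 4) {s : ℝ} (hs : s ≤ r) {z : CCover d}
    (hz : z ∈ strip d s) : z + w z ∈ strip d (5 / 4 * s) := by
  have h1 := wr.norm_imPart_le hw hK (strip_mono hs hz)
  have h2 : ‖imPart z‖ < s := hz
  change ‖imPart (z + w z)‖ < _
  rw [map_add]
  have := norm_add_le (imPart z) (imPart (w z))
  linarith

lemma holOn_defect (hr : 0 < r) (hP : HolOn P (4 * r)) (hw : HolOn w r) (wr : IsReal w)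
    (hK : ∀ z ∈ strip d r, ‖fderiv ℂ w z‖ ≤ 1 / 4) : HolOn (defect a P w lam) r := by
  have h1 : ContDiffOn ℂ ∞ (fun z => P (z + w z)) (strip d r) :=
    ContDiffOn.comp (g := P) (f := fun z => z + w z) hP (contDiffOn_id.add hw) fun z hz =>
      strip_mono (by linarith) (add_mem_strip hw wr hK le_rfl hz)
  exact (((hw.translate a).sub hw).sub h1).add contDiffOn_const

lemma defect_periodic (hP : CPeriodic P) (hw : CPeriodic w) : CPeriodic (defect a P w lam) := by
  intro z k
  simp only [defect]
  rw [hw z k, add_right_comm z _ (incl a), hw, add_right_comm z _ (w z), hP]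

lemma isReal_defect (hP : IsReal P) (hw : IsReal w) : IsReal (defect a P w lam) := by
  intro x
  have h1 : incl x + w (incl x) = incl (x + rePart (w (incl x))) := by
    rw [map_add, incl_rePart_of_imPart_eq_zero (hw x)]
  simp only [defect]
  rw [h1, ← map_add, map_add, map_sub, map_sub, hw, hw, hP]
  simp

lemma fderiv_defect (hr : 0 < r) (hP : HolOn P (4 * r)) (hw : HolOn w r) (wr : IsReal w)
    (hK : ∀ z ∈ strip d r, ‖fderiv ℂ w z‖ ≤ 1 / 4) {z : CCover d} (hz : z ∈ strip d r) :
    fderiv ℂ (defect a P w lam) z = fderiv ℂ w (z + incl a) - fderiv ℂ w z -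
      (fderiv ℂ P (z + w z)).comp (1 + fderiv ℂ w z) := by
  have h1 : HasFDerivAt (fun z => w (z + incl a)) (fderiv ℂ w (z + incl a)) z := by
    have := (hw.differentiableAt ((add_incl_mem_strip a).2 hz)).hasFDerivAt
    exact this.comp z ((hasFDerivAt_id z).add_const _)
  have h2 := (hw.differentiableAt hz).hasFDerivAt
  have h3 : HasFDerivAt (fun z => z + w z) (1 + fderiv ℂ w z) z := (hasFDerivAt_id z).add h2
  have h4 := (hP.differentiableAt
    (strip_mono (by linarith) (add_mem_strip hw wr hK le_rfl hz))).hasFDerivAt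
  have h5 : HasFDerivAt (fun z => P (z + w z)) _ z := h4.comp z h3
  have h6 : HasFDerivAt (defect a P w lam) _ z := ((h1.sub h2).sub h5).add_const (incl lam)
  exact h6.fderiv

end Defect

set_option maxHeartbeats 1600000 in
/-- One step of the Newton iteration. -/
theorem exists_newton_step (d : ℕ) (γ τ : ℝ) (hγ : 0 < γ) :
    ∃ (C : ℝ) (p : ℕ), 1 ≤ C ∧ ∀ a : Cover d, IsDiophantine γ τ (Torus.proj a) →
      ∀ (r e : ℝ) (P w : CCover d → CCover d) (lam : Cover d), 0 < r → r ≤ 1 → 0 ≤ e →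
        HolOn P (4 * r) → CPeriodic P → IsReal P → (∀ z ∈ strip d (4 * r), ‖P z‖ ≤ 1) →
        HolOn w r → CPeriodic w → IsReal w → (∀ z ∈ strip d r, ‖fderiv ℂ w z‖ ≤ 1 / 4) →
        (∀ z ∈ strip d r, ‖defect a P w lam z‖ ≤ e) → C * r⁻¹ ^ p * e ≤ r →
        ∃ (ξ : CCover d → CCover d) (μ : Cover d), HolOn ξ (r / 2) ∧ CPeriodic ξ ∧ IsReal ξ ∧
          (∀ z ∈ strip d (r / 2), ‖ξ z‖ ≤ C * r⁻¹ ^ p * e) ∧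
          (∀ z ∈ strip d (r / 4), ‖fderiv ℂ ξ z‖ ≤ C * r⁻¹ ^ p * e) ∧
          ∀ z ∈ strip d (r / 4),
            ‖defect a P (fun z => w z + ξ z) (lam + μ) z‖ ≤ C * r⁻¹ ^ p * e ^ 2 := by
  obtain ⟨C₀, q, hC₀, hsol⟩ := exists_cohomological_solution d γ τ hγ
  refine ⟨420 * C₀ ^ 2, 2 * q + 2, by nlinarith, ?_⟩
  intro a ha r e P w lam hr hr1 he hP Pp Pr PM hw wp wr wK hE hsmall
  have hone : ‖(1 : CCover d →L[ℂ] CCover d)‖ ≤ 1 := ContinuousLinearMap.norm_id_le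
  set E := defect a P w lam with hEdef
  have EH : HolOn E r := holOn_defect hr hP hw wr wK
  have Ep : CPeriodic E := defect_periodic Pp wp
  have Er : IsReal E := isReal_defect Pr wr
  set A : CCover d → CCover d →L[ℂ] CCover d := fun z => 1 + fderiv ℂ w z with hA
  set B : CCover d → CCover d →L[ℂ] CCover d := fun z => Ring.inverse (A z) with hB
  have Aunit : ∀ z ∈ strip d r, IsUnit (A z) := fun z hz =>
    isUnit_one_add_of_norm_lt ((wK z hz).trans_lt (by norm_num))
  have BA : ∀ z ∈ strip d r, B z * A z = 1 := fun z hz => Ring.inverse_mul_cancel _ (Aunit z hz)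
  have AB : ∀ z ∈ strip d r, A z * B z = 1 := fun z hz => Ring.mul_inverse_cancel _ (Aunit z hz)
  have Bbd : ∀ z ∈ strip d r, ‖B z‖ ≤ 2 ∧ ‖B z - 1‖ ≤ 1 / 3 := fun z hz => by
    have := norm_inverse_one_add_le hone (by norm_num : (1 / 4 : ℝ) < 1) (wK z hz)
    exact ⟨this.1.trans (by norm_num), this.2.trans (by norm_num)⟩
  have AH : ContDiffOn ℂ ∞ A (strip d r) := contDiffOn_const.add hw.derivative
  have Ap : CPeriodic A := fun z k => by simp only [hA]; rw [wp.derivative z k]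
  have Bp : CPeriodic B := fun z k => by simp only [hB]; rw [Ap z k]
  have BH : HolOn B r := fun z hz => by
    obtain ⟨U, hU⟩ := Aunit z hz
    have h1 : ContDiffAt ℂ ∞ Ring.inverse (A z) := by
      rw [← hU]; exact contDiffAt_ringInverse ℂ U
    exact h1.comp_contDiffWithinAt z (AH z hz)
  have Areal : ∀ x, RealOp (A (incl x)) := fun x v => by
    have := wr.realOp_fderiv hw hr x v
    simp [hA, this]
  have mem : ∀ x : Cover d, incl x ∈ strip d r := incl_mem_strip hr
  have Breal : ∀ x, RealOp (B (incl x)) := fun x =>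
    (Areal x).inverse (BA _ (mem x)) (AB _ (mem x))
  have BTH : HolOn (fun z => B (z + incl a)) r := BH.translate a
  have BTp : CPeriodic fun z => B (z + incl a) := Bp.translate _
  -- the mean of `B`
  set m : CCover d →L[ℂ] CCover d := mean fun x => B (incl x + incl a) with hm
  have cB : Continuous fun x : Cover d => B (incl x + incl a) := (BTH.contDiff_incl hr).continuous
  have cE : Continuous fun x : Cover d => E (incl x) := (EH.contDiff_incl hr).continuous
  have hm1 : ‖m - 1‖ ≤ 1 / 3 := by
    have h1 : mean (fun x : Cover d => B (incl x + incl a) + -1) = m + -1 := by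
      rw [IsPeriodic.mean_add BTp.real (fun _ _ => rfl) cB continuous_const, mean_const]
    rw [sub_eq_add_neg, ← h1]
    refine norm_mean_le fun x => ?_
    rw [← sub_eq_add_neg, ← map_add]
    exact (Bbd _ (mem _)).2
  have hm' : m = 1 + (m - 1) := (add_sub_cancel 1 m).symm
  have munit : IsUnit m := by
    rw [hm']; exact isUnit_one_add_of_norm_lt (hm1.trans_lt (by norm_num))
  set n := Ring.inverse m with hn
  have nbd : ‖n‖ ≤ 2 := by
    have := (norm_inverse_one_add_le hone (by norm_num : (1 / 3 : ℝ) < 1) hm1).1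
    rw [← hm'] at this
    exact this.trans (by norm_num)
  have nm : n * m = 1 := Ring.inverse_mul_cancel _ munit
  have mn : m * n = 1 := Ring.mul_inverse_cancel _ munit
  have mapply : ∀ v, mean (fun x : Cover d => B (incl x + incl a) v) = m v := fun v => by
    have := BTp.real.mean_clm cB
      ((ContinuousLinearMap.apply ℂ (CCover d) v).restrictScalars ℝ)
    simpa using this
  have mreal : RealOp m := fun v => by
    have h1 : IsPeriodic fun x : Cover d => B (incl x + incl a) (incl v) := fun x k =>
      congrArg (fun L => L (incl v)) (BTp.real x k)
    have h2 := h1.mean_clm (cB.clm_apply continuous_const) imPart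
    rw [← mapply, ← h2]
    have : ∀ x : Cover d, imPart (B (incl x + incl a) (incl v)) = 0 := fun x => by
      rw [← map_add]; exact Breal _ v
    simp [this, mean]
  have nreal : RealOp n := mreal.inverse nm mn
  set v₀ : CCover d := mean fun x => B (incl x + incl a) (E (incl x)) with hv₀
  have pBE : IsPeriodic fun x : Cover d => B (incl x + incl a) (E (incl x)) := fun x k =>
    congrArg₂ (fun L v => L v) (BTp.real x k) (Ep.real x k)
  have cBE : Continuous fun x : Cover d => B (incl x + incl a) (E (incl x)) := cB.clm_apply cE
  have bBE : ∀ x : Cover d, ‖B (incl x + incl a) (E (incl x))‖ ≤ 2 * e := fun x => by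
    refine (ContinuousLinearMap.le_opNorm _ _).trans ?_
    refine mul_le_mul ?_ (hE _ (mem x)) (norm_nonneg _) (by norm_num)
    rw [← map_add]
    exact (Bbd _ (mem _)).1
  have v₀bd : ‖v₀‖ ≤ 2 * e := norm_mean_le bBE
  have realBE : ∀ x : Cover d, imPart (B (incl x + incl a) (E (incl x))) = 0 := fun x => by
    rw [← map_add, ← incl_rePart_of_imPart_eq_zero (Er x)]
    exact Breal _ _
  have v₀real : imPart v₀ = 0 := by
    rw [hv₀, ← pBE.mean_clm cBE imPart]
    simp [realBE, mean]
  set μ : Cover d := rePart (-(n v₀)) with hμ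
  have nv₀real : imPart (-(n v₀)) = 0 := by
    rw [map_neg, ← incl_rePart_of_imPart_eq_zero v₀real, nreal, neg_zero]
  have hμ' : incl μ = -(n v₀) := incl_rePart_of_imPart_eq_zero nv₀real
  have μbd : ‖incl μ‖ ≤ 4 * e := by
    rw [hμ', norm_neg]
    refine (n.le_opNorm v₀).trans ?_
    nlinarith [norm_nonneg n, norm_nonneg v₀]
  -- the right-hand side of the cohomological equation
  set g : CCover d → CCover d := fun z => -(B (z + incl a) (E z + incl μ)) with hg
  have gH : HolOn g r := (ContDiffOn.clm_apply BTH (ContDiffOn.add EH contDiffOn_const)).neg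
  have gp : CPeriodic g := fun z k => by
    have h1 := BTp z k
    simp only at h1
    simp only [hg]
    rw [Ep z k, h1]
  have gr : IsReal g := fun x => by
    simp only [hg]
    rw [map_neg, map_add, map_add, realBE, ← map_add, Breal, add_zero, neg_zero]
  have gM : ∀ z ∈ strip d r, ‖g z‖ ≤ 10 * e := fun z hz => by
    simp only [hg, norm_neg]
    refine (ContinuousLinearMap.le_opNorm _ _).trans ?_
    have h1 := (Bbd _ ((add_incl_mem_strip a).2 hz)).1
    have h2 : ‖E z + incl μ‖ ≤ 5 * e := (norm_add_le _ _).trans (by linarith [hE z hz])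
    calc _ ≤ 2 * (5 * e) := mul_le_mul h1 h2 (norm_nonneg _) (by norm_num)
      _ = _ := by ring
  have gmean : mean (fun x : Cover d => g (incl x)) = 0 := by
    have h1 : mean (fun x : Cover d => B (incl x + incl a) (E (incl x)) +
        B (incl x + incl a) (incl μ)) = v₀ + m (incl μ) := by
      rw [pBE.mean_add (fun x k => congrArg (fun L => L (incl μ)) (BTp.real x k)) cBE
        (cB.clm_apply continuous_const), mapply]
    have h2 : m (incl μ) = -v₀ := by
      rw [hμ', map_neg]
      have := congrArg (fun L => L v₀) mn
      simpa using this
    have h3 : (fun x : Cover d => g (incl x)) = fun x => -(B (incl x + incl a) (E (incl x)) +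
        B (incl x + incl a) (incl μ)) := funext fun x => by simp only [hg, map_add]
    have h4 : mean (fun x : Cover d => g (incl x)) = -(v₀ + m (incl μ)) := by
      rw [h3, ← h1]
      exact integral_neg _
    rw [h4, h2, add_neg_cancel, neg_zero]
  obtain ⟨ζ, ζH, ζp, ζr, ζM, ζeq⟩ := hsol a ha r (10 * e) g hr gH gp gr gM gmean
  set ξ : CCover d → CCover d := fun z => A z (ζ z) with hξ
  have ξH : HolOn ξ (r / 2) :=
    ContDiffOn.clm_apply (ContDiffOn.mono AH (strip_mono (by linarith))) ζH
  have ξp : CPeriodic ξ := fun z k => congrArg₂ (fun L v => L v) (Ap z k) (ζp z k)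
  have ξr : IsReal ξ := fun x => by
    simp only [hξ]
    rw [← incl_rePart_of_imPart_eq_zero (ζr x), Areal]
  set R : ℝ := C₀ * r⁻¹ ^ q * e with hR
  have hrinv : 1 ≤ r⁻¹ := one_le_inv_iff₀.2 ⟨hr, hr1⟩
  have hrinv0 : 0 < r⁻¹ := by positivity
  have hC₀0 : 0 < C₀ := by linarith
  have hR0 : 0 ≤ R := by positivity
  have ζM' : ∀ z ∈ strip d (r / 2), ‖ζ z‖ ≤ 10 * R := fun z hz =>
    (ζM z hz).trans (le_of_eq (by rw [hR]; ring))
  have ξM : ∀ z ∈ strip d (r / 2), ‖ξ z‖ ≤ 20 * R := fun z hz => by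
    have h1 : ‖A z‖ ≤ 2 := (norm_add_le _ _).trans
      (by linarith [wK z (strip_mono (by linarith : r / 2 ≤ r) hz)])
    calc ‖ξ z‖ ≤ ‖A z‖ * ‖ζ z‖ := ContinuousLinearMap.le_opNorm _ _
      _ ≤ 2 * (10 * R) := mul_le_mul h1 (ζM' z hz) (norm_nonneg _) (by norm_num)
      _ = _ := by ring
  have hpow : r⁻¹ ^ (q + 1) ≤ r⁻¹ ^ (2 * q + 2) := pow_le_pow_right₀ hrinv (by omega)
  have hpow0 : r⁻¹ ^ q ≤ r⁻¹ ^ (q + 1) := pow_le_pow_right₀ hrinv (by omega)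
  set T : ℝ := r⁻¹ ^ (2 * q + 2) * e with hT
  have hT0 : 0 ≤ T := by positivity
  have hRT1 : R * r⁻¹ ≤ C₀ ^ 2 * T := by
    have h1 : R * r⁻¹ = C₀ * (r⁻¹ ^ (q + 1) * e) := by rw [hR]; ring
    have h2 : r⁻¹ ^ (q + 1) * e ≤ T := by rw [hT]; gcongr
    have h3 : C₀ ≤ C₀ ^ 2 := by nlinarith
    rw [h1]
    gcongr
  have hRT : R ≤ C₀ ^ 2 * T := (le_mul_of_one_le_right hR0 hrinv).trans hRT1
  have hbound : 420 * C₀ ^ 2 * r⁻¹ ^ (2 * q + 2) * e = 420 * (C₀ ^ 2 * T) := by rw [hT]; ring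
  have hCT0 : 0 ≤ C₀ ^ 2 * T := by positivity
  rw [hbound] at hsmall
  have hRr : 20 * R ≤ r := by linarith
  refine ⟨ξ, μ, ξH, ξp, ξr, ?_, ?_, ?_⟩
  · intro z hz
    rw [hbound]
    linarith [ξM z hz]
  · intro z hz
    rw [hbound]
    have h1 := ξH.norm_fderiv_le ξM (by linarith : r / 4 < r / 2) hz
    have h2 : 20 * R / (r / 2 - r / 4) = 80 * (R * r⁻¹) := by field_simp; ring
    rw [h2] at h1
    linarith
  · intro z hz
    have hz2 : z ∈ strip d (r / 2) := strip_mono (by linarith) hz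
    have hzr : z ∈ strip d r := strip_mono (by linarith) hz
    have hza : z + incl a ∈ strip d r := (add_incl_mem_strip a).2 hzr
    set y := z + w z with hy
    have hy1 : y ∈ strip d (5 / 4 * (r / 4)) := add_mem_strip hw wr wK (by linarith) hz
    have hy2 : y ∈ strip d (2 * r) := strip_mono (by linarith) hy1
    have hy3 : y + ξ z ∈ strip d (2 * r) := by
      change ‖imPart (y + ξ z)‖ < _
      rw [map_add]
      have h1 : ‖imPart y‖ < 5 / 4 * (r / 4) := hy1
      have h2 := (norm_imPart_le (ξ z)).trans (ξM z hz2)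
      have h3 := norm_add_le (imPart y) (imPart (ξ z))
      linarith
    have hQ := hP.norm_taylor_le hr PM hy2 hy3
    have hDE := EH.norm_fderiv_le hE (by linarith : r / 2 < r) hz2
    have hformula : defect a P (fun z => w z + ξ z) (lam + μ) z
        = fderiv ℂ E z (ζ z) - (P (y + ξ z) - P y - fderiv ℂ P y (ξ z)) := by
      have h1 : fderiv ℂ E z = fderiv ℂ w (z + incl a) - fderiv ℂ w z -
        (fderiv ℂ P (z + w z)).comp (1 + fderiv ℂ w z) := fderiv_defect hr hP hw wr wK hzr
      have h2 : ζ (z + incl a) = ζ z - B (z + incl a) (E z + incl μ) := by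
        have := ζeq z hz2
        rw [sub_eq_iff_eq_add] at this
        rw [this]
        exact neg_add_eq_sub _ _
      have h3 : A (z + incl a) (B (z + incl a) (E z + incl μ)) = E z + incl μ := by
        have := congrArg (fun L => L (E z + incl μ)) (AB _ hza)
        simpa using this
      have h4 : ξ (z + incl a) = A (z + incl a) (ζ z) - (E z + incl μ) := by
        simp only [hξ]
        rw [h2, map_sub, h3]
      have h5 : E z = w (z + incl a) - w z - P y + incl lam := rfl
      have h6 : z + (w z + ξ z) = y + ξ z := by rw [hy, add_assoc]
      rw [h1]
      simp only [defect]
      rw [h4, h6, h5, ← hy]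
      simp only [hξ, hA, sub_apply, add_apply,
        ContinuousLinearMap.comp_apply, one_apply_eq_self, map_add]
      abel
    rw [hformula]
    have h1 : ‖fderiv ℂ E z (ζ z)‖ ≤ e / (r - r / 2) * (10 * R) :=
      (ContinuousLinearMap.le_opNorm _ _).trans
        (mul_le_mul hDE (ζM' z hz2) (norm_nonneg _) (div_nonneg he (by linarith)))
    have h2 : ‖P (y + ξ z) - P y - fderiv ℂ P y (ξ z)‖ ≤ 1 / r ^ 2 * (20 * R) ^ 2 := by
      refine hQ.trans ?_
      gcongr
      exact ξM z hz2
    refine (norm_sub_le _ _).trans ((add_le_add h1 h2).trans ?_)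
    have h3 : e / (r - r / 2) * (10 * R) = 20 * e * (R * r⁻¹) := by field_simp; ring
    have h4 : 1 / r ^ 2 * (20 * R) ^ 2 = 400 * (C₀ ^ 2 * T) * e := by
      rw [hR, hT]
      have : r⁻¹ ^ (2 * q + 2) = (r⁻¹ ^ q) ^ 2 * r⁻¹ ^ 2 := by ring
      rw [this, one_div, ← inv_pow]
      ring
    have h5 : 420 * C₀ ^ 2 * r⁻¹ ^ (2 * q + 2) * e ^ 2 = 420 * (C₀ ^ 2 * T) * e := by
      rw [hT]; ring
    rw [h3, h4, h5]
    nlinarith [mul_le_mul_of_nonneg_left hRT1 he]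

end NewtonStep

section NewtonSequences

variable {d : ℕ}

/-- Cauchy's estimates for the real derivatives of all orders of a holomorphic function. -/
lemma HolOn.norm_iteratedFDeriv_le (n : ℕ) :
    ∀ {F : Type} [NormedAddCommGroup F] [NormedSpace ℂ F] {u : CCover d → F} {r M : ℝ}
      (_ : 0 < r) (_ : HolOn u r) (_ : ∀ z ∈ strip d r, ‖u z‖ ≤ M) (x : Cover d),
      ‖iteratedFDeriv ℝ n (fun x => u (incl x)) x‖ ≤ 2 ^ n ^ 2 * r⁻¹ ^ n * M := by
  induction n with
  | zero =>
    intro F _ _ u r M hr hu hM x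
    simpa using hM _ (incl_mem_strip hr x)
  | succ n ih =>
    intro F _ _ u r M hr hu hM x
    have hM0 : 0 ≤ M := (norm_nonneg _).trans (hM _ (incl_mem_strip hr 0))
    let Λ : (CCover d →L[ℂ] F) →L[ℝ] (Cover d →L[ℝ] F) :=
      LinearMap.mkContinuous
        { toFun := fun L => (L.restrictScalars ℝ).comp incl
          map_add' := fun L L' => by ext; rfl
          map_smul' := fun c L => by ext; rfl } 1
        (fun L => by
          refine (ContinuousLinearMap.opNorm_comp_le _ _).trans ?_
          rw [one_mul]
          exact mul_le_of_le_one_right (norm_nonneg _) opNorm_incl_le)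
    have hΛ : ‖Λ‖ ≤ 1 := LinearMap.mkContinuous_norm_le _ zero_le_one _
    have hfd : fderiv ℝ (fun x => u (incl x)) = Λ ∘ fun x => fderiv ℂ u (incl x) := by
      funext y
      have h1 : HasFDerivAt (fun x => u (incl x)) _ y :=
        ((hu.differentiableAt (incl_mem_strip hr y)).hasFDerivAt.restrictScalars ℝ).comp y
          incl.hasFDerivAt
      exact h1.fderiv
    rw [← norm_iteratedFDeriv_fderiv, hfd]
    have hu' : HolOn (fderiv ℂ u) (r / 2) := hu.derivative.mono (by linarith)
    have hM' : ∀ z ∈ strip d (r / 2), ‖fderiv ℂ u z‖ ≤ M / (r - r / 2) := fun z hz =>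
      hu.norm_fderiv_le hM (by linarith) hz
    have h1 := ih (half_pos hr) hu' hM' x
    have h2 := Λ.norm_iteratedFDeriv_comp_left (x := x) (N := ∞) (n := n)
      (hu'.contDiff_incl (half_pos hr)).contDiffAt (by exact_mod_cast le_top)
    refine h2.trans ((mul_le_of_le_one_left (norm_nonneg _) hΛ).trans (h1.trans ?_))
    have h3 : 2 ^ n ^ 2 * (r / 2)⁻¹ ^ n * (M / (r - r / 2))
        = 2 ^ (n ^ 2 + n + 1) * (r⁻¹ ^ (n + 1) * M) := by
      have e1 : (r / 2)⁻¹ = 2 * r⁻¹ := by rw [inv_div]; rfl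
      have e2 : M / (r - r / 2) = 2 * r⁻¹ * M := by field_simp; ring
      rw [e1, e2, mul_pow]
      ring
    rw [h3, mul_assoc (2 ^ (n + 1) ^ 2)]
    have h4 : (2 : ℝ) ^ (n ^ 2 + n + 1) ≤ 2 ^ (n + 1) ^ 2 :=
      pow_le_pow_right₀ (by norm_num) (by nlinarith)
    gcongr

section Sequences

/-- The quadratic recursion of the Newton iteration stays small. -/
lemma newton_seq_small {C A K : ℝ} {p : ℕ} {e t : ℕ → ℝ} (hC : 0 ≤ C) (hA : 0 ≤ A) (hK : 0 ≤ K)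
    (he : ∀ n, 0 ≤ e n) (h0 : e 0 ≤ A * K) (ht : ∀ n, t n ≤ A * K * ((4 : ℝ)⁻¹ ^ n) ^ (p + 1))
    (hrec : ∀ n, e (n + 1) = C * (4 ^ n) ^ p * e n ^ 2 + t n)
    (hK' : C * (2 * A * 4 ^ (p + 1)) * K ≤ 8⁻¹ * 4⁻¹ ^ (p + 1)) (n : ℕ) :
    C * (4 ^ n) ^ p * e n ≤ 8⁻¹ * 4⁻¹ ^ n := by
  set G : ℝ := 2 * A * 4 ^ (p + 1) with hG
  have hG0 : 0 ≤ G := by positivity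
  have hq : (4 : ℝ)⁻¹ ^ (p + 1) ≤ 1 := pow_le_one₀ (by norm_num) (by norm_num)
  have main : ∀ n, e n ≤ G * K * ((4 : ℝ)⁻¹ ^ n) ^ (p + 1) → C * (4 ^ n) ^ p * e n
      ≤ C * G * K * 4⁻¹ ^ n := by
    intro n hn
    calc C * (4 ^ n) ^ p * e n ≤ C * (4 ^ n) ^ p * (G * K * ((4 : ℝ)⁻¹ ^ n) ^ (p + 1)) := by gcongr
      _ = C * G * K * 4⁻¹ ^ n * ((4 ^ n) * (4 : ℝ)⁻¹ ^ n) ^ p := by rw [mul_pow, pow_succ]; ring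
      _ = _ := by rw [← mul_pow]; norm_num
  have claim : ∀ n, e n ≤ G * K * ((4 : ℝ)⁻¹ ^ n) ^ (p + 1) := by
    intro n
    induction n with
    | zero =>
      have : A ≤ G := by
        have : (1 : ℝ) ≤ 4 ^ (p + 1) := one_le_pow₀ (by norm_num)
        rw [hG]; nlinarith
      simpa using h0.trans (by gcongr)
    | succ n ih =>
      set x : ℝ := ((4 : ℝ)⁻¹ ^ n) ^ (p + 1) with hx
      have hx0 : 0 ≤ x := by positivity
      have h1 := main n ih
      have h4n : (4 : ℝ)⁻¹ ^ n ≤ 1 := pow_le_one₀ (by norm_num) (by norm_num)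
      have h2 : C * (4 ^ n) ^ p * e n ≤ 8⁻¹ * 4⁻¹ ^ (p + 1) := by
        refine h1.trans (le_trans ?_ hK')
        exact mul_le_of_le_one_right (by positivity) h4n
      have h3 : C * (4 ^ n) ^ p * e n ^ 2 ≤ 8⁻¹ * 4⁻¹ ^ (p + 1) * (G * K * x) := by
        rw [sq, ← mul_assoc]
        exact mul_le_mul h2 ih (he n) (by positivity)
      have h4 : A * K * x = 2⁻¹ * 4⁻¹ ^ (p + 1) * (G * K * x) := by
        have : (4 : ℝ)⁻¹ ^ (p + 1) * 4 ^ (p + 1) = 1 := by rw [← mul_pow]; norm_num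
        calc A * K * x = A * K * x * ((4 : ℝ)⁻¹ ^ (p + 1) * 4 ^ (p + 1)) := by rw [this, mul_one]
          _ = _ := by rw [hG]; ring
      have h5 : ((4 : ℝ)⁻¹ ^ (n + 1)) ^ (p + 1) = 4⁻¹ ^ (p + 1) * x := by
        rw [pow_succ (4 : ℝ)⁻¹ n, mul_pow, mul_comm]
      have h6 : 0 ≤ (4 : ℝ)⁻¹ ^ (p + 1) * (G * K * x) := by positivity
      rw [hrec, h5]
      have h7 : G * K * ((4 : ℝ)⁻¹ ^ (p + 1) * x) = 4⁻¹ ^ (p + 1) * (G * K * x) := by ring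
      rw [h7]
      have h8 : t n ≤ A * K * x := ht n
      rw [mul_assoc (8⁻¹ : ℝ)] at h3
      rw [mul_assoc (2⁻¹ : ℝ)] at h4
      generalize (4 : ℝ)⁻¹ ^ (p + 1) * (G * K * x) = Y at h3 h4 h6 ⊢
      generalize A * K * x = Y' at h4 h8
      generalize C * (4 ^ n) ^ p * e n ^ 2 = Y'' at h3 ⊢
      linarith
  refine (main n (claim n)).trans ?_
  refine mul_le_mul_of_nonneg_right ?_ (by positivity)
  nlinarith

/-- A recursion with vanishing contraction factors is bounded. -/
lemma exists_bound_contracting (l : ℕ) : ∃ G : ℝ, 0 ≤ G ∧ ∀ x : ℕ → ℝ, ∀ D : ℝ, 0 ≤ D →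
    (∀ n, 0 ≤ x n) → x 0 ≤ D → (∀ n, x (n + 1) ≤ 4 ^ l * (8⁻¹ * 4⁻¹ ^ n * x n + D)) →
    ∀ n, x n ≤ G * D := by
  let X : ℕ → ℝ := fun n => Nat.rec 1 (fun n y => 4 ^ l * (8⁻¹ * 4⁻¹ ^ n * y + 1)) n
  have hX : ∀ n, X (n + 1) = 4 ^ l * (8⁻¹ * 4⁻¹ ^ n * X n + 1) := fun n => rfl
  have hX0 : ∀ n, 0 ≤ X n := by
    intro n
    induction n with
    | zero => exact zero_le_one
    | succ n ih => rw [hX]; positivity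
  set G : ℝ := 2 * 4 ^ l + ∑ n ∈ Finset.range (l + 1), X n with hG
  have hG0 : 0 ≤ ∑ n ∈ Finset.range (l + 1), X n := Finset.sum_nonneg fun n _ => hX0 n
  have hbound : ∀ n, X n ≤ G := by
    intro n
    rcases lt_or_ge n (l + 1) with hn | hn
    · have := Finset.single_le_sum (f := X) (fun n _ => hX0 n) (Finset.mem_range.2 hn)
      have h4 : (0 : ℝ) ≤ 2 * 4 ^ l := by positivity
      linarith
    · induction n, hn using Nat.le_induction with
      | base =>
        have h1 := Finset.single_le_sum (f := X) (fun n _ => hX0 n) (Finset.self_mem_range_succ l)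
        rw [hX]
        have : (4 : ℝ) ^ l * (8⁻¹ * 4⁻¹ ^ l * X l + 1)
            = 8⁻¹ * X l * (4 * 4⁻¹) ^ l + 4 ^ l := by rw [mul_pow]; ring
        rw [this, mul_inv_cancel₀ (by norm_num), one_pow]
        have h4 : (0 : ℝ) ≤ 4 ^ l := by positivity
        linarith [hX0 l]
      | succ n hn ih =>
        rw [hX]
        have h2 : (4 : ℝ)⁻¹ ^ n ≤ 4⁻¹ ^ l :=
          pow_le_pow_of_le_one (by norm_num) (by norm_num) (by omega)
        have h3 : (4 : ℝ) ^ l * 4⁻¹ ^ n ≤ 1 := by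
          calc (4 : ℝ) ^ l * 4⁻¹ ^ n ≤ 4 ^ l * 4⁻¹ ^ l := by gcongr
            _ = 1 := by rw [← mul_pow]; norm_num
        have h4 : (0 : ℝ) ≤ 4 ^ l := by positivity
        nlinarith [hX0 n, mul_le_mul_of_nonneg_right h3 (hX0 n)]
  refine ⟨G, by positivity, fun x D hD hx h0 hrec n => ?_⟩
  have key : ∀ n, x n ≤ X n * D := by
    intro n
    induction n with
    | zero => simpa [X] using h0
    | succ n ih =>
      rw [hX]
      refine (hrec n).trans ?_
      calc (4 : ℝ) ^ l * (8⁻¹ * 4⁻¹ ^ n * x n + D)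
          ≤ 4 ^ l * (8⁻¹ * 4⁻¹ ^ n * (X n * D) + D) := by gcongr
        _ = _ := by ring
  exact (key n).trans (by gcongr; exact hbound n)

/-- The Newton recursion inherits every order of decay of its source term. -/
lemma exists_newton_seq_decay (l : ℕ) : ∃ G : ℝ, 0 ≤ G ∧ ∀ (C D : ℝ) (p : ℕ) (e t : ℕ → ℝ),
    0 ≤ D → (∀ n, 0 ≤ e n) → e 0 ≤ D → (∀ n, t n ≤ D * ((4 : ℝ)⁻¹ ^ n) ^ l) →
    (∀ n, e (n + 1) = C * (4 ^ n) ^ p * e n ^ 2 + t n) →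
    (∀ n, C * (4 ^ n) ^ p * e n ≤ 8⁻¹ * 4⁻¹ ^ n) → ∀ n, e n ≤ G * D * ((4 : ℝ)⁻¹ ^ n) ^ l := by
  obtain ⟨G, hG0, hG⟩ := exists_bound_contracting l
  refine ⟨G, hG0, fun C D p e t hD he h0 ht hrec hsmall n => ?_⟩
  have hinv : ∀ n, ((4 : ℝ) ^ n) ^ l * ((4 : ℝ)⁻¹ ^ n) ^ l = 1 := fun n => by
    rw [← mul_pow, ← mul_pow]; norm_num
  have h1 := hG (fun n => ((4 : ℝ) ^ n) ^ l * e n) D hD (fun n => by have := he n; positivity)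
    (by simpa using h0) (fun n => by
      have h2 : e (n + 1) ≤ 8⁻¹ * 4⁻¹ ^ n * e n + D * ((4 : ℝ)⁻¹ ^ n) ^ l := by
        rw [hrec, sq, ← mul_assoc]
        exact add_le_add (mul_le_mul_of_nonneg_right (hsmall n) (he n)) (ht n)
      calc ((4 : ℝ) ^ (n + 1)) ^ l * e (n + 1)
          ≤ ((4 : ℝ) ^ (n + 1)) ^ l * (8⁻¹ * 4⁻¹ ^ n * e n + D * ((4 : ℝ)⁻¹ ^ n) ^ l) := by gcongr
        _ = 4 ^ l * (8⁻¹ * 4⁻¹ ^ n * (((4 : ℝ) ^ n) ^ l * e n)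
            + D * (((4 : ℝ) ^ n) ^ l * ((4 : ℝ)⁻¹ ^ n) ^ l)) := by
              rw [pow_succ (4 : ℝ) n, mul_pow]; ring
        _ = _ := by rw [hinv, mul_one]) n
  calc e n = (((4 : ℝ) ^ n) ^ l * e n) * ((4 : ℝ)⁻¹ ^ n) ^ l := by
        rw [mul_right_comm, hinv, one_mul]
    _ ≤ _ := by gcongr

end Sequences

end NewtonSequences

section NewtonIteration

variable {d : ℕ}

/-- The truncation of a family of Fourier coefficients to frequencies at most `4 ^ n`. -/
noncomputable def trunc (c : (Fin d → ℤ) → CCover d) (n : ℕ) (k : Fin d → ℤ) : CCover d :=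
  if ‖intVec k‖ ≤ 4 ^ n then c k else 0

/-- The part of a family of Fourier coefficients at frequencies above `4 ^ n`. -/
noncomputable def tail (c : (Fin d → ℤ) → CCover d) (n : ℕ) (k : Fin d → ℤ) : ℝ :=
  if ‖intVec k‖ ≤ 4 ^ n then 0 else ‖c k‖

/-- The bound for the defects of the Newton iteration. -/
noncomputable def newtonErr (C : ℝ) (p : ℕ) (c : (Fin d → ℤ) → CCover d) : ℕ → ℝ
  | 0 => Real.exp (8 * Real.pi) * ∑' k, ‖c k‖
  | n + 1 => C * (4 ^ n) ^ p * newtonErr C p c n ^ 2 + Real.exp (8 * Real.pi) * ∑' k, tail c n k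

section Truncation

variable {c : (Fin d → ℤ) → CCover d}

lemma tail_nonneg (n : ℕ) (k : Fin d → ℤ) : 0 ≤ tail c n k := by
  unfold tail; split_ifs <;> positivity

lemma tail_le (n : ℕ) (k : Fin d → ℤ) : tail c n k ≤ ‖c k‖ := by
  unfold tail; split_ifs <;> simp

lemma summable_tail (hc : Summable fun k => ‖c k‖) (n : ℕ) : Summable (tail c n) :=
  Summable.of_nonneg_of_le (tail_nonneg n) (tail_le n) hc

lemma newtonErr_nonneg {C : ℝ} (hC : 0 ≤ C) (p n : ℕ) : 0 ≤ newtonErr C p c n := by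
  cases n with
  | zero => exact mul_nonneg (Real.exp_pos _).le (tsum_nonneg fun _ => norm_nonneg _)
  | succ n =>
    refine add_nonneg (by positivity) (mul_nonneg (Real.exp_pos _).le (tsum_nonneg fun k => ?_))
    exact tail_nonneg n k

lemma norm_trunc_le (n : ℕ) (k : Fin d → ℤ) : ‖trunc c n k‖ ≤ ‖c k‖ := by
  unfold trunc; split_ifs <;> simp

lemma holOn_trunc (hc : Summable fun k => ‖c k‖) (n : ℕ) {r : ℝ} (hr : 0 ≤ r) :
    HolOn (fourierSeries (trunc c n)) r := by
  refine holOn_fourierSeries fun m => Summable.of_nonneg_of_le (fun k => by positivity)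
    (fun k => ?_) (hc.mul_left ((4 ^ n) ^ m * Real.exp (2 * Real.pi * 4 ^ n * r)))
  unfold trunc
  split_ifs with h
  · gcongr
  · rw [norm_zero, mul_zero]
    positivity

lemma isReal_trunc (hc : Summable fun k => ‖c k‖)
    (hreal : ∀ k i, c (-k) i = starRingEnd ℂ (c k i)) (n : ℕ) :
    IsReal (fourierSeries (trunc c n)) := by
  refine isReal_fourierSeries (Summable.of_nonneg_of_le (fun k => norm_nonneg _)
    (norm_trunc_le n) hc) fun k i => ?_
  unfold trunc
  rw [intVec_neg, norm_neg]
  split_ifs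
  · exact hreal k i
  · simp

lemma exp_mul_le {n : ℕ} {k : Fin d → ℤ} (hk : ‖intVec k‖ ≤ 4 ^ n) :
    Real.exp (2 * Real.pi * ‖intVec k‖ * (4 * 4⁻¹ ^ n)) ≤ Real.exp (8 * Real.pi) := by
  rw [Real.exp_le_exp]
  have h1 : ‖intVec k‖ * (4 : ℝ)⁻¹ ^ n ≤ 4 ^ n * 4⁻¹ ^ n := by gcongr
  rw [← mul_pow, mul_inv_cancel₀ (by norm_num), one_pow] at h1
  nlinarith [Real.pi_pos]

lemma norm_trunc_series_le (hc : Summable fun k => ‖c k‖) (n : ℕ) {z : CCover d}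
    (hz : z ∈ strip d (4 * 4⁻¹ ^ n)) :
    ‖fourierSeries (trunc c n) z‖ ≤ Real.exp (8 * Real.pi) * ∑' k, ‖c k‖ := by
  rw [← tsum_mul_left]
  refine norm_fourierSeries_le (hc.mul_left _) (fun k => ?_) (le_of_lt hz)
  unfold trunc
  split_ifs with h
  · exact mul_le_mul_of_nonneg_right (exp_mul_le h) (norm_nonneg _)
  · rw [norm_zero, mul_zero]
    positivity

lemma summable_char_trunc (hc : Summable fun k => ‖c k‖) (n : ℕ) (z : CCover d) :
    Summable fun k => char k z • trunc c n k := by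
  refine Summable.of_norm_bounded
    (hc.mul_left (Real.exp (2 * Real.pi * 4 ^ n * ‖imPart z‖))) fun k => ?_
  rw [norm_smul]
  unfold trunc
  split_ifs with h
  · gcongr
    refine (norm_char_le k le_rfl).trans ?_
    gcongr
  · rw [norm_zero, mul_zero]
    positivity

lemma norm_trunc_sub_le (hc : Summable fun k => ‖c k‖) (n : ℕ) {z : CCover d}
    (hz : z ∈ strip d (4 * 4⁻¹ ^ (n + 1))) :
    ‖fourierSeries (trunc c n) z - fourierSeries (trunc c (n + 1)) z‖ ≤
      Real.exp (8 * Real.pi) * ∑' k, tail c n k := by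
  have hsub : fourierSeries (trunc c n) z - fourierSeries (trunc c (n + 1)) z
      = fourierSeries (fun k => trunc c n k - trunc c (n + 1) k) z := by
    simp only [fourierSeries, smul_sub]
    exact ((summable_char_trunc hc n z).tsum_sub (summable_char_trunc hc (n + 1) z)).symm
  rw [hsub, ← tsum_mul_left]
  refine norm_fourierSeries_le ((summable_tail hc n).mul_left _) (fun k => ?_) (le_of_lt hz)
  have h4 : (4 : ℝ) ^ n ≤ 4 ^ (n + 1) := pow_le_pow_right₀ (by norm_num) (by omega)
  unfold trunc tail
  by_cases h1 : ‖intVec k‖ ≤ 4 ^ n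
  · simp [h1, h1.trans h4]
  · by_cases h2 : ‖intVec k‖ ≤ 4 ^ (n + 1)
    · simp only [h1, h2, if_true, if_false, zero_sub, norm_neg]
      exact mul_le_mul_of_nonneg_right (exp_mul_le h2) (norm_nonneg _)
    · simp only [h1, h2, if_false, sub_zero, norm_zero, mul_zero]
      positivity

lemma norm_trunc_sub_real_le (hc : Summable fun k => ‖c k‖) {h : Cover d → CCover d}
    (hs : ∀ x, HasSum (fun k => char k (incl x) • c k) (h x)) (n : ℕ) (x : Cover d) :
    ‖fourierSeries (trunc c n) (incl x) - h x‖ ≤ ∑' k, tail c n k := by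
  have h1 := (summable_char_trunc hc n (incl x)).hasSum.sub (hs x)
  have h2 : fourierSeries (trunc c n) (incl x) - h x
      = ∑' k, (char k (incl x) • trunc c n k - char k (incl x) • c k) := h1.tsum_eq.symm
  rw [h2]
  refine tsum_of_norm_bounded (summable_tail hc n).hasSum fun k => ?_
  rw [← smul_sub, norm_smul, norm_char_incl, one_mul]
  unfold trunc tail
  split_ifs <;> simp

end Truncation

/-- The Newton iteration. -/
theorem exists_newton_iteration (d : ℕ) (γ τ : ℝ) (hγ : 0 < γ) :
    ∃ (C : ℝ) (p : ℕ), 1 ≤ C ∧ ∀ a : Cover d, IsDiophantine γ τ (Torus.proj a) →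
      ∀ c : (Fin d → ℤ) → CCover d, (Summable fun k => ‖c k‖) →
        (∀ k i, c (-k) i = starRingEnd ℂ (c k i)) →
        Real.exp (8 * Real.pi) * ∑' k, ‖c k‖ ≤ 1 →
        (∀ n, C * (4 ^ n) ^ p * newtonErr C p c n ≤ 8⁻¹ * 4⁻¹ ^ n) →
        ∃ (ξ : ℕ → CCover d → CCover d) (lam : ℕ → Cover d),
          (∀ n, HolOn (ξ n) (4⁻¹ ^ n / 2)) ∧ (∀ n, CPeriodic (ξ n)) ∧ (∀ n, IsReal (ξ n)) ∧
          (∀ n, ∀ z ∈ strip d (4⁻¹ ^ n / 2), ‖ξ n z‖ ≤ C * (4 ^ n) ^ p * newtonErr C p c n) ∧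
          (∀ n x y, ‖∑ i ∈ Finset.range n, ξ i (incl x) - ∑ i ∈ Finset.range n, ξ i (incl y)‖ ≤
            1 / 4 * ‖x - y‖) ∧
          ∀ n x, ‖defect a (fourierSeries (trunc c n)) (fun z => ∑ i ∈ Finset.range n, ξ i z)
            (lam n) (incl x)‖ ≤ newtonErr C p c n := by
  obtain ⟨C, p, hC, hstep⟩ := exists_newton_step d γ τ hγ
  refine ⟨C, p, hC, fun a ha c hc hreal hP1 hsmall => ?_⟩
  have hC0 : 0 ≤ C := by linarith
  set e := newtonErr C p c with he
  have e0 : ∀ n, 0 ≤ e n := newtonErr_nonneg hC0 p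
  have hr0 : ∀ n : ℕ, (0 : ℝ) < 4⁻¹ ^ n := fun n => by positivity
  have hr1 : ∀ n : ℕ, (4 : ℝ)⁻¹ ^ n ≤ 1 := fun n => pow_le_one₀ (by norm_num) (by norm_num)
  have hrinv : ∀ n : ℕ, ((4 : ℝ)⁻¹ ^ n)⁻¹ = 4 ^ n := fun n => by rw [inv_pow, inv_inv]
  let Inv : ℕ → (CCover d → CCover d) × Cover d → Prop := fun n s =>
    HolOn s.1 (4⁻¹ ^ n) ∧ CPeriodic s.1 ∧ IsReal s.1 ∧
      (∀ z ∈ strip d (4⁻¹ ^ n), ‖fderiv ℂ s.1 z‖ ≤ 1 / 6 * (1 - 4⁻¹ ^ n)) ∧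
      ∀ z ∈ strip d (4⁻¹ ^ n), ‖defect a (fourierSeries (trunc c n)) s.1 s.2 z‖ ≤ e n
  have quarter : ∀ n : ℕ, (1 / 6 : ℝ) * (1 - 4⁻¹ ^ n) ≤ 1 / 4 := fun n => by linarith [hr0 n]
  have next : ∀ n s, Inv n s → ∃ ξμ : (CCover d → CCover d) × Cover d,
      Inv (n + 1) (fun z => s.1 z + ξμ.1 z, s.2 + ξμ.2) ∧ HolOn ξμ.1 (4⁻¹ ^ n / 2) ∧
      CPeriodic ξμ.1 ∧ IsReal ξμ.1 ∧
      ∀ z ∈ strip d (4⁻¹ ^ n / 2), ‖ξμ.1 z‖ ≤ C * (4 ^ n) ^ p * e n := by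
    rintro n ⟨w, lam⟩ ⟨wH, wp, wr, wK, wE⟩
    simp only at wH wp wr wK wE
    have hsm : C * ((4 : ℝ)⁻¹ ^ n)⁻¹ ^ p * e n ≤ 4⁻¹ ^ n := by
      rw [hrinv]
      exact (hsmall n).trans (by linarith [hr0 n])
    obtain ⟨ξ, μ, ξH, ξp, ξr, ξM, ξD, hE⟩ := hstep a ha (4⁻¹ ^ n) (e n)
      (fourierSeries (trunc c n)) w lam (hr0 n) (hr1 n) (e0 n)
      (holOn_trunc hc n (by positivity)) (fourierSeries_periodic _) (isReal_trunc hc hreal n)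
      (fun z hz => (norm_trunc_series_le hc n hz).trans hP1) wH wp wr
      (fun z hz => (wK z hz).trans (quarter n)) wE hsm
    rw [hrinv] at ξM ξD hE
    have hq : (4 : ℝ)⁻¹ ^ n / 4 = 4⁻¹ ^ (n + 1) := by rw [pow_succ]; ring
    rw [hq] at ξD hE
    have hle : (4 : ℝ)⁻¹ ^ (n + 1) ≤ 4⁻¹ ^ n / 2 := by rw [← hq]; linarith [hr0 n]
    have hle' : (4 : ℝ)⁻¹ ^ (n + 1) ≤ 4⁻¹ ^ n := by rw [← hq]; linarith [hr0 n]
    have wH' : HolOn w (4⁻¹ ^ (n + 1)) := wH.mono hle'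
    have ξH' : HolOn ξ (4⁻¹ ^ (n + 1)) := ξH.mono hle
    have sumH : HolOn (fun z => w z + ξ z) (4⁻¹ ^ (n + 1)) := ContDiffOn.add wH' ξH'
    have sumr : IsReal fun z => w z + ξ z := fun x => by rw [map_add, wr, ξr, add_zero]
    have sumK : ∀ z ∈ strip d (4⁻¹ ^ (n + 1)),
        ‖fderiv ℂ (fun z => w z + ξ z) z‖ ≤ 1 / 6 * (1 - 4⁻¹ ^ (n + 1)) := fun z hz => by
      rw [fderiv_fun_add (wH'.differentiableAt hz) (ξH'.differentiableAt hz)]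
      refine (norm_add_le _ _).trans
        ((add_le_add (wK z (strip_mono hle' hz)) ((ξD z hz).trans (hsmall n))).trans ?_)
      rw [← hq]
      linarith
    refine ⟨(ξ, μ), ⟨sumH, ?_, sumr, sumK, ?_⟩, ξH, ξp, ξr, ξM⟩
    · intro z k
      simp only
      rw [wp, ξp]
    · intro z hz
      have h1 : defect a (fourierSeries (trunc c (n + 1))) (fun z => w z + ξ z) (lam + μ) z
          = defect a (fourierSeries (trunc c n)) (fun z => w z + ξ z) (lam + μ) z
            + (fourierSeries (trunc c n) (z + (w z + ξ z))
              - fourierSeries (trunc c (n + 1)) (z + (w z + ξ z))) := by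
        simp only [defect]
        abel
      simp only
      rw [h1]
      refine (norm_add_le _ _).trans (add_le_add (hE z hz) (norm_trunc_sub_le hc n ?_))
      exact strip_mono (by linarith [hr0 (n + 1)]) (add_mem_strip sumH sumr
        (fun z hz => (sumK z hz).trans (quarter _)) le_rfl hz)
  have init : Inv 0 (fun _ => 0, 0) := by
    refine ⟨contDiffOn_const, fun _ _ => rfl, fun _ => map_zero _, fun z _ => by simp, ?_⟩
    intro z hz
    have h1 := norm_trunc_series_le hc 0 (z := z) (strip_mono (by norm_num) hz)
    have h2 : e 0 = Real.exp (8 * Real.pi) * ∑' k, ‖c k‖ := by rw [he, newtonErr]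
    rw [h2]
    simpa [defect] using h1
  choose! f hf using next
  let S : ℕ → (CCover d → CCover d) × Cover d := fun n =>
    Nat.rec (fun _ => 0, 0) (fun n s => (fun z => s.1 z + (f n s).1 z, s.2 + (f n s).2)) n
  have hS : ∀ n, Inv n (S n) := fun n => by
    induction n with
    | zero => exact init
    | succ n ih => exact (hf n _ ih).1
  let ξ : ℕ → CCover d → CCover d := fun n => (f n (S n)).1
  have hsum : ∀ n z, (S n).1 z = ∑ i ∈ Finset.range n, ξ i z := fun n z => by
    induction n with
    | zero => rfl
    | succ n ih => rw [Finset.sum_range_succ, ← ih]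
  refine ⟨ξ, fun n => (S n).2, fun n => (hf n _ (hS n)).2.1, fun n => (hf n _ (hS n)).2.2.1,
    fun n => (hf n _ (hS n)).2.2.2.1, fun n => (hf n _ (hS n)).2.2.2.2, ?_, ?_⟩
  · intro n x y
    obtain ⟨wH, -, -, wK, -⟩ := hS n
    rw [← hsum, ← hsum]
    have := (convex_strip _).norm_image_sub_le_of_norm_fderiv_le (𝕜 := ℂ)
      (fun z hz => wH.differentiableAt hz) (fun z hz => (wK z hz).trans (quarter n))
      (incl_mem_strip (hr0 n) y) (incl_mem_strip (hr0 n) x)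
    rwa [← map_sub, norm_incl] at this
  · intro n x
    have h := (hS n).2.2.2.2 (incl x) (incl_mem_strip (hr0 n) x)
    have h2 : (S n).1 = fun z => ∑ i ∈ Finset.range n, ξ i z := funext (hsum n)
    rwa [h2] at h

end NewtonIteration

section TranslatedConjugacy

variable {d : ℕ}

lemma isPeriodic_iteratedFDeriv {F : Type*} [NormedAddCommGroup F] [NormedSpace ℝ F]
    {h : Cover d → F} (hp : IsPeriodic h) (m : ℕ) : IsPeriodic (iteratedFDeriv ℝ m h) := by
  intro x k
  rw [← iteratedFDeriv_comp_add_right]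
  exact congrArg (fun u => iteratedFDeriv ℝ m u x) (funext fun y => hp y k)

lemma exists_iteratedFDeriv_bound {F : Type*} [NormedAddCommGroup F] [NormedSpace ℝ F]
    {h : Cover d → F} (hp : IsPeriodic h) (hs : ContDiff ℝ ∞ h) (m : ℕ) :
    ∃ C, 0 ≤ C ∧ ∀ x, ‖iteratedFDeriv ℝ m h x‖ ≤ C :=
  (isPeriodic_iteratedFDeriv hp m).exists_bound
    (hs.continuous_iteratedFDeriv (by exact_mod_cast le_top))

lemma isPeriodic_incl {h : Cover d → Cover d} (hp : IsPeriodic h) :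
    IsPeriodic fun x => incl (h x) := fun x k => congrArg incl (hp x k)

lemma pow_mul_norm_coeff_incl_le {h : Cover d → Cover d} (hp : IsPeriodic h)
    (hs : ContDiff ℝ ∞ h) {m : ℕ} {C : ℝ} (hC : ∀ x, ‖iteratedFDeriv ℝ m h x‖ ≤ C)
    (k : Fin d → ℤ) : ‖intVec k‖ ^ m * ‖coeff (fun x => incl (h x)) k‖ ≤ C := by
  refine IsPeriodic.pow_mul_norm_coeff_le m (isPeriodic_incl hp) (incl.contDiff.comp hs)
    (fun x => ?_) k
  have := incl.norm_iteratedFDeriv_comp_left (x := x) (N := ∞) (n := m) hs.contDiffAt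
    (by exact_mod_cast le_top)
  exact this.trans ((mul_le_of_le_one_left (norm_nonneg _) opNorm_incl_le).trans (hC x))

lemma exists_coeff_decay {h : Cover d → Cover d} (hp : IsPeriodic h) (hs : ContDiff ℝ ∞ h)
    (m : ℕ) : ∃ K, 0 ≤ K ∧ ∀ k, ‖coeff (fun x => incl (h x)) k‖ * wt k ^ m ≤ K := by
  obtain ⟨C, hC0, hC⟩ := exists_iteratedFDeriv_bound hp hs m
  refine ⟨max C ‖coeff (fun x => incl (h x)) 0‖, hC0.trans (le_max_left _ _), fun k => ?_⟩
  rcases eq_or_ne k 0 with rfl | hk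
  · simp [wt, intVec_zero]
  · rw [wt_eq hk, mul_comm]
    exact (pow_mul_norm_coeff_incl_le hp hs hC k).trans (le_max_left _ _)

section Decay

variable {c : (Fin d → ℤ) → CCover d}

lemma norm_le_of_decay {K : ℝ} {l : ℕ} (h : ∀ k, ‖c k‖ * wt k ^ (l + d + 1) ≤ K)
    (k : Fin d → ℤ) : ‖c k‖ ≤ K * (wt k ^ (d + 1))⁻¹ := by
  have hw := wt_pos k
  rw [← div_eq_mul_inv, le_div_iff₀ (by positivity)]
  refine le_trans ?_ (h k)
  gcongr
  · exact one_le_wt k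
  · omega

lemma summable_of_decay {K : ℝ} {l : ℕ}
    (h : ∀ k, ‖c k‖ * wt k ^ (l + d + 1) ≤ K) : Summable fun k => ‖c k‖ :=
  Summable.of_nonneg_of_le (fun _ => norm_nonneg _) (norm_le_of_decay h)
    ((summable_wt d).mul_left K)

lemma tsum_le_of_decay {K : ℝ} {l : ℕ}
    (h : ∀ k, ‖c k‖ * wt k ^ (l + d + 1) ≤ K) :
    ∑' k, ‖c k‖ ≤ K * ∑' k : Fin d → ℤ, (wt k ^ (d + 1))⁻¹ := by
  rw [← tsum_mul_left]
  exact (summable_of_decay h).tsum_le_tsum (norm_le_of_decay h)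
    ((summable_wt d).mul_left K)

lemma tsum_tail_le_of_decay {K : ℝ} {l : ℕ} (hK : 0 ≤ K)
    (h : ∀ k, ‖c k‖ * wt k ^ (l + d + 1) ≤ K) (n : ℕ) :
    ∑' k, tail c n k ≤ K * ((4 : ℝ)⁻¹ ^ n) ^ l * ∑' k : Fin d → ℤ, (wt k ^ (d + 1))⁻¹ := by
  rw [← tsum_mul_left]
  refine (summable_tail (summable_of_decay h) n).tsum_le_tsum (fun k => ?_)
    ((summable_wt d).mul_left _)
  have hw := wt_pos k
  unfold tail
  split_ifs with hk
  · positivity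
  · have h1 : (4 : ℝ) ^ n ≤ wt k := (not_le.1 hk).le.trans (norm_le_wt k)
    have h2 : ‖c k‖ * (4 ^ n) ^ l * wt k ^ (d + 1) ≤ K := by
      refine le_trans ?_ (h k)
      rw [add_assoc l d 1, pow_add (wt k) l, mul_assoc]
      have h3 : ((4 : ℝ) ^ n) ^ l ≤ wt k ^ l := by gcongr
      exact mul_le_mul_of_nonneg_left (mul_le_mul_of_nonneg_right h3 (by positivity))
        (norm_nonneg _)
    rw [inv_pow, inv_pow, ← div_eq_mul_inv, ← div_eq_mul_inv, le_div_iff₀ (by positivity),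
      le_div_iff₀ (by positivity)]
    linarith

end Decay

set_option maxHeartbeats 800000 in
/-- The translated conjugacy theorem: a small periodic perturbation of a Diophantine translation
is, up to a translation, conjugate to it. -/
theorem exists_translated_conjugacy (d : ℕ) (γ τ : ℝ) (hγ : 0 < γ) :
    ∃ (K₀ : ℝ) (m₀ : ℕ) (G : ℕ → ℝ) (m : ℕ → ℕ), 0 < K₀ ∧ (∀ s, 0 ≤ G s) ∧
      ∀ a : Cover d, IsDiophantine γ τ (Torus.proj a) → ∀ h : Cover d → Cover d, IsPeriodic h →
        ContDiff ℝ ∞ h → (∀ k, ‖coeff (fun x => incl (h x)) k‖ * wt k ^ m₀ ≤ K₀) →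
        ∃ (w : Cover d → Cover d) (lam : Cover d), ContDiff ℝ ∞ w ∧ IsPeriodic w ∧
          (∀ x, ‖fderiv ℝ w x‖ ≤ 1 / 4) ∧ (∀ x, w (x + a) - w x = h (x + w x) - lam) ∧
          ∀ (s : ℕ) (K : ℝ), 0 ≤ K → (∀ k, ‖coeff (fun x => incl (h x)) k‖ * wt k ^ m s ≤ K) →
            ∀ x, ‖iteratedFDeriv ℝ s w x‖ ≤ G s * K := by
  obtain ⟨C, p, hC, hnewton⟩ := exists_newton_iteration d γ τ hγ
  have hC0 : 0 ≤ C := by linarith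
  choose Q hQ0 hQ using exists_newton_seq_decay
  set Z : ℝ := ∑' k : Fin d → ℤ, (wt k ^ (d + 1))⁻¹ with hZ
  have hZ0 : 0 ≤ Z := tsum_nonneg fun k => by have := wt_pos k; positivity
  set A : ℝ := Real.exp (8 * Real.pi) * Z with hA
  have hA0 : 0 ≤ A := by positivity
  set K₀ : ℝ := (1 + A + C * (2 * A * 4 ^ (p + 1)) * (8 * 4 ^ (p + 1)))⁻¹ with hK₀
  have hK₀0 : 0 < K₀ := by positivity
  have hden : (1 + A + C * (2 * A * 4 ^ (p + 1)) * (8 * 4 ^ (p + 1))) * K₀ = 1 :=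
    mul_inv_cancel₀ (by positivity)
  have hK₀A : A * K₀ ≤ 1 := by
    rw [← hden]
    gcongr
    have : 0 ≤ C * (2 * A * 4 ^ (p + 1)) * (8 * 4 ^ (p + 1)) := by positivity
    linarith
  have hK₀C : C * (2 * A * 4 ^ (p + 1)) * K₀ ≤ 8⁻¹ * 4⁻¹ ^ (p + 1) := by
    have h1 : C * (2 * A * 4 ^ (p + 1)) * K₀ * (8 * 4 ^ (p + 1)) ≤ 1 := by
      have : C * (2 * A * 4 ^ (p + 1)) * K₀ * (8 * 4 ^ (p + 1))
        = C * (2 * A * 4 ^ (p + 1)) * (8 * 4 ^ (p + 1)) * K₀ := by ring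
      rw [this, ← hden]
      gcongr
      linarith
    rw [inv_pow, ← mul_inv, ← one_div, le_div_iff₀ (by positivity)]
    exact h1
  refine ⟨K₀, p + 1 + d + 1, fun s => 2 ^ s ^ 2 * 2 ^ s * C * Q (s + p + 1) * A * (1 - 4⁻¹)⁻¹,
    fun s => s + p + 1 + d + 1, hK₀0, fun s => ?_, fun a ha h hp hs hdec => ?_⟩
  · have := hQ0 (s + p + 1)
    have : (0 : ℝ) ≤ (1 - 4⁻¹)⁻¹ := by norm_num
    positivity
  set c : (Fin d → ℤ) → CCover d := coeff fun x => incl (h x) with hc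
  have hip := isPeriodic_incl hp
  have hic : Continuous fun x => incl (h x) := incl.continuous.comp hs.continuous
  have hsum : Summable fun k => ‖c k‖ := summable_of_decay hdec
  have hreal : ∀ k i, c (-k) i = starRingEnd ℂ (c k i) :=
    coeff_neg_of_real hip hic fun x => imPart_incl _
  set e := newtonErr C p c with he
  set t : ℕ → ℝ := fun n => Real.exp (8 * Real.pi) * ∑' k, tail c n k with ht
  have e0 : ∀ n, 0 ≤ e n := newtonErr_nonneg hC0 p
  have hrec : ∀ n, e (n + 1) = C * (4 ^ n) ^ p * e n ^ 2 + t n := fun n => rfl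
  have hdecay : ∀ (l : ℕ) (K : ℝ), 0 ≤ K → (∀ k, ‖c k‖ * wt k ^ (l + d + 1) ≤ K) →
      e 0 ≤ A * K ∧ ∀ n, t n ≤ A * K * ((4 : ℝ)⁻¹ ^ n) ^ l := by
    intro l K hK hl
    have hexp : (0 : ℝ) ≤ Real.exp (8 * Real.pi) := (Real.exp_pos _).le
    constructor
    · have := mul_le_mul_of_nonneg_left (tsum_le_of_decay hl) hexp
      calc e 0 = Real.exp (8 * Real.pi) * ∑' k, ‖c k‖ := by rw [he, newtonErr]
        _ ≤ _ := this
        _ = _ := by rw [hA]; ring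
    · intro n
      refine (mul_le_mul_of_nonneg_left (tsum_tail_le_of_decay hK hl n) hexp).trans
        (le_of_eq ?_)
      rw [hA]; ring
  obtain ⟨he0, htn⟩ := hdecay (p + 1) K₀ hK₀0.le hdec
  have hsmall : ∀ n, C * (4 ^ n) ^ p * e n ≤ 8⁻¹ * 4⁻¹ ^ n :=
    newton_seq_small hC0 hA0 hK₀0.le e0 he0 htn hrec hK₀C
  have hP1 : Real.exp (8 * Real.pi) * ∑' k, ‖c k‖ ≤ 1 := by
    have : e 0 = Real.exp (8 * Real.pi) * ∑' k, ‖c k‖ := by rw [he, newtonErr]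
    rw [← this]
    exact he0.trans hK₀A
  obtain ⟨ξ, lam, ξH, ξp, ξr, ξM, ξL, hdef⟩ := hnewton a ha c hsum hreal hP1 hsmall
  have hrpos : ∀ n : ℕ, (0 : ℝ) < 4⁻¹ ^ n / 2 := fun n => by positivity
  let θ : ℕ → Cover d → Cover d := fun n x => rePart (ξ n (incl x))
  have hθ : ∀ n x, incl (θ n x) = ξ n (incl x) := fun n x => incl_rePart_of_imPart_eq_zero (ξr n x)
  have θs : ∀ n, ContDiff ℝ ∞ (θ n) := fun n =>
    rePart.contDiff.comp ((ξH n).contDiff_incl (hrpos n))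
  let v : ℕ → ℕ → ℝ := fun s n => 2 ^ s ^ 2 * ((4 : ℝ)⁻¹ ^ n / 2)⁻¹ ^ s * (C * (4 ^ n) ^ p * e n)
  have θv : ∀ s n x, ‖iteratedFDeriv ℝ s (θ n) x‖ ≤ v s n := fun s n x => by
    have h1 := (ξH n).norm_iteratedFDeriv_le s (hrpos n) (ξM n) x
    have h2 := rePart.norm_iteratedFDeriv_comp_left (x := x) (N := ∞) (n := s)
      ((ξH n).contDiff_incl (hrpos n)).contDiffAt (by exact_mod_cast le_top)
    exact h2.trans ((mul_le_of_le_one_left (norm_nonneg _) opNorm_rePart_le).trans h1)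
  have vbound : ∀ (s : ℕ) (K : ℝ), 0 ≤ K → (∀ k, ‖c k‖ * wt k ^ (s + p + 1 + d + 1) ≤ K) →
      ∀ n, v s n ≤ 2 ^ s ^ 2 * 2 ^ s * C * Q (s + p + 1) * A * K * 4⁻¹ ^ n := by
    intro s K hK hdec n
    obtain ⟨h1, h2⟩ := hdecay (s + p + 1) K hK hdec
    have h3 := hQ (s + p + 1) C (A * K) p e t (by positivity) e0 h1 h2 hrec hsmall n
    have hinv : ((4 : ℝ)⁻¹ ^ n / 2)⁻¹ = 2 * 4 ^ n := by
      rw [inv_div, inv_pow, div_inv_eq_mul]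
    have hone : (4 : ℝ) ^ n * 4⁻¹ ^ n = 1 := by rw [← mul_pow]; norm_num
    simp only [v]
    rw [hinv]
    calc _ ≤ 2 ^ s ^ 2 * (2 * 4 ^ n) ^ s *
          (C * (4 ^ n) ^ p * (Q (s + p + 1) * (A * K) * ((4 : ℝ)⁻¹ ^ n) ^ (s + p + 1))) := by gcongr
      _ = 2 ^ s ^ 2 * 2 ^ s * C * Q (s + p + 1) * A * K * 4⁻¹ ^ n *
          ((4 : ℝ) ^ n * 4⁻¹ ^ n) ^ (s + p) := by
            rw [mul_pow 2 ((4 : ℝ) ^ n), mul_pow ((4 : ℝ) ^ n), pow_succ ((4 : ℝ)⁻¹ ^ n) (s + p),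
              pow_add ((4 : ℝ) ^ n)]
            ring
      _ = _ := by rw [hone, one_pow, mul_one]
  have hgeom : HasSum (fun n : ℕ => (4 : ℝ)⁻¹ ^ n) (1 - 4⁻¹)⁻¹ :=
    hasSum_geometric_of_lt_one (by norm_num) (by norm_num)
  have v0 : ∀ s n, 0 ≤ v s n := fun s n => by have := e0 n; positivity
  have vsum : ∀ s, Summable (v s) := fun s => by
    obtain ⟨K, hK, hKd⟩ := exists_coeff_decay hp hs (s + p + 1 + d + 1)
    exact Summable.of_nonneg_of_le (v0 s) (vbound s K hK hKd) (hgeom.summable.mul_left _)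
  let w : Cover d → Cover d := fun x => ∑' n, θ n x
  have ws : ContDiff ℝ ∞ w := contDiff_tsum (N := ⊤) θs (fun s _ => vsum s) fun s n x _ => θv s n x
  have θsum : ∀ x, HasSum (fun n => θ n x) (w x) := fun x =>
    (Summable.of_norm_bounded (vsum 0) fun n => by simpa using θv 0 n x).hasSum
  have hpart : ∀ n x, incl (∑ i ∈ Finset.range n, θ i x) = ∑ i ∈ Finset.range n, ξ i (incl x) :=
    fun n x => by rw [map_sum]; exact Finset.sum_congr rfl fun i _ => hθ i x
  have hlim : ∀ x, Filter.Tendsto (fun n => ∑ i ∈ Finset.range n, θ i x) Filter.atTop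
      (nhds (w x)) := fun x => (θsum x).tendsto_sum_nat
  have wL : ∀ x y, ‖w x - w y‖ ≤ 1 / 4 * ‖x - y‖ := fun x y => by
    refine le_of_tendsto ((hlim x).sub (hlim y)).norm (Filter.Eventually.of_forall fun n => ?_)
    rw [← norm_incl, map_sub, hpart, hpart]
    exact ξL n x y
  have hge : Filter.Tendsto (fun n : ℕ => (4 : ℝ)⁻¹ ^ n) Filter.atTop (nhds 0) :=
    tendsto_pow_atTop_nhds_zero_of_lt_one (by norm_num) (by norm_num)
  have elim : Filter.Tendsto e Filter.atTop (nhds 0) := by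
    refine squeeze_zero e0 (fun n => ?_) hge
    have h1 : (1 : ℝ) ≤ C * (4 ^ n) ^ p := by
      have h2 : (1 : ℝ) ≤ (4 ^ n) ^ p := one_le_pow₀ (one_le_pow₀ (by norm_num))
      nlinarith
    have h3 : e n ≤ C * (4 ^ n) ^ p * e n := le_mul_of_one_le_left (e0 n) h1
    have h4 : (0 : ℝ) ≤ 4⁻¹ ^ n := by positivity
    linarith [hsmall n]
  have tlim : Filter.Tendsto t Filter.atTop (nhds 0) := by
    refine squeeze_zero (fun n => ?_) (fun n => ?_) ((Filter.tendsto_add_atTop_iff_nat 1).2 elim)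
    · exact mul_nonneg (Real.exp_pos _).le (tsum_nonneg fun k => tail_nonneg n k)
    · rw [hrec]
      have := e0 n
      have : 0 ≤ C * (4 ^ n) ^ p * e n ^ 2 := by positivity
      linarith
  have hser : ∀ x, HasSum (fun k => char k (incl x) • c k) (incl (h x)) :=
    hip.hasSum_coeff hic hsum
  have lamlim : ∀ x, Filter.Tendsto (fun n => incl (lam n)) Filter.atTop
      (nhds (incl (h (x + w x) - (w (x + a) - w x)))) := by
    intro x
    set y : ℕ → Cover d := fun n => x + ∑ i ∈ Finset.range n, θ i x with hy
    have hylim : Filter.Tendsto y Filter.atTop (nhds (x + w x)) := (hlim x).const_add x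
    have hPlim : Filter.Tendsto (fun n => fourierSeries (trunc c n) (incl (y n)) - incl (h (y n)))
        Filter.atTop (nhds 0) := by
      refine squeeze_zero_norm (fun n => ?_) tlim
      refine (norm_trunc_sub_real_le hsum hser n (y n)).trans ?_
      exact le_mul_of_one_le_left (tsum_nonneg fun k => tail_nonneg n k)
        (Real.one_le_exp (by positivity))
    have hDlim : Filter.Tendsto (fun n => defect a (fourierSeries (trunc c n))
        (fun z => ∑ i ∈ Finset.range n, ξ i z) (lam n) (incl x)) Filter.atTop (nhds 0) :=
      squeeze_zero_norm (fun n => hdef n x) elim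
    have hWlim : ∀ x, Filter.Tendsto (fun n => incl (∑ i ∈ Finset.range n, θ i x)) Filter.atTop
        (nhds (incl (w x))) := fun x => (incl.continuous.tendsto _).comp (hlim x)
    have hhlim : Filter.Tendsto (fun n => incl (h (y n))) Filter.atTop
        (nhds (incl (h (x + w x)))) := (hic.tendsto _).comp hylim
    have key := ((hDlim.add hPlim).add hhlim).sub ((hWlim (x + a)).sub (hWlim x))
    rw [add_zero, zero_add, ← map_sub, ← map_sub] at key
    refine key.congr fun n => ?_
    have hyn : incl x + ∑ i ∈ Finset.range n, ξ i (incl x) = incl (y n) := by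
      rw [hy, map_add, hpart]
    simp only [defect]
    rw [hyn, hpart, hpart, map_add incl x a]
    abel
  refine ⟨w, h (0 + w 0) - (w (0 + a) - w 0), ws, fun x k => ?_, fun x => ?_, fun x => ?_, ?_⟩
  · refine tsum_congr fun n => ?_
    simp only [θ]
    rw [map_add, ξp n]
  · have : LipschitzWith (1 / 4) w := LipschitzWith.of_dist_le_mul fun x y => by
      rw [dist_eq_norm, dist_eq_norm]
      simpa using wL x y
    simpa using norm_fderiv_le_of_lipschitz ℝ this (x₀ := x)
  · have h1 := incl_injective (tendsto_nhds_unique (lamlim 0) (lamlim x))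
    rw [h1]
    abel
  · intro s K hK hKd x
    have h1 : iteratedFDeriv ℝ s w x = ∑' n, iteratedFDeriv ℝ s (θ n) x :=
      iteratedFDeriv_tsum_apply (N := ⊤) θs (fun s _ => vsum s) (fun s n x _ => θv s n x)
        (by exact_mod_cast le_top) x
    rw [h1]
    have h2 : HasSum (fun n : ℕ => 2 ^ s ^ 2 * 2 ^ s * C * Q (s + p + 1) * A * K * (4 : ℝ)⁻¹ ^ n)
        (2 ^ s ^ 2 * 2 ^ s * C * Q (s + p + 1) * A * K * (1 - 4⁻¹)⁻¹) := hgeom.mul_left _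
    refine (tsum_of_norm_bounded h2 fun n =>
      (θv s n x).trans (vbound s K hK hKd n)).trans (le_of_eq ?_)
    ring

end TranslatedConjugacy

section Diffeomorphisms

variable {d : ℕ}

lemma lipschitz_of_norm_fderiv_le {u : Cover d → Cover d} {c : ℝ} (hu : ContDiff ℝ ∞ u)
    (hc : ∀ x, ‖fderiv ℝ u x‖ ≤ c) (x y : Cover d) : ‖u x - u y‖ ≤ c * ‖x - y‖ :=
  convex_univ.norm_image_sub_le_of_norm_fderiv_le (𝕜 := ℝ)
    (fun _ _ => hu.differentiable (by simp) _) (fun x _ => hc x) (mem_univ y) (mem_univ x)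

/-- A perturbation of the identity by a periodic contraction has an inverse of the same form. -/
lemma exists_inverse {u : Cover d → Cover d} (hu : ContDiff ℝ ∞ u) (hp : IsPeriodic u)
    (hK : ∀ x, ‖fderiv ℝ u x‖ ≤ 1 / 2) :
    ∃ v : Cover d → Cover d, ContDiff ℝ ∞ v ∧ IsPeriodic v ∧ (∀ x, v x = -u (x + v x)) ∧
      ∀ x, x + u x + v (x + u x) = x := by
  have happ : ApproximatesLinearOn (fun x => x + u x)
      ((ContinuousLinearEquiv.refl ℝ (Cover d) : Cover d ≃L[ℝ] Cover d) : Cover d →L[ℝ] Cover d)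
      univ (1 / 2) := by
    intro x _ y _
    have : x + u x - (y + u y) - (x - y) = u x - u y := by abel
    simpa [this] using lipschitz_of_norm_fderiv_le hu hK x y
  have hcond : Subsingleton (Cover d) ∨
      (1 / 2 : NNReal) < ‖((ContinuousLinearEquiv.refl ℝ (Cover d)).symm :
        Cover d →L[ℝ] Cover d)‖₊⁻¹ := by
    rcases subsingleton_or_nontrivial (Cover d) with h | h
    · exact Or.inl h
    · right
      have h1 : ‖((ContinuousLinearEquiv.refl ℝ (Cover d)).symm :
        Cover d →L[ℝ] Cover d)‖₊ = 1 := by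
        rw [← NNReal.coe_inj]
        exact ContinuousLinearMap.norm_id
      rw [h1, inv_one]
      exact NNReal.half_lt_self one_ne_zero
  let Ψ : Cover d ≃ₜ Cover d := happ.toHomeomorph _ hcond
  have hΨ : ∀ x, Ψ x = x + u x := fun _ => rfl
  have hunit : ∀ x, IsUnit (1 + fderiv ℝ u x) := fun x =>
    isUnit_one_add_of_norm_lt ((hK x).trans_lt (by norm_num))
  let D : Cover d → Cover d ≃L[ℝ] Cover d := fun x =>
    ContinuousLinearEquiv.unitsEquiv ℝ (Cover d) (hunit x).unit
  have hD : ∀ x, HasFDerivAt Ψ (D x : Cover d →L[ℝ] Cover d) x := by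
    intro x
    have h1 : HasFDerivAt (fun x => x + u x) (1 + fderiv ℝ u x) x :=
      (hasFDerivAt_id x).add (hu.differentiable (by simp) x).hasFDerivAt
    exact h1
  have hs : ContDiff ℝ ∞ Ψ.symm := Ψ.contDiff_symm hD (contDiff_id.add hu)
  have h1 : ∀ x, Ψ.symm x + u (Ψ.symm x) = x := fun x => by rw [← hΨ, Ψ.apply_symm_apply]
  refine ⟨fun x => Ψ.symm x - x, hs.sub contDiff_id, fun x k => ?_, fun x => ?_, fun x => ?_⟩
  · have : Ψ.symm (x + intVec k) = Ψ.symm x + intVec k := by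
      apply Ψ.injective
      rw [Ψ.apply_symm_apply, hΨ, hp, add_right_comm, h1]
    simp only [this]
    abel
  · simp only [add_sub_cancel]
    rw [sub_eq_iff_eq_add, neg_add_eq_sub, eq_sub_iff_add_eq, h1]
  · simp only [add_sub_cancel]
    rw [← hΨ, Ψ.symm_apply_apply]

/-- The self-map of the torus lifted by `x ↦ x + u x`. -/
noncomputable def torusMap (u : Cover d → Cover d) (x : Torus d) : Torus d :=
  Torus.proj (Torus.rep x + u (Torus.rep x))

lemma isLift_torusMap {u : Cover d → Cover d} (hu : Continuous u) (hp : IsPeriodic u) :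
    IsLift (fun x => x + u x) (torusMap u) := by
  refine ⟨continuous_id.add hu, fun x => ?_⟩
  unfold torusMap
  rw [proj_add, proj_add, Torus.proj_rep, hp.rep_proj]

lemma torusMap_leftInverse {u v : Cover d → Cover d} (hu : Continuous u) (pu : IsPeriodic u)
    (hv : Continuous v) (pv : IsPeriodic v) (h : ∀ x, x + u x + v (x + u x) = x) :
    Function.LeftInverse (torusMap v) (torusMap u) := by
  intro x
  obtain ⟨y, rfl⟩ := proj_surjective x
  rw [← (isLift_torusMap hu pu).2, ← (isLift_torusMap hv pv).2]
  simp only [h]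

lemma exists_torusDiffeo {u : Cover d → Cover d} (hu : ContDiff ℝ ∞ u) (hp : IsPeriodic u)
    (hK : ∀ x, ‖fderiv ℝ u x‖ ≤ 1 / 2) : ∃ φ : TorusDiffeo d, IsLift (fun x => x + u x) φ := by
  obtain ⟨v, hv, pv, h1, h2⟩ := exists_inverse hu hp hK
  have h3 : ∀ x, x + v x + u (x + v x) = x := fun x => by
    rw [add_assoc, eq_neg_iff_add_eq_zero.1 (h1 x), add_zero]
  refine ⟨⟨⟨torusMap u, torusMap v, torusMap_leftInverse hu.continuous hp hv.continuous pv h2,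
    torusMap_leftInverse hv.continuous pv hu.continuous hp h3⟩,
    ⟨_, contDiff_id.add hu, isLift_torusMap hu.continuous hp⟩,
    ⟨_, contDiff_id.add hv, isLift_torusMap hv.continuous pv⟩⟩,
    isLift_torusMap hu.continuous hp⟩

lemma isotopicToId_of_lift {u : Cover d → Cover d} (hu : ContDiff ℝ ∞ u) (hp : IsPeriodic u)
    (hK : ∀ x, ‖fderiv ℝ u x‖ ≤ 1 / 2) {φ : TorusDiffeo d} (hφ : IsLift (fun x => x + u x) φ) :
    IsotopicToId φ := by
  refine ⟨fun t x => x + t • u x, ?_, fun t ht => ?_, ?_, ?_⟩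
  · refine ContDiff.contDiffOn ?_
    exact contDiff_snd.add (contDiff_fst.smul (hu.comp contDiff_snd))
  · refine exists_torusDiffeo (u := fun x => t • u x) (hu.const_smul t) (fun x k => ?_)
      fun x => ?_
    · simp only
      rw [hp]
    · rw [fderiv_fun_const_smul (hu.differentiable (by simp) x), norm_smul, Real.norm_eq_abs,
        abs_of_nonneg ht.1]
      exact (mul_le_of_le_one_left (norm_nonneg _) ht.2).trans (hK x)
  · simpa using ⟨continuous_id, fun _ => rfl⟩
  · simpa using hφ

lemma norm_iteratedFDeriv_id_le (j : ℕ) (x : Cover d) :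
    ‖iteratedFDeriv ℝ (j + 1) (fun x : Cover d => x) x‖ ≤ 1 := by
  rw [← norm_iteratedFDeriv_fderiv]
  have : fderiv ℝ (fun x : Cover d => x) = fun _ => ContinuousLinearMap.id ℝ (Cover d) :=
    funext fun x => fderiv_fun_id
  rw [this]
  rcases j with _ | j
  · simpa using ContinuousLinearMap.norm_id_le
  · rw [iteratedFDeriv_const_of_ne (Nat.succ_ne_zero j)]
    simp

/-- The derivatives of the inverse of a near-identity map are controlled by those of the map. -/
lemma exists_inverse_bound (d s : ℕ) : ∃ C : ℝ, 1 ≤ C ∧ ∀ (w v : Cover d → Cover d) (θ : ℝ),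
    ContDiff ℝ ∞ w → ContDiff ℝ ∞ v → (∀ x, v x = -w (x + v x)) →
    (∀ x, ‖fderiv ℝ w x‖ ≤ 1 / 4) → 0 ≤ θ → θ ≤ 1 →
    (∀ i ≤ s, ∀ x, ‖iteratedFDeriv ℝ i w x‖ ≤ θ) →
    ∀ i ≤ s, ∀ x, ‖iteratedFDeriv ℝ i v x‖ ≤ C * θ := by
  induction s with
  | zero =>
    refine ⟨1, le_rfl, fun w v θ _ _ hv _ _ _ hθ i hi x => ?_⟩
    obtain rfl := Nat.le_zero.1 hi
    rw [norm_iteratedFDeriv_zero, hv, norm_neg, one_mul]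
    simpa using hθ 0 le_rfl (x + v x)
  | succ s ih =>
    obtain ⟨C, hC, ih⟩ := ih
    set D : ℝ := 1 + C with hD
    set C' : ℝ := C + 2 * (s.factorial * D ^ s * (1 + 2 ^ s * C)) with hC'
    have hC0 : 0 ≤ C := by linarith
    have hD1 : 1 ≤ D := by linarith
    have hpos : 0 ≤ s.factorial * D ^ s * (1 + 2 ^ s * C) := by positivity
    refine ⟨C', by linarith, fun w v θ ws vs hv hw4 hθ0 hθ1 hθ i hi x => ?_⟩
    have ihv := ih w v θ ws vs hv hw4 hθ0 hθ1 fun i hi => hθ i (by omega)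
    rcases Nat.lt_or_ge i (s + 1) with hlt | hge
    · refine (ihv i (by omega) x).trans ?_
      gcongr
      linarith
    obtain rfl : i = s + 1 := le_antisymm hi hge
    set L : Cover d → Cover d →L[ℝ] Cover d := fun x => fderiv ℝ w (x + v x) with hL
    have dw : ContDiff ℝ ∞ (fderiv ℝ w) := ws.fderiv_right (by simp)
    have dv : ContDiff ℝ ∞ (fderiv ℝ v) := vs.fderiv_right (by simp)
    have Φs : ContDiff ℝ ∞ fun x => x + v x := contDiff_id.add vs
    have Ls : ContDiff ℝ ∞ L := dw.comp Φs
    have hfd : fderiv ℝ v = fun x => -(L x + ContinuousLinearMap.compL ℝ (Cover d) (Cover d)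
        (Cover d) (L x) (fderiv ℝ v x)) := by
      funext x
      have h1 : HasFDerivAt (fun x => x + v x) (1 + fderiv ℝ v x) x :=
        (hasFDerivAt_id x).add (vs.differentiable (by simp) x).hasFDerivAt
      have h2 : HasFDerivAt (fun x => -w (x + v x)) (-(L x).comp (1 + fderiv ℝ v x)) x :=
        ((ws.differentiable (by simp) (x + v x)).hasFDerivAt.comp x h1).neg
      have h3 : v = fun x => -w (x + v x) := funext hv
      conv_lhs => rw [h3]
      rw [h2.fderiv]
      ext y
      simp
    have hΦ : ∀ j, 1 ≤ j → j ≤ s → ∀ x, ‖iteratedFDeriv ℝ j (fun x => x + v x) x‖ ≤ D ^ j := by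
      intro j hj hjs x
      have h1 : iteratedFDeriv ℝ j (fun x => x + v x) x
          = iteratedFDeriv ℝ j (fun x => x) x + iteratedFDeriv ℝ j v x :=
        fun_iteratedFDeriv_add_apply (contDiff_id.of_le (by exact_mod_cast le_top)).contDiffAt
          (vs.of_le (by exact_mod_cast le_top)).contDiffAt
      rw [h1]
      obtain ⟨m, rfl⟩ : ∃ m, j = m + 1 := ⟨j - 1, by omega⟩
      have h2 : C * θ ≤ C := mul_le_of_le_one_right hC0 hθ1
      calc _ ≤ 1 + C := (norm_add_le _ _).trans
            (add_le_add (norm_iteratedFDeriv_id_le m x) ((ihv _ hjs x).trans h2))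
        _ ≤ D ^ (m + 1) := le_self_pow₀ hD1 (by omega)
    have hLb : ∀ i ≤ s, ∀ x, ‖iteratedFDeriv ℝ i L x‖ ≤ s.factorial * D ^ s * θ := by
      intro i hi x
      have h1 := norm_iteratedFDeriv_comp_le (g := fderiv ℝ w) (f := fun x => x + v x) (n := i)
        (N := ∞) dw Φs (by exact_mod_cast le_top) x (C := θ) (D := D)
        (fun j hj => by rw [norm_iteratedFDeriv_fderiv]; exact hθ _ (by omega) _)
        (fun j hj hji => hΦ j hj (hji.trans hi) x)
      refine h1.trans ?_
      have h2 : (i.factorial : ℝ) ≤ s.factorial := by exact_mod_cast Nat.factorial_le hi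
      have h3 : D ^ i ≤ D ^ s := pow_le_pow_right₀ hD1 hi
      calc (i.factorial : ℝ) * θ * D ^ i ≤ s.factorial * θ * D ^ s := by gcongr
        _ = _ := by ring
    set B := ContinuousLinearMap.compL ℝ (Cover d) (Cover d) (Cover d) with hB
    have hBs : ContDiff ℝ ∞ fun x => B (L x) (fderiv ℝ v x) :=
      Ls.clm_comp dv
    have hbil := B.norm_iteratedFDeriv_le_of_bilinear_of_le_one Ls dv x (n := s)
      (by exact_mod_cast le_top) (ContinuousLinearMap.norm_compL_le _ _ _ _)
    set M : ℝ := s.factorial * D ^ s * θ with hM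
    have hM0 : 0 ≤ M := by positivity
    set X : ℝ := ‖iteratedFDeriv ℝ (s + 1) v x‖ with hX
    have hsum : ∑ i ∈ Finset.range (s + 1), (s.choose i : ℝ) * ‖iteratedFDeriv ℝ i L x‖ *
        ‖iteratedFDeriv ℝ (s - i) (fderiv ℝ v) x‖ ≤ 2 ^ s * (M * C) + 1 / 4 * X := by
      rw [Finset.sum_range_succ']
      refine add_le_add ?_ ?_
      · calc _ ≤ ∑ i ∈ Finset.range s, (s.choose (i + 1) : ℝ) * (M * C) := by
              refine Finset.sum_le_sum fun i hi => ?_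
              have his := Finset.mem_range.1 hi
              rw [mul_assoc]
              refine mul_le_mul_of_nonneg_left ?_ (by positivity)
              refine mul_le_mul (hLb _ (by omega) x) ?_ (norm_nonneg _) hM0
              rw [norm_iteratedFDeriv_fderiv]
              exact (ihv _ (by omega) x).trans (mul_le_of_le_one_right hC0 hθ1)
          _ ≤ (∑ i ∈ Finset.range (s + 1), (s.choose i : ℝ)) * (M * C) := by
              rw [← Finset.sum_mul, Finset.sum_range_succ' _ s]
              gcongr
              simp
          _ = 2 ^ s * (M * C) := by
              congr 1
              exact_mod_cast Nat.sum_range_choose s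
      · rw [norm_iteratedFDeriv_fderiv, norm_iteratedFDeriv_zero]
        simp only [Nat.choose_zero_right, Nat.cast_one, one_mul, Nat.sub_zero]
        exact mul_le_mul_of_nonneg_right (hw4 _) (norm_nonneg _)
    have hXle : X ≤ M + (2 ^ s * (M * C) + 1 / 4 * X) := by
      conv_lhs => rw [hX, ← norm_iteratedFDeriv_fderiv, hfd]
      have h1 : iteratedFDeriv ℝ s (fun x => -(L x + B (L x) (fderiv ℝ v x))) x
          = -(iteratedFDeriv ℝ s L x + iteratedFDeriv ℝ s (fun x => B (L x) (fderiv ℝ v x)) x) := by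
        rw [← fun_iteratedFDeriv_add_apply (Ls.of_le (by exact_mod_cast le_top)).contDiffAt
          (hBs.of_le (by exact_mod_cast le_top)).contDiffAt]
        exact iteratedFDeriv_neg_apply
      rw [h1, norm_neg]
      exact (norm_add_le _ _).trans (add_le_add (hLb s le_rfl x) (hbil.trans hsum))
    have hfin : C' * θ = C * θ + 2 * (M * (1 + 2 ^ s * C)) := by rw [hC', hM]; ring
    rw [hfin]
    have h0 : 0 ≤ C * θ := by positivity
    have h1 : M * (1 + 2 ^ s * C) = M + 2 ^ s * (M * C) := by ring
    have h2 : 0 ≤ 2 ^ s * (M * C) := by positivity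
    rw [h1]
    generalize 2 ^ s * (M * C) = Y at hXle h2 ⊢
    linarith

end Diffeomorphisms

section RotationSet

variable {d : ℕ}

lemma intVec_eq_zero_of_norm_lt {k : Fin d → ℤ} (h : ‖intVec k‖ < 1) : k = 0 := by
  by_contra hk
  exact absurd (one_le_norm_intVec hk) (not_le.2 h)

/-- Two lifts of the same map differ by an integer translation. -/
lemma exists_intVec_of_isLift {f : Torus d → Torus d} {F G : Cover d → Cover d} (hF : IsLift F f)
    (hG : IsLift G f) : ∃ k, ∀ x, F x = G x + intVec k := by
  have h1 : ∀ x, ∃ k, F x = G x + intVec k := fun x =>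
    proj_eq_iff.1 ((hG.2 x).trans (hF.2 x).symm)
  choose k hk using h1
  have hc : Continuous fun x => F x - G x := hF.1.sub hG.1
  have hval : ∀ x, F x - G x = intVec (k x) := fun x => by rw [hk x, add_sub_cancel_left]
  have hloc : IsLocallyConstant k := by
    rw [IsLocallyConstant.iff_eventually_eq]
    intro x
    filter_upwards [Metric.continuousAt_iff'.1 (hc.continuousAt (x := x)) 1 one_pos] with y hy
    rw [hval, hval, dist_eq_norm, ← intVec_sub] at hy
    exact sub_eq_zero.1 (intVec_eq_zero_of_norm_lt hy)
  exact ⟨k 0, fun x => by rw [← hloc.apply_eq_of_preconnectedSpace x 0]; exact hk x⟩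

lemma isLift_rotation {a : Cover d} : IsLift (fun x => x + a) (Torus.rotation (Torus.proj a)) :=
  ⟨by fun_prop, fun x => proj_add x a⟩

/-- A bound on the distance to a rotation, in terms of a given displacement. -/
lemma exists_displacement_bound {f : Torus d → Torus d} {a : Cover d} {h : Cover d → Cover d}
    (hs : ContDiff ℝ ∞ h) (hf : IsLift (fun x => x + a + h x) f) {s : ℕ} {C : ℝ} (hC : 0 ≤ C)
    (hd : torusDist s f (Torus.rotation (Torus.proj a)) < ENNReal.ofReal C) :
    ∃ k, ∀ σ ≤ s, ∀ x, ‖iteratedFDeriv ℝ σ (fun x => h x + intVec k) x‖ ≤ C := by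
  unfold torusDist at hd
  simp only [iInf_lt_iff] at hd
  obtain ⟨F, hF, G, hG, hlt⟩ := hd
  obtain ⟨k, hk⟩ := exists_intVec_of_isLift hF hf
  obtain ⟨l, hl⟩ := exists_intVec_of_isLift hG isLift_rotation
  refine ⟨k - l, fun σ hσ x => ?_⟩
  have h1 : ‖iteratedFDeriv ℝ σ F x - iteratedFDeriv ℝ σ G x‖ₑ ≤ ENNReal.ofReal C := by
    refine le_trans ?_ hlt.le
    exact le_iSup_of_le σ (le_iSup_of_le hσ (le_iSup_of_le x le_rfl))
  have hFs : ContDiff ℝ ∞ F := by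
    rw [funext hk]
    exact ((contDiff_id.add contDiff_const).add hs).add contDiff_const
  have hGs : ContDiff ℝ ∞ G := by
    rw [funext hl]
    exact (contDiff_id.add contDiff_const).add contDiff_const
  have h2 : (fun x => h x + intVec (k - l)) = fun x => F x - G x := by
    funext y
    rw [hk, hl, intVec_sub]
    abel
  rw [h2, fun_iteratedFDeriv_sub_apply (hFs.of_le (by exact_mod_cast le_top)).contDiffAt
    (hGs.of_le (by exact_mod_cast le_top)).contDiffAt]
  rwa [← ofReal_norm, ENNReal.ofReal_le_ofReal_iff hC] at h1

lemma iteratedFDeriv_add_intVec {h : Cover d → Cover d} (k : Fin d → ℤ) (σ : ℕ) (x : Cover d) :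
    ‖iteratedFDeriv ℝ (σ + 1) (fun x => h x + intVec k) x‖ = ‖iteratedFDeriv ℝ (σ + 1) h x‖ := by
  rw [← norm_iteratedFDeriv_fderiv, ← norm_iteratedFDeriv_fderiv]
  have : fderiv ℝ (fun x => h x + intVec k) = fderiv ℝ h := funext fun x => fderiv_add_const _
  rw [this]

/-- A diffeomorphism close to a rotation has a small smooth periodic displacement. -/
lemma exists_displacement {f : Torus d → Torus d} (hf : IsSmoothTorusMap f) {α : Torus d} {C : ℝ}
    (hC : 0 ≤ C) (hC' : C ≤ 1 / 4) (hd : torusDist 0 f (Torus.rotation α) < ENNReal.ofReal C) :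
    ∃ (a : Cover d) (h : Cover d → Cover d), Torus.proj a = α ∧ ContDiff ℝ ∞ h ∧ IsPeriodic h ∧
      IsLift (fun x => x + a + h x) f ∧ ∀ x, ‖h x‖ ≤ C := by
  obtain ⟨F, hFs, hF⟩ := hf
  set a := Torus.rep α with ha
  have hα : Torus.proj a = α := Torus.proj_rep α
  rw [← hα] at hd
  have hs : ContDiff ℝ ∞ fun x => F x - (x + a) := hFs.sub (contDiff_id.add contDiff_const)
  have hl : IsLift (fun x => x + a + (F x - (x + a))) f := by simpa using hF
  obtain ⟨k, hk⟩ := exists_displacement_bound hs hl hC hd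
  have hb : ∀ x, ‖F x - (x + a) + intVec k‖ ≤ C := fun x => by simpa using hk 0 le_rfl x
  refine ⟨a, fun x => F x - (x + a) + intVec k, hα, hs.add contDiff_const, ?_, ?_, hb⟩
  · intro x l
    have h1 : Torus.proj (F (x + intVec l)) = Torus.proj (F x) := by
      rw [hF.2, hF.2, proj_add_intVec]
    obtain ⟨j, hj⟩ := proj_eq_iff.1 h1
    have h2 : F x - (x + a) + intVec k - (F (x + intVec l) - (x + intVec l + a) + intVec k)
        = intVec (j + l) := by
      rw [hj, intVec_add]
      abel
    have h3 : ‖intVec (j + l)‖ < 1 := by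
      rw [← h2]
      exact (norm_sub_le _ _).trans_lt (by linarith [hb x, hb (x + intVec l)])
    rw [intVec_eq_zero_of_norm_lt h3, intVec_zero, sub_eq_zero] at h2
    exact h2.symm
  · refine ⟨by have := hF.1; fun_prop, fun x => ?_⟩
    have : x + a + (F x - (x + a) + intVec k) = F x + intVec k := by abel
    change Torus.proj (x + a + (F x - (x + a) + intVec k)) = _
    rw [this, proj_add_intVec, hF.2]

/-- Interpolation, on the side of the Fourier coefficients. -/
lemma coeff_interpolation {h : Cover d → Cover d} (hp : IsPeriodic h) (hs : ContDiff ℝ ∞ h)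
    {ρ : ℝ} {m : ℕ} (hρ : 0 ≤ ρ) (hρ1 : ρ ≤ 1) (h0 : ∀ x, ‖h x‖ ≤ ρ ^ 2)
    (hm : ∀ σ < 2 * m, ∀ x, ‖iteratedFDeriv ℝ (σ + 1) h x‖ ≤ 1) (k : Fin d → ℤ) :
    ‖coeff (fun x => incl (h x)) k‖ * wt k ^ m ≤ ρ := by
  set b := ‖coeff (fun x => incl (h x)) k‖ with hb
  have hb0 : 0 ≤ b := norm_nonneg _
  have hρ2 : ρ ^ 2 ≤ 1 := pow_le_one₀ hρ hρ1
  have hbρ : b ≤ ρ ^ 2 := norm_coeff_le (fun x => by rw [norm_incl]; exact h0 x) k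
  have hm' : ∀ x, ‖iteratedFDeriv ℝ (2 * m) h x‖ ≤ 1 := by
    intro x
    rcases Nat.eq_zero_or_pos (2 * m) with h2 | h2
    · rw [h2, norm_iteratedFDeriv_zero]
      exact (h0 x).trans hρ2
    · have := hm (2 * m - 1) (by omega) x
      rwa [Nat.sub_add_cancel h2] at this
  have hw : b * wt k ^ (2 * m) ≤ 1 := by
    rcases eq_or_ne k 0 with rfl | hk
    · simpa [wt, intVec_zero] using hbρ.trans hρ2
    · rw [wt_eq hk, mul_comm]
      exact pow_mul_norm_coeff_incl_le hp hs hm' k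
  have hw0 := wt_pos k
  refine le_of_sq_le_sq ?_ hρ
  calc (b * wt k ^ m) ^ 2 = b * (b * wt k ^ (2 * m)) := by ring
    _ ≤ b * 1 := by gcongr
    _ ≤ ρ ^ 2 := by rw [mul_one]; exact hbρ

/-- The translation vanishes when the measure rotation set contains the rotation vector, and the
map is then conjugate to the rotation. -/
lemma conjugacy_of_translated {f : Torus d → Torus d} {a lam : Cover d}
    {h w v : Cover d → Cover d} (hc : Continuous h) (hp : IsPeriodic h)
    (hf : IsLift (fun x => x + a + h x) f) (h4 : ∀ x, ‖h x‖ ≤ 1 / 4)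
    (hw : ∀ x, w (x + a) - w x = h (x + w x) - lam) (vc : Continuous v) (vp : IsPeriodic v)
    (hv : ∀ x, v x = -w (x + v x)) (hv' : ∀ x, x + w x + v (x + w x) = x)
    (vL : ∀ x y, ‖v x - v y‖ ≤ 1 / 2 * ‖x - y‖)
    (hα : Torus.proj a ∈ measRotationSet f) (x : Cover d) :
    x + a + h x + v (x + a + h x) = x + v x + a := by
  set F : Cover d → Cover d := fun x => x + a + h x with hF
  have hFper : ∀ x k, F (x + intVec k) = F x + intVec k := fun x k => by
    simp only [hF]
    rw [hp]
    abel
  have hcb : ∀ x, ‖h x - v x + v (F x) - lam‖ ≤ 1 / 2 * ‖lam‖ := by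
    intro x
    set z := x + v x with hz
    have h1 : z + w z = x := by
      rw [hz, add_assoc, eq_neg_iff_add_eq_zero.1 (hv x), add_zero]
    set y := z + a with hy
    have h2 : h x = w y - w z + lam := by
      have := hw z
      rw [h1] at this
      rw [hy, this]
      abel
    have h3 : F x = y + w y + lam := by
      simp only [hF]
      rw [h2]
      conv_lhs => rw [← h1]
      rw [hy]
      abel
    have h5 : v (y + w y) = -w y := by
      have := hv' y
      rw [add_assoc, add_eq_left] at this
      exact eq_neg_of_add_eq_zero_right this
    have h6 : h x - v x + v (F x) - lam = v (F x) - v (y + w y) := by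
      have h7 : v x = -w z := hv x
      rw [h5, h2, h7]
      abel
    rw [h6]
    refine (vL _ _).trans (le_of_eq ?_)
    rw [h3, add_sub_cancel_left]
  obtain ⟨ν, hν, hνf, G, hG, hGα⟩ := hα
  obtain ⟨k, hk⟩ := exists_intVec_of_isLift hG hf
  have vFp : IsPeriodic fun x => v (F x) := fun x k => by
    simp only
    rw [hFper, vp]
  have hFc : Continuous F := hf.1
  have int : ∀ {u : Cover d → Cover d}, IsPeriodic u → Continuous u →
      Integrable (fun x => u (Torus.rep x)) ν := fun hu cu =>
    (hu.continuous_rep cu).integrable_of_hasCompactSupport (HasCompactSupport.of_compactSpace _)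
  have ih := int hp hc
  have iv := int vp vc
  have ivF := int vFp (vc.comp hFc)
  have hh0 : ∫ x, h (Torus.rep x) ∂ν = 0 := by
    have h1 : meanDisplacement ν G = a + intVec k + ∫ x, h (Torus.rep x) ∂ν := by
      have h2 : ∀ x : Torus d, G (Torus.rep x) - Torus.rep x
          = (a + intVec k) + h (Torus.rep x) := fun x => by
        rw [hk]
        simp only [hF]
        abel
      unfold meanDisplacement
      simp only [h2]
      rw [integral_add (integrable_const _) ih]
      simp
    rw [h1] at hGα
    obtain ⟨l, hl⟩ := proj_eq_iff.1 hGα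
    have h3 : ∫ x, h (Torus.rep x) ∂ν = intVec (l - k) := by
      rw [intVec_sub]
      rw [add_assoc] at hl
      rw [eq_sub_iff_add_eq, add_comm]
      exact add_left_cancel hl
    have h5 : ‖∫ x, h (Torus.rep x) ∂ν‖ ≤ 1 / 4 := by
      have := norm_integral_le_of_norm_le_const (μ := ν)
        (Filter.Eventually.of_forall fun x => h4 (Torus.rep x))
      simpa using this
    rw [h3] at h5 ⊢
    rw [intVec_eq_zero_of_norm_lt (h5.trans_lt (by norm_num)), intVec_zero]
  have hinv : ∫ x, v (F (Torus.rep x)) ∂ν = ∫ x, v (Torus.rep x) ∂ν := by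
    have h1 : ∀ x : Torus d, v (F (Torus.rep x)) = v (Torus.rep (f x)) := fun x => by
      refine vp.eq_of_proj_eq ?_
      rw [Torus.proj_rep, hf.2, Torus.proj_rep]
    have h2 := integral_map (μ := ν) (f := fun x => v (Torus.rep x)) hνf.measurable.aemeasurable
      (vp.continuous_rep vc).aestronglyMeasurable
    rw [hνf.map_eq] at h2
    simp only [h1, h2]
  have hlam : lam = 0 := by
    have h1 : ∫ x, (h (Torus.rep x) - v (Torus.rep x) + v (F (Torus.rep x)) - lam) ∂ν = -lam := by
      have e1 := integral_sub ((ih.sub iv).add ivF) (integrable_const (μ := ν) lam)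
      have e2 := integral_add (ih.sub iv) ivF
      have e3 := integral_sub ih iv
      simp only [Pi.add_apply, Pi.sub_apply] at e1 e2
      rw [e1, e2, e3, hh0, hinv]
      simp
    have h2 := norm_integral_le_of_norm_le_const (μ := ν)
      (Filter.Eventually.of_forall fun x => hcb (Torus.rep x))
    rw [h1] at h2
    simp only [norm_neg, probReal_univ, mul_one] at h2
    exact norm_le_zero_iff.1 (by linarith)
  have hx := hcb x
  rw [hlam, norm_zero, mul_zero, sub_zero, norm_le_zero_iff] at hx
  have h1 : v (F x) = v x - h x := by
    rw [← sub_eq_zero]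
    rw [← hx]
    abel
  change F x + v (F x) = _
  rw [h1]
  simp only [hF]
  abel

lemma torusDist_le_of_lift {u : Cover d → Cover d} (hu : ContDiff ℝ ∞ u) {φ : Torus d → Torus d}
    (hφ : IsLift (fun x => x + u x) φ) {s : ℕ} {C : ℝ} (hC : 0 ≤ C)
    (h : ∀ σ ≤ s, ∀ x, ‖iteratedFDeriv ℝ σ u x‖ ≤ C) :
    torusDist s φ id ≤ ENNReal.ofReal C := by
  unfold torusDist
  refine iInf_le_of_le (fun x => x + u x) (iInf_le_of_le hφ (iInf_le_of_le (fun x => x)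
    (iInf_le_of_le ⟨continuous_id, fun _ => rfl⟩ ?_)))
  refine iSup_le fun σ => iSup_le fun hσ => iSup_le fun x => ?_
  have h1 : iteratedFDeriv ℝ σ (fun x => x + u x) x
      = iteratedFDeriv ℝ σ (fun x => x) x + iteratedFDeriv ℝ σ u x :=
    fun_iteratedFDeriv_add_apply (contDiff_id.of_le (by exact_mod_cast le_top)).contDiffAt
      (hu.of_le (by exact_mod_cast le_top)).contDiffAt
  rw [h1, add_sub_cancel_left, ← ofReal_norm, ENNReal.ofReal_le_ofReal_iff hC]
  exact h σ hσ x

lemma lipschitz_inverse {w v : Cover d → Cover d} (hw : ContDiff ℝ ∞ w)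
    (hw4 : ∀ x, ‖fderiv ℝ w x‖ ≤ 1 / 4) (hv : ∀ x, v x = -w (x + v x)) (x y : Cover d) :
    ‖v x - v y‖ ≤ 1 / 2 * ‖x - y‖ := by
  have h1 : ‖v x - v y‖ ≤ 1 / 4 * ‖x + v x - (y + v y)‖ := by
    conv_lhs => rw [hv x, hv y, neg_sub_neg, norm_sub_rev]
    exact lipschitz_of_norm_fderiv_le hw hw4 _ _
  have h2 : x + v x - (y + v y) = (x - y) + (v x - v y) := by abel
  rw [h2] at h1
  have := norm_add_le (x - y) (v x - v y)
  linarith [norm_nonneg (x - y)]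

end RotationSet

end TorusKAM

open TorusKAM in
/-- Near a Diophantine rotation `R_α` of type `(γ, τ)`, a diffeomorphism whose measure rotation set
contains `α` is smoothly conjugate to `R_α`. The last clause says that the conjugation is close to
the identity: it is as `C^s`-close to it as one likes once `f` is close enough to `R_α`, uniformly
in `α` and `f`. -/
theorem theorem1 (d : ℕ) (hd : 1 ≤ d) (γ τ : ℝ) (hγ : 0 < γ) (hτ : (d : ℝ) < τ) :
    ∃ (ε : ℝ) (s₀ : ℕ) (δ : ℕ → ℝ → ℝ) (s₁ : ℕ → ℝ → ℕ),
      0 < ε ∧ 0 < s₀ ∧ (∀ (s : ℕ) (η : ℝ), 0 < η → 0 < δ s η) ∧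
      ∀ (α : Torus d) (f : TorusDiffeo d),
        IsotopicToId f →
        IsDiophantine γ τ α →
        torusDist 0 f (Torus.rotation α) < ENNReal.ofReal ε →
        torusDist s₀ f (Torus.rotation α) < 1 →
        α ∈ measRotationSet f →
        ∃ φ : TorusDiffeo d,
          IsotopicToId φ ∧
          (∀ x, φ (f x) = Torus.rotation α (φ x)) ∧
          ∀ (s : ℕ) (η : ℝ), 0 < η →
            torusDist 0 f (Torus.rotation α) < ENNReal.ofReal (δ s η) →
            torusDist (s₁ s η) f (Torus.rotation α) < 1 →
            torusDist s φ id < ENNReal.ofReal η := by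
  obtain ⟨K₀, m₀, G, m, hK₀, hG, hkam⟩ := exists_translated_conjugacy d γ τ hγ
  choose Q hQ1 hQ using exists_inverse_bound d
  set ρ₀ : ℝ := min (1 / 2) K₀ with hρ₀
  have hρ₀0 : 0 < ρ₀ := lt_min (by norm_num) hK₀
  set Γ : ℕ → ℝ := fun s => ∑ i ∈ Finset.range (s + 1), G i with hΓ
  have hΓ0 : ∀ s, 0 ≤ Γ s := fun s => Finset.sum_nonneg fun i _ => hG i
  set M : ℕ → ℕ := fun s => ∑ i ∈ Finset.range (s + 1), m i with hM
  set ρ : ℕ → ℝ → ℝ := fun s η =>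
    min (1 / 2) (min (1 / (Γ s + 1)) (η / (2 * Q s * (Γ s + 1)))) with hρ
  have hΓ1 : ∀ s, 0 < Γ s + 1 := fun s => by linarith [hΓ0 s]
  have hQ0 : ∀ s, 0 < Q s := fun s => by linarith [hQ1 s]
  have hρ0 : ∀ s η, 0 < η → 0 < ρ s η := fun s η hη => by
    have h1 := hΓ1 s
    have h2 := hQ0 s
    exact lt_min (by norm_num) (lt_min (by positivity) (by positivity))
  refine ⟨ρ₀ ^ 2, 2 * m₀ + 1, fun s η => ρ s η ^ 2, fun s _ => 2 * M s, by positivity,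
    Nat.succ_pos _, fun s η hη => pow_pos (hρ0 s η hη) 2, ?_⟩
  intro α f _ hDio h0 h1 hrot
  have hsq : ∀ r : ℝ, 0 ≤ r → r ≤ 1 / 2 → r ^ 2 ≤ 1 / 4 := fun r hr hr2 => by nlinarith
  have hρ₀4 : ρ₀ ^ 2 ≤ 1 / 4 := hsq _ hρ₀0.le (min_le_left _ _)
  obtain ⟨a, h, rfl, hs, hp, hf, hsmall⟩ :=
    exists_displacement f.smooth_toFun (sq_nonneg ρ₀) hρ₀4 h0
  have hderiv : ∀ s, torusDist s f (Torus.rotation (Torus.proj a)) < 1 →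
      ∀ σ < s, ∀ x, ‖iteratedFDeriv ℝ (σ + 1) h x‖ ≤ 1 := by
    intro s hlt σ hσ x
    rw [← ENNReal.ofReal_one] at hlt
    obtain ⟨k, hk⟩ := exists_displacement_bound hs hf zero_le_one hlt
    rw [← iteratedFDeriv_add_intVec k]
    exact hk _ hσ x
  have hh4 : ∀ x, ‖h x‖ ≤ 1 / 4 := fun x => (hsmall x).trans hρ₀4
  obtain ⟨w, lam, ws, wp, w4, weq, wbound⟩ := hkam a hDio h hp hs fun k =>
    (coeff_interpolation hp hs hρ₀0.le ((min_le_left _ _).trans (by norm_num)) hsmall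
      (fun σ hσ => hderiv _ h1 σ (by omega)) k).trans (min_le_right _ _)
  obtain ⟨v, vs, vp, hv, hv'⟩ := exists_inverse ws wp fun x => (w4 x).trans (by norm_num)
  have vL := lipschitz_inverse ws w4 hv
  have v2 : ∀ x, ‖fderiv ℝ v x‖ ≤ 1 / 2 := fun x => by
    have : LipschitzWith (1 / 2) v := LipschitzWith.of_dist_le_mul fun x y => by
      rw [dist_eq_norm, dist_eq_norm]
      simpa using vL x y
    simpa using norm_fderiv_le_of_lipschitz ℝ this (x₀ := x)
  obtain ⟨φ, hφ⟩ := exists_torusDiffeo vs vp v2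
  refine ⟨φ, isotopicToId_of_lift vs vp v2 hφ, fun x => ?_, fun s η hη hδ hs₁ => ?_⟩
  · obtain ⟨y, rfl⟩ := proj_surjective x
    have hconj := conjugacy_of_translated hs.continuous hp hf hh4 weq vs.continuous vp hv hv' vL
      hrot y
    rw [← hf.2 y, ← hφ.2, ← hφ.2]
    change Torus.proj (y + a + h y + v (y + a + h y)) = Torus.proj (y + v y) + Torus.proj a
    rw [hconj, proj_add]
  · have hρpos := hρ0 s η hη
    have hρ2 : ρ s η ≤ 1 / 2 := min_le_left _ _
    have hρ1 : ρ s η ≤ 1 / (Γ s + 1) := (min_le_right _ _).trans (min_le_left _ _)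
    have hρη : ρ s η ≤ η / (2 * Q s * (Γ s + 1)) := (min_le_right _ _).trans (min_le_right _ _)
    have hΓs := hΓ1 s
    have hQs := hQ0 s
    rw [le_div_iff₀ hΓs] at hρ1
    rw [le_div_iff₀ (by positivity)] at hρη
    obtain ⟨k, hk⟩ := exists_displacement_bound hs hf (sq_nonneg (ρ s η)) hδ
    have hk0 : k = 0 := by
      apply intVec_eq_zero_of_norm_lt
      have e1 : ‖h 0 + intVec k‖ ≤ ρ s η ^ 2 := by simpa using hk 0 le_rfl 0
      have e2 := norm_sub_le (h 0 + intVec k) (h 0)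
      rw [add_sub_cancel_left] at e2
      linarith [hh4 0, hsq _ hρpos.le hρ2]
    have hsm : ∀ x, ‖h x‖ ≤ ρ s η ^ 2 := fun x => by
      simpa [hk0, intVec_zero] using hk 0 le_rfl x
    have hcoeff := coeff_interpolation hp hs hρpos.le (hρ2.trans (by norm_num)) hsm
      (hderiv _ hs₁)
    have hwb : ∀ i ≤ s, ∀ x, ‖iteratedFDeriv ℝ i w x‖ ≤ Γ s * ρ s η := by
      intro i hi x
      have hmem : i ∈ Finset.range (s + 1) := Finset.mem_range.2 (by omega)
      refine (wbound i (ρ s η) hρpos.le (fun k => le_trans ?_ (hcoeff k)) x).trans ?_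
      · gcongr
        · exact one_le_wt k
        · exact Finset.single_le_sum (f := m) (fun _ _ => Nat.zero_le _) hmem
      · gcongr
        exact Finset.single_le_sum (f := G) (fun i _ => hG i) hmem
    have hvb := hQ s w v (Γ s * ρ s η) ws vs hv w4 (mul_nonneg (hΓ0 s) hρpos.le)
      (by nlinarith) hwb
    have hle : Q s * (Γ s * ρ s η) ≤ η / 2 := by
      nlinarith [mul_pos hQs hρpos]
    refine (torusDist_le_of_lift vs hφ (half_pos hη).le fun σ hσ x =>
      (hvb σ hσ x).trans hle).trans_lt ?_
    exact (ENNReal.ofReal_lt_ofReal_iff hη).2 (half_lt_self hη)
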